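/- Let $R$ be a commutative artinian ring and $\Lambda$ an artin $R$-algebra (an $R$-algebra that is finitely generated as an $R$-module). Modules are finitely generated left modules; $\mathrm{mod}(\Lambda)$ is their category. For a family $\mathcal C$ of modules, $\mathcal F(\mathcal C)$ is the class of modules $M$ having a finite filtration $0=M_0\subseteq M_1\subseteq\cdots\subseteq M_s=M$ with each factor $M_{k+1}/M_k$ isomorphic to a member of $\mathcal C$; ${}^{\perp_1}\mathcal X$ is the class of modules $M$ with $\mathrm{Ext}^1(M,X)=0$ for all $X\in\mathcal X$; $\mathrm{add}(M)$ is the class of direct summands of finite direct sums of copies of $M$. A class is \emph{resolving} if it is closed under extensions and under kernels of epimorphisms and contains all projective modules. Given a representative set $P=\{P(i)\}$ of the indecomposable projective modules of an artin algebra $A$ (one from each isomorphism class) and a linear order $\preceq$ on the index set, put $\Delta(i)=P(i)/\mathrm{Tr}_{\bigoplus_{j\succ i}P(j)}(P(i))$ and $\overline\Delta(i)=P(i)/\mathrm{Tr}_{\bigoplus_{j\succeq i}P(j)}(\mathrm{rad}\,P(i))$, where $\mathrm{Tr}_M(N)$ is the submodule of $N$ generated by the images of all morphisms $M\to N$. The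 pair $(A,\preceq)$ is \emph{standardly stratified} if every projective $A$-module is in $\mathcal F(\Delta)$. For $A^{op}$ one uses the representative set $P(i)^*=\mathrm{Hom}_A(P(i),A)$. Let $(\Psi,\mathbf Q,\leq)$ be a proper costratifying system of size $t$ in $\mathrm{mod}(\Lambda)$, that is: $\Psi=\{\Psi(i)\}_{i=1}^t$ and $\mathbf Q=\{Q(i)\}_{i=1}^t$ are families of $\Lambda$-modules with every $Q(i)$ indecomposable, and $\leq$ is a linear order on $\{1,\dots,t\}$, such that (i) $\mathrm{End}_\Lambda(\Psi(i))$ is a division ring for all $i$; (ii) $\mathrm{Hom}_\Lambda(\Psi(i),\Psi(j))=0$ if $i<j$; (iii) for each $i$ there is an exact sequence $0\to Z(i)\to Q(i)\to\Psi(i)\to 0$ with $Z(i)\in\mathcal F(\{\Psi(j):j\leq i\})$; (iv) $\mathrm{Ext}^1_\Lambda(Q(i),\Psi(j))=0$ for all $i,j$. Let $Q=\bigoplus_{i=1}^tQ(i)$, $\Gamma=\mathrm{End}_\Lambda(Q)^{op}$, $F=\mathrm{Hom}_\Lambda(Q,-):\mathrm{mod}(\Lambda)\to\mathrm{mod}(\Gamma)$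 and $G=Q\otimes_\Gamma-:\mathrm{mod}(\Gamma)\to\mathrm{mod}(\Lambda)$. Put ${}_\Gamma P(i)=F(Q(i))$, and let ${}_\Gamma\overline\Delta=\{{}_\Gamma\overline\Delta(i)\}_{i=1}^t$ be formed from ${}_\Gamma P$ and the opposite order $\leq^{op}$. Then: (a) $\{F(Q(i)):1\le i\le t\}$ is a representative set of the indecomposable projective $\Gamma$-modules (with $F(Q(i))\not\simeq F(Q(j))$ for $i\neq j$); $\Gamma$ is basic, i.e. ${}_\Gamma\Gamma$ is a finite direct sum of pairwise non-isomorphic indecomposable modules; and the Grothendieck group $K_0(\Gamma)$ of $\mathrm{mod}(\Gamma)$ has rank $t$. (b) $F$ restricts to an exact equivalence of categories $\mathcal F(\Psi)\to\mathcal F({}_\Gamma\overline\Delta)$ (it carries short exact sequences with terms in $\mathcal F(\Psi)$ to short exact sequences), and $G$ restricts to a functor $\mathcal F({}_\Gamma\overline\Delta)\to\mathcal F(\Psi)$ that is a quasi-inverse of it. (c) $F(\Psi(i))\simeq{}_\Gamma\overline\Delta(i)$ for all $i$. (d) $(\Gamma^{op},\leq^{op})$ is a standardly stratified algebra. (e)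 $\mathrm{add}(Q)=\mathcal F(\Psi)\cap{}^{\perp_1}\mathcal F(\Psi)$. (f) $\mathcal F({}_\Gamma\overline\Delta)$ is resolving and closed under direct summands in $\mathrm{mod}(\Gamma)$. -/

import Mathlib

open CategoryTheory

open scoped TensorProduct

universe u w

noncomputable section

namespace Costrat

section Ring

variable {A : Type u} [Ring A]

/-- Modules with a finite filtration `0 = N 0 ⊆ N 1 ⊆ ⋯ ⊆ N s = M` each of whose factors
`N (k+1) / N k` is isomorphic to a member of the family `C`. -/
def Filt {ι : Type w} (C : ι → ModuleCat.{u} A) : ObjectProperty (ModuleCat.{u} A) :=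
  fun M => ∃ (s : ℕ) (N : ℕ → Submodule A M), N 0 = ⊥ ∧ N s = ⊤ ∧
    ∀ k < s, N k ≤ N (k + 1) ∧
      ∃ i, Nonempty ((N (k + 1) ⧸ (N k).submoduleOf (N (k + 1))) ≃ₗ[A] C i)

/-- The trace of `M` in `N`. -/
def trace (A : Type u) [Ring A] (M N : Type u) [AddCommGroup M] [Module A M]
    [AddCommGroup N] [Module A N] : Submodule A N :=
  ⨆ f : M →ₗ[A] N, LinearMap.range f

/-- `add M`: direct summands of finite direct sums of copies of `M`. -/
def addClosure (M : ModuleCat.{u} A) : ObjectProperty (ModuleCat.{u} A) :=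
  fun X => ∃ (n : ℕ) (s : X →ₗ[A] (Fin n → M)) (r : (Fin n → M) →ₗ[A] X),
    r ∘ₗ s = LinearMap.id

/-- The finitely generated modules `M` with `Ext¹(M, X) = 0` for all `X` in the class. -/
def leftPerpOne (X : ObjectProperty (ModuleCat.{u} A)) : ObjectProperty (ModuleCat.{u} A) :=
  fun M => Module.Finite A M ∧ ∀ Y, X Y → Subsingleton (Abelian.Ext M Y 1)

/-- Resolving classes of finitely generated modules. -/
structure IsResolving (X : ObjectProperty (ModuleCat.{u} A)) : Prop where
  finite : ∀ M, X M → Module.Finite A M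
  extensions : ∀ S : ShortComplex (ModuleCat.{u} A), S.ShortExact → X S.X₁ → X S.X₃ → X S.X₂
  kernels : ∀ S : ShortComplex (ModuleCat.{u} A), S.ShortExact → X S.X₂ → X S.X₃ → X S.X₁
  projectives : ∀ M : ModuleCat.{u} A, Module.Finite A M → Module.Projective A M → X M

/-- `P` contains exactly one module of each isomorphism class of finitely generated
indecomposable projective `A`-modules. -/
structure IsRepresentativeSet {ι : Type w} (P : ι → ModuleCat.{u} A) : Prop where
  finite : ∀ i, Module.Finite A (P i)
  projective : ∀ i, Module.Projective A (P i)
  indecomposable : ∀ i, Indecomposable (P i)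
  not_iso : ∀ i j, i ≠ j → IsEmpty (P i ≃ₗ[A] P j)
  exists_iso : ∀ M : ModuleCat.{u} A, Module.Finite A M → Module.Projective A M →
    Indecomposable M → ∃ i, Nonempty (M ≃ₗ[A] P i)

/-- `A` is basic: the regular module is a finite direct sum of pairwise non-isomorphic
indecomposable modules. -/
def IsBasic (A : Type u) [Ring A] : Prop :=
  ∃ (n : ℕ) (P : Fin n → ModuleCat.{u} A), (∀ i, Indecomposable (P i)) ∧
    (∀ i j, i ≠ j → IsEmpty (P i ≃ₗ[A] P j)) ∧ Nonempty (A ≃ₗ[A] (∀ i, P i))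

/-- Finitely generated `A`-modules. -/
abbrev FG (A : Type u) [Ring A] : Type (u + 1) :=
  {M : ModuleCat.{u} A // Module.Finite A M}

/-- The relations `[Y] = [X] + [Z]`, one for each exact sequence `0 → X → Y → Z → 0`. -/
def K0Relations (A : Type u) [Ring A] : AddSubgroup (FreeAbelianGroup (FG A)) :=
  AddSubgroup.closure {x | ∃ (X Y Z : FG A) (f : X.1 →ₗ[A] Y.1) (g : Y.1 →ₗ[A] Z.1),
    Function.Injective f ∧ Function.Exact f g ∧ Function.Surjective g ∧
    x = FreeAbelianGroup.of Y - FreeAbelianGroup.of X - FreeAbelianGroup.of Z}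

/-- The Grothendieck group of the category of finitely generated `A`-modules. -/
abbrev K0 (A : Type u) [Ring A] : Type (u + 1) :=
  FreeAbelianGroup (FG A) ⧸ K0Relations A

section Standard

variable {ι : Type} [Fintype ι] [LinearOrder ι]

/-- The standard module `Δ(i) = P(i) / Tr_{⨁_{j>i} P(j)} P(i)`; the direct sum is finite and
is written as a product. -/
def standard (P : ι → ModuleCat.{u} A) (i : ι) : ModuleCat.{u} A :=
  ModuleCat.of A (P i ⧸ trace A (∀ j : {j // i < j}, P j) (P i))

/-- The proper standard module `Δ̄(i) = P(i) / Tr_{⨁_{j≥i} P(j)} (rad P(i))`. -/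
def properStandard (P : ι → ModuleCat.{u} A) (i : ι) : ModuleCat.{u} A :=
  ModuleCat.of A (P i ⧸
    (trace A (∀ j : {j // i ≤ j}, P j) (Module.jacobson A (P i))).map
      (Module.jacobson A (P i)).subtype)

/-- The algebra `A`, with the representative set `P` of its indecomposable projectives indexed
by the linearly ordered set `ι`, is standardly stratified. -/
structure IsStandardlyStratified (P : ι → ModuleCat.{u} A) : Prop where
  representative : IsRepresentativeSet P
  projectives : ∀ M : ModuleCat.{u} A, Module.Finite A M → Module.Projective A M →
    Filt (standard P) M

end Standard

/-- The `Aᵒᵖ`-module `P^* = Hom_A(P, A)`. -/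
def dual (P : ModuleCat.{u} A) : ModuleCat.{u} Aᵐᵒᵖ :=
  ModuleCat.of Aᵐᵒᵖ (P →ₗ[A] A)

/-- The `A`-module `⨁ i, Q i` for a finite index set. -/
def sum {ι : Type} [Fintype ι] (Q : ι → ModuleCat.{u} A) : ModuleCat.{u} A :=
  ModuleCat.of A (∀ i, Q i)

/-- The algebra `End_A(M)ᵒᵖ`. Multiplication in `End M` is composition of maps, `f * g = f ∘ g`. -/
abbrev EndOp (M : ModuleCat.{u} A) : Type u := (End M)ᵐᵒᵖ

/-- The functor `F = Hom_A(M, -)`; `γ ∈ End_A(M)ᵒᵖ` acts by `γ • f = f ∘ γ`. -/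
abbrev homFunctor (M : ModuleCat.{u} A) : ModuleCat.{u} A ⥤ ModuleCat.{u} (EndOp M) :=
  preadditiveCoyonedaObj M

/-- The elements `(m γ) ⊗ y - m ⊗ (γ y)`, where `m γ = γ(m)`. Their `A`-span coincides with
their additive span, since `a ((m γ) ⊗ y) = ((a m) γ) ⊗ y`. -/
def balancing (M : ModuleCat.{u} A) (Y : ModuleCat.{u} (EndOp M)) : Submodule A (M ⊗[ℤ] Y) :=
  Submodule.span A {x | ∃ (γ : EndOp M) (m : M) (y : Y),
    x = (γ.unop.hom m) ⊗ₜ[ℤ] y - m ⊗ₜ[ℤ] (γ • y)}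

/-- The map induced by `f` on `M ⊗_ℤ Y`, as an `A`-linear map. -/
def tensorMap (M : ModuleCat.{u} A) {Y Y' : ModuleCat.{u} (EndOp M)} (f : Y ⟶ Y') :
    (M ⊗[ℤ] Y) →ₗ[A] (M ⊗[ℤ] Y') :=
  TensorProduct.AlgebraTensorModule.map (LinearMap.id : M →ₗ[A] M)
    (f.hom.toAddMonoidHom.toIntLinearMap)

theorem tensorMap_tmul (M : ModuleCat.{u} A) {Y Y' : ModuleCat.{u} (EndOp M)} (f : Y ⟶ Y')
    (m : M) (y : Y) : tensorMap M f (m ⊗ₜ[ℤ] y) = m ⊗ₜ[ℤ] (f.hom y) := rfl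

theorem balancing_le (M : ModuleCat.{u} A) {Y Y' : ModuleCat.{u} (EndOp M)} (f : Y ⟶ Y') :
    balancing M Y ≤ (balancing M Y').comap (tensorMap M f) := by
  refine Submodule.span_le.2 ?_
  rintro _ ⟨γ, m, y, rfl⟩
  refine Submodule.subset_span ⟨γ, m, f.hom y, ?_⟩
  rw [map_sub, tensorMap_tmul, tensorMap_tmul, map_smul]

/-- The functor `G = M ⊗_Γ -` with `Γ = End_A(M)ᵒᵖ`. -/
def tensorFunctor (M : ModuleCat.{u} A) : ModuleCat.{u} (EndOp M) ⥤ ModuleCat.{u} A where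
  obj Y := ModuleCat.of A ((M ⊗[ℤ] Y) ⧸ balancing M Y)
  map {Y Y'} f := ModuleCat.ofHom
    (Submodule.mapQ (balancing M Y) (balancing M Y') (tensorMap M f) (balancing_le M f))
  map_id Y := by
    refine ModuleCat.hom_ext (LinearMap.ext fun x => ?_)
    obtain ⟨x, rfl⟩ := Submodule.Quotient.mk_surjective _ x
    induction x using TensorProduct.induction_on with
    | zero => simp
    | tmul m y => rfl
    | add x y hx hy => rw [Submodule.Quotient.mk_add, map_add, hx, hy, map_add]
  map_comp f g := by
    refine ModuleCat.hom_ext (LinearMap.ext fun x => ?_)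
    obtain ⟨x, rfl⟩ := Submodule.Quotient.mk_surjective _ x
    induction x using TensorProduct.induction_on with
    | zero => simp
    | tmul m y => rfl
    | add x y hx hy => rw [Submodule.Quotient.mk_add, map_add, hx, hy, map_add]

end Ring

/-- Proper costratifying systems `(Ψ, Q, ≤)` in the category of finitely generated `A`-modules,
indexed by a finite linearly ordered set `ι`; the size is the cardinality of `ι`. -/
structure IsProperCostratifyingSystem {A : Type u} [Ring A] {ι : Type} [Fintype ι]
    [LinearOrder ι] (Ψ Q : ι → ModuleCat.{u} A) : Prop where
  finite_Ψ : ∀ i, Module.Finite A (Ψ i)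
  finite_Q : ∀ i, Module.Finite A (Q i)
  indecomposable : ∀ i, Indecomposable (Q i)
  /-- `End(Ψ(i))` is a division ring. -/
  division : ∀ i, Nontrivial (Module.End A (Ψ i)) ∧
    ∀ f : Module.End A (Ψ i), f ≠ 0 → IsUnit f
  hom_eq_zero : ∀ i j, i < j → ∀ f : Ψ i →ₗ[A] Ψ j, f = 0
  exact_sequence : ∀ i, ∃ (Z : ModuleCat.{u} A) (α : Z →ₗ[A] Q i) (β : Q i →ₗ[A] Ψ i),
    Function.Injective α ∧ Function.Exact α β ∧ Function.Surjective β ∧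
    Filt (fun j : {j // j ≤ i} => Ψ j) Z
  ext_eq_zero : ∀ i j, Subsingleton (Abelian.Ext (Q i) (Ψ j) 1)

/-- `F` restricts to an equivalence from the full subcategory `X` to the full subcategory `Y`,
exact in the sense that it sends short exact sequences with terms in `X` to short exact
sequences, and `G` restricts to a quasi-inverse of it. -/
def IsExactEquivalenceWithQuasiInverse {A B : Type u} [Ring A] [Ring B]
    (X : ObjectProperty (ModuleCat.{u} A)) (Y : ObjectProperty (ModuleCat.{u} B))
    (F : ModuleCat.{u} A ⥤ ModuleCat.{u} B) [F.Additive]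
    (G : ModuleCat.{u} B ⥤ ModuleCat.{u} A) : Prop :=
  ∃ (hF : ∀ M : X.FullSubcategory, Y ((X.ι ⋙ F).obj M))
    (hG : ∀ N : Y.FullSubcategory, X ((Y.ι ⋙ G).obj N)),
    (Y.lift (X.ι ⋙ F) hF).IsEquivalence ∧
    (∀ S : ShortComplex (ModuleCat.{u} A), X S.X₁ → X S.X₂ → X S.X₃ →
      S.ShortExact → (S.map F).ShortExact) ∧
    Nonempty (Y.lift (X.ι ⋙ F) hF ⋙ X.lift (Y.ι ⋙ G) hG ≅ 𝟭 X.FullSubcategory) ∧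
    Nonempty (X.lift (Y.ι ⋙ G) hG ⋙ Y.lift (X.ι ⋙ F) hF ≅ 𝟭 Y.FullSubcategory)

/-- The family `P(i) = F(Q(i))` of modules over `Γ = End_A(Q)ᵒᵖ`, `Q = ⨁ i, Q i`, indexed by
`ι` with the opposite order. -/
def ΓP {A : Type u} [Ring A] {ι : Type} [Fintype ι] (Q : ι → ModuleCat.{u} A) :
    ιᵒᵈ → ModuleCat.{u} (EndOp (sum Q)) :=
  fun i => (homFunctor (sum Q)).obj (Q (OrderDual.ofDual i))

end Costrat

end

/-!
Write `F = Hom(Q, -)` and `Γ = End(Q)ᵒᵖ`. By (iv), maps from `Q` lift along every epimorphism whose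
kernel is filtered by `Ψ`, so `F` is exact on `Ψ`-filtered modules; by (iii) and a horseshoe
argument every such module `M` has a presentation by objects of `add Q` that `F` keeps exact. As
`F` is fully faithful on `add Q` and the counit `Q ⊗ F(M) → M` is bijective there, both facts pass
to all `Ψ`-filtered modules. Essential surjectivity follows by induction along a filtration over
`Γ`: the one-step extensions are pushouts of the images under `F` of the sequences (iii).

Over `Γ`, for the opposite order, the modules `FΨ(i)` have division rings of endomorphisms and
maps between them in one direction only, and each is covered by the indecomposable projective
`FQ(i)` with a kernel filtered by the `FΨ(j)`, `j ≥ i`. This makes the kernel of the cover the trace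
of the `FQ(j)`, `j ≥ i`, in `rad FQ(i)`, whence `FΨ(i)` is a proper standard module. In a filtered
module the trace of the `FQ(j)` with `j` in an upper set cuts out the factors with these indices, so
that closure under kernels of epimorphisms and under summands reduces to a single index.

For (d), filter the dual `X* = Hom(X, Γ)` of a projective `X` by the forms with values in the trace
ideals of the `FQ(j)`, `j ≥ a`. A basis of `Hom(X, FΨ(a))` over the division ring `End FΨ(a)` lifts
to a map `X → FQ(a)ⁿ` along which `Hom(-, N)` is bijective for every `N` filtered by `FΨ(a)` alone.
Applied to the layers of the trace filtration of `Γ`, this identifies the layers of `X*` with powers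
of the standard modules of `Γᵒᵖ`.
-/

namespace Costrat

noncomputable section

section LinearMaps

variable {A : Type*} [Ring A] {M N L : Type*} [AddCommGroup M] [Module A M]
  [AddCommGroup N] [Module A N] [AddCommGroup L] [Module A L]

theorem exists_comp_eq_of_ker_le {π : M →ₗ[A] N} (hπ : Function.Surjective π) {f : M →ₗ[A] L}
    (h : LinearMap.ker π ≤ LinearMap.ker f) : ∃ d : N →ₗ[A] L, d ∘ₗ π = f :=
  ⟨(LinearMap.ker π).liftQ f h ∘ₗ (π.quotKerEquivOfSurjective hπ).symm.toLinearMap,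
    LinearMap.ext fun x => by simp⟩

theorem nonempty_equiv_of_ker_eq {f : M →ₗ[A] N} {g : M →ₗ[A] L} (hf : Function.Surjective f)
    (hg : Function.Surjective g) (h : LinearMap.ker f = LinearMap.ker g) :
    Nonempty (N ≃ₗ[A] L) :=
  ⟨(f.quotKerEquivOfSurjective hf).symm ≪≫ₗ Submodule.quotEquivOfEq _ _ h ≪≫ₗ
    g.quotKerEquivOfSurjective hg⟩

/-- The identification of the first term of a short exact sequence with a kernel. -/
def kerEquivOfExact {f : L →ₗ[A] M} {g : M →ₗ[A] N} (hf : Function.Injective f)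
    (hfg : Function.Exact f g) : L ≃ₗ[A] LinearMap.ker g :=
  .ofInjective f hf ≪≫ₗ .ofEq _ _ hfg.linearMap_ker_eq.symm

theorem not_isUnit_subtype_comp {U : Submodule A M} (hU : U ≠ ⊤) (g : M →ₗ[A] U) :
    ¬ IsUnit (U.subtype ∘ₗ g : Module.End A M) := by
  intro hu
  have surjective : Function.Surjective U.subtype :=
    .of_comp (g := g) ((Module.End.isUnit_iff _).1 hu).2
  exact hU (U.range_subtype.symm.trans (LinearMap.range_eq_top.2 surjective))

theorem isDedekindFiniteMonoid_end [IsNoetherian A M] :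
    IsDedekindFiniteMonoid (Module.End A M) where
  mul_eq_one_symm {x y} h := by
    have x_surjective : Function.Surjective x := fun m => ⟨y m, LinearMap.congr_fun h m⟩
    have isUnit : IsUnit x := (Module.End.isUnit_iff x).2
      (IsNoetherian.bijective_of_surjective_endomorphism x x_surjective)
    rw [← isUnit.mul_right_inj, ← mul_assoc, h, one_mul, mul_one]

/-- Both sides are the intersection `U ⊓ V`, as a submodule of `V` and of `U`. -/
def comapSubtypeComm (U V : Submodule A M) : U.comap V.subtype ≃ₗ[A] V.comap U.subtype where
  toFun x := ⟨⟨x.1.1, x.2⟩, x.1.2⟩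
  invFun x := ⟨⟨x.1.1, x.2⟩, x.1.2⟩
  map_add' _ _ := rfl
  map_smul' _ _ := rfl

/-- The second isomorphism theorem for `U + V = M`. -/
def quotComapSubtypeEquiv {U V : Submodule A M} (h : V ⊔ U = ⊤) :
    (V ⧸ U.comap V.subtype) ≃ₗ[A] M ⧸ U :=
  Submodule.quotEquivOfEq _ _ (by rw [LinearMap.ker_comp, Submodule.ker_mkQ]) ≪≫ₗ
    (U.mkQ ∘ₗ V.subtype).quotKerEquivOfSurjective (by
      rw [← LinearMap.range_eq_top, LinearMap.range_comp, Submodule.range_subtype,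
        Submodule.map_mkQ_eq_top, sup_comm, h])

/-- An injective map identifies the factor of `V` by `U` with the factor of the images. -/
def factorMapEquiv {f : M →ₗ[A] N} (hf : Function.Injective f) (U V : Submodule A M) :
    ((V.map f) ⧸ (U.map f).submoduleOf (V.map f)) ≃ₗ[A] V ⧸ U.submoduleOf V :=
  (Submodule.Quotient.equiv _ _ (Submodule.equivMapOfInjective f hf V) <| by
    refine Submodule.ext fun x => ?_
    simp only [Submodule.mem_map, Submodule.submoduleOf, Submodule.mem_comap,
      Submodule.subtype_apply]
    constructor
    · rintro ⟨y, hy, rfl⟩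
      exact ⟨y, hy, rfl⟩
    · rintro ⟨y, hy, hyx⟩
      obtain ⟨z, hz, hzx⟩ := x.2
      obtain rfl : y = z := hf (hyx.trans hzx.symm)
      exact ⟨⟨y, hz⟩, hy, Subtype.ext hyx⟩).symm

end LinearMaps

section Filtrations

variable {A : Type u} [Ring A] {ι : Type*}

/-- `IsFiltered C s M`: the module `M` is obtained from the zero module by finitely many
extensions by members `C j` with `j ∈ s`. This is `Filt` for unbundled modules, with the
allowed indices as a parameter and the filtration peeled off from the top factor. -/
inductive IsFiltered (C : ι → ModuleCat.{u} A) (s : Set ι) :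
    ∀ (M : Type u) [AddCommGroup M] [Module A M], Prop
  | zero {M} [AddCommGroup M] [Module A M] [Subsingleton M] : IsFiltered C s M
  | step {M} [AddCommGroup M] [Module A M] (j : ι) (hj : j ∈ s) (π : M →ₗ[A] C j)
      (hπ : Function.Surjective π) : IsFiltered C s (LinearMap.ker π) → IsFiltered C s M

variable {C : ι → ModuleCat.{u} A} {s t : Set ι} {M N L : Type u} [AddCommGroup M] [Module A M]
  [AddCommGroup N] [Module A N] [AddCommGroup L] [Module A L]

namespace IsFiltered

theorem of_equiv (h : IsFiltered C s M) (e : N ≃ₗ[A] M) : IsFiltered C s N := by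
  induction h generalizing N with
  | zero =>
    have := e.toEquiv.subsingleton
    exact .zero
  | step j hj π hπ _ ih =>
    exact .step j hj (π ∘ₗ e.toLinearMap) (hπ.comp e.surjective)
      (ih (e.ofSubmodule' (LinearMap.ker π)))

theorem mono (h : IsFiltered C s M) (hst : s ⊆ t) : IsFiltered C t M := by
  induction h with
  | zero => exact .zero
  | step j hj π hπ _ ih => exact .step j (hst hj) π hπ ih

theorem of_exact (hL : IsFiltered C s L) (f : N →ₗ[A] M) (g : M →ₗ[A] L)
    (hf : Function.Injective f) (hfg : Function.Exact f g) (hg : Function.Surjective g)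
    (hN : IsFiltered C s N) : IsFiltered C s M := by
  induction hL generalizing M with
  | zero =>
    exact hN.of_equiv (LinearEquiv.ofBijective f
      ⟨hf, fun x => (hfg x).1 (Subsingleton.elim _ _)⟩).symm
  | step j hj π hπ _ ih =>
    refine .step j hj (π ∘ₗ g) (hπ.comp hg) <|
      ih (f.codRestrict _ fun x => by simp [hfg.apply_apply_eq_zero])
        (g.restrict fun x hx => hx) (fun x y hxy => hf (congrArg Subtype.val hxy)) ?_ ?_
    · refine fun x => ⟨fun hx => ?_, ?_⟩
      · obtain ⟨y, hy⟩ := (hfg x).1 (congrArg Subtype.val hx)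
        exact ⟨y, Subtype.ext hy⟩
      · rintro ⟨y, rfl⟩
        exact Subtype.ext (hfg.apply_apply_eq_zero y)
    · rintro ⟨y, hy⟩
      obtain ⟨x, rfl⟩ := hg y
      exact ⟨⟨x, hy⟩, rfl⟩

theorem of_submodule (K : Submodule A M) (hK : IsFiltered C s K)
    (hQ : IsFiltered C s (M ⧸ K)) : IsFiltered C s M :=
  hQ.of_exact K.subtype K.mkQ K.injective_subtype
    (LinearMap.exact_subtype_mkQ K) K.mkQ_surjective hK

theorem of_eq_top {K : Submodule A M} (hK : IsFiltered C s K) (h : K = ⊤) : IsFiltered C s M :=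
  hK.of_equiv (LinearEquiv.ofTop K h).symm

theorem of_member {j : ι} (hj : j ∈ s) (e : M ≃ₗ[A] C j) : IsFiltered C s M := by
  refine .step j hj e.toLinearMap e.surjective ?_
  have : Subsingleton (LinearMap.ker e.toLinearMap) := by
    rw [LinearEquiv.ker]
    infer_instance
  exact .zero

theorem prod (hM : IsFiltered C s M) (hN : IsFiltered C s N) : IsFiltered C s (M × N) :=
  hN.of_exact (LinearMap.inl A M N) (LinearMap.snd A M N) LinearMap.inl_injective
    Function.Exact.inl_snd LinearMap.snd_surjective hM

theorem pi {κ : Type} [Finite κ] {X : κ → Type u} [∀ k, AddCommGroup (X k)]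
    [∀ k, Module A (X k)] (h : ∀ k, IsFiltered C s (X k)) :
    IsFiltered C s (∀ k, X k) := by
  suffices pi_fin : ∀ (n : ℕ) (Y : Fin n → Type u) [∀ k, AddCommGroup (Y k)]
      [∀ k, Module A (Y k)], (∀ k, IsFiltered C s (Y k)) → IsFiltered C s (∀ k, Y k) from
    (pi_fin _ _ fun k => h ((Finite.equivFin κ).symm k)).of_equiv
      (LinearEquiv.piCongrLeft A X (Finite.equivFin κ).symm).symm
  intro n
  induction n with
  | zero => exact fun _ _ _ _ => .zero
  | succ n ih =>
    exact fun Y _ _ hY => ((hY 0).prod (ih _ fun k => hY k.succ)).of_equiv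
      (Fin.consLinearEquiv A Y).symm

theorem of_family {ι' : Type*} {C' : ι' → ModuleCat.{u} A} {s' : Set ι'}
    (h : IsFiltered C s M) (H : ∀ j ∈ s, IsFiltered C' s' (C j)) : IsFiltered C' s' M := by
  induction h with
  | zero => exact .zero
  | step j hj π hπ _ ih =>
    exact (H j hj).of_exact (LinearMap.ker π).subtype π (Submodule.injective_subtype _)
      (LinearMap.exact_subtype_ker_map π) hπ ih

theorem of_factor {U V : Submodule A M} (hUV : U ≤ V) (hU : IsFiltered C s U)
    (hVU : IsFiltered C s (V ⧸ U.submoduleOf V)) : IsFiltered C s V :=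
  of_submodule (U.submoduleOf V) (hU.of_equiv (Submodule.submoduleOfEquivOfLe hUV)) hVU

theorem quotient_map_subtype {j : ι} (hj : j ∈ s) {π : M →ₗ[A] C j}
    (hπ : Function.Surjective π) {W : Submodule A (LinearMap.ker π)}
    (hW : IsFiltered C s (LinearMap.ker π ⧸ W)) :
    IsFiltered C s (M ⧸ W.map (LinearMap.ker π).subtype) := by
  let K := LinearMap.ker π
  have map_le : W.map K.subtype ≤ K := Submodule.map_subtype_le K W
  refine (of_member hj (.refl A _)).of_exact
    (W.mapQ (W.map K.subtype) K.subtype (Submodule.le_comap_map _ _))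
    ((W.map K.subtype).liftQ π map_le) ?_ ?_ ?_ hW
  · rw [← LinearMap.ker_eq_bot, Submodule.ker_mapQ,
      Submodule.comap_map_eq_of_injective K.injective_subtype, Submodule.mkQ_map_self]
  · rw [LinearMap.exact_iff, Submodule.ker_liftQ, Submodule.range_mapQ, K.range_subtype]
  · rw [← LinearMap.range_eq_top, Submodule.range_liftQ, LinearMap.range_eq_top.2 hπ]

theorem ker_of_submodule (f : M →ₗ[A] N) (U : Submodule A M)
    (hU : IsFiltered C s (LinearMap.ker (f.submoduleMap U)))
    (hMU : IsFiltered C s (LinearMap.ker (U.mapQ (U.map f) f (U.le_comap_map f)))) :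
    IsFiltered C s (LinearMap.ker f) := by
  let K := LinearMap.ker f
  have ker_submoduleMap : LinearMap.ker (f.submoduleMap U) = K.comap U.subtype := by
    ext x
    simp [K, LinearMap.submoduleMap, Subtype.ext_iff]
  have ker_mapQ : LinearMap.ker (U.mapQ (U.map f) f (U.le_comap_map f)) =
      LinearMap.range (U.mkQ ∘ₗ K.subtype) := by
    rw [Submodule.ker_mapQ, Submodule.comap_map_eq, Submodule.map_sup, Submodule.mkQ_map_self,
      bot_sup_eq, LinearMap.range_comp, Submodule.range_subtype]
  rw [ker_submoduleMap] at hU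
  rw [ker_mapQ] at hMU
  refine of_submodule (U.comap K.subtype) (hU.of_equiv (comapSubtypeComm U K))
    (hMU.of_equiv (Submodule.quotEquivOfEq _ _ ?_ ≪≫ₗ LinearMap.quotKerEquivRange _))
  rw [LinearMap.ker_comp, Submodule.ker_mkQ]

theorem hom_to_eq_zero (hN : IsFiltered C s N) (h : ∀ j ∈ s, ∀ g : M →ₗ[A] C j, g = 0)
    (f : M →ₗ[A] N) : f = 0 := by
  induction hN with
  | zero => exact LinearMap.ext fun _ => Subsingleton.elim _ _
  | step j hj π _ _ ih =>
    have hf : ∀ x, f x ∈ LinearMap.ker π := LinearMap.congr_fun (h j hj (π ∘ₗ f))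
    ext x
    exact congrArg Subtype.val (LinearMap.congr_fun (ih (f.codRestrict _ hf)) x)

theorem hom_from_eq_zero (hM : IsFiltered C s M) (h : ∀ j ∈ s, ∀ g : C j →ₗ[A] N, g = 0)
    (f : M →ₗ[A] N) : f = 0 := by
  induction hM with
  | zero => exact LinearMap.ext fun x => by rw [Subsingleton.elim x 0, map_zero, map_zero]
  | step j hj π hπ _ ih =>
    have hker : LinearMap.ker π ≤ LinearMap.ker f := fun x hx =>
      LinearMap.congr_fun (ih (f ∘ₗ (LinearMap.ker π).subtype)) ⟨x, hx⟩
    obtain ⟨d, rfl⟩ := exists_comp_eq_of_ker_le hπ hker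
    rw [h j hj d, LinearMap.zero_comp]

end IsFiltered

theorem isFiltered_of_filt {M : ModuleCat.{u} A} (h : Filt C M) : IsFiltered C Set.univ M := by
  obtain ⟨n, N, h0, hn, hN⟩ := h
  have isFiltered_term : ∀ k ≤ n, IsFiltered C Set.univ (N k) := fun k => by
    induction k with
    | zero => exact fun _ => h0 ▸ .zero
    | succ k ih =>
      intro hk
      obtain ⟨hle, i, ⟨e⟩⟩ := hN k hk
      exact (ih (by lia)).of_factor hle (.of_member (Set.mem_univ i) e)
  exact (isFiltered_term n le_rfl).of_eq_top hn

theorem filt_of_subsingleton [Subsingleton M] : Filt C (ModuleCat.of A M) :=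
  ⟨0, fun _ => ⊥, rfl, Subsingleton.elim _ _, fun _ hk => absurd hk (Nat.not_lt_zero _)⟩

theorem filt_of_ker {j : ι} (π : M →ₗ[A] C j) (hπ : Function.Surjective π)
    (h : Filt C (ModuleCat.of A (LinearMap.ker π))) : Filt C (ModuleCat.of A M) := by
  obtain ⟨n, N, h0, hn, hN⟩ := h
  let K := LinearMap.ker π
  let N' : ℕ → Submodule A M := fun k => if k ≤ n then (N k).map K.subtype else ⊤
  have map_eq {k : ℕ} (hk : k ≤ n) : N' k = (N k).map K.subtype := if_pos hk
  have eq_top : N' (n + 1) = ⊤ := if_neg n.not_succ_le_self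
  refine ⟨n + 1, N', by rw [map_eq n.zero_le, h0, Submodule.map_bot], eq_top, fun k hk => ?_⟩
  rcases (Nat.lt_succ_iff.1 hk).lt_or_eq with hkn | rfl
  · obtain ⟨hle, i, ⟨e⟩⟩ := hN k hkn
    rw [map_eq hkn.le, map_eq hkn]
    exact ⟨Submodule.map_mono hle, i, ⟨factorMapEquiv K.injective_subtype _ _ ≪≫ₗ e⟩⟩
  · have eq_ker : N' k = K := by rw [map_eq le_rfl, hn, Submodule.map_top, K.range_subtype]
    rw [eq_ker, eq_top]
    exact ⟨le_top, j, ⟨Submodule.Quotient.equiv _ K Submodule.topEquiv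
      (by ext; simp [Submodule.submoduleOf]) ≪≫ₗ π.quotKerEquivOfSurjective hπ⟩⟩

theorem filt_iff_isFiltered {M : ModuleCat.{u} A} : Filt C M ↔ IsFiltered C Set.univ M := by
  refine ⟨isFiltered_of_filt, fun h => ?_⟩
  have filt_of : ∀ (X : Type u) [AddCommGroup X] [Module A X], IsFiltered C Set.univ X →
      Filt C (ModuleCat.of A X) := fun X _ _ hX => by
    induction hX with
    | zero => exact filt_of_subsingleton
    | step j _ π hπ _ ih => exact filt_of_ker π hπ ih
  exact filt_of M h

theorem filt_subtype_iff_isFiltered {M : ModuleCat.{u} A} :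
    Filt (fun j : s => C j) M ↔ IsFiltered C s M := by
  rw [filt_iff_isFiltered]
  exact ⟨fun h => h.of_family fun j _ => .of_member j.2 (.refl A _), fun h => h.of_family
    fun j hj => .of_member (C := fun j : s => C j) (Set.mem_univ ⟨j, hj⟩) (.refl A _)⟩

end Filtrations

section Indecomposable

/-- A nonzero module whose only idempotent endomorphisms are `0` and `1`: indecomposability
for unbundled modules. -/
structure IsIndec (A : Type*) [Ring A] (M : Type*) [AddCommGroup M] [Module A M] : Prop where
  nontrivial : Nontrivial M
  idempotent : ∀ e : Module.End A M, e * e = e → e = 0 ∨ e = 1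

variable {A : Type*} [Ring A] {M N : Type*} [AddCommGroup M] [Module A M]
  [AddCommGroup N] [Module A N]

theorem exists_isCompl_of_not_isIndec [Nontrivial M] (h : ¬ IsIndec A M) :
    ∃ U V : Submodule A M, IsCompl U V ∧ U ≠ ⊤ ∧ V ≠ ⊤ := by
  obtain ⟨e, he, he0, he1⟩ : ∃ e : Module.End A M, e * e = e ∧ e ≠ 0 ∧ e ≠ 1 := by
    by_contra! hc
    exact h ⟨‹_›, fun e he => or_iff_not_imp_left.2 (hc e he)⟩
  refine ⟨_, _, LinearMap.IsIdempotentElem.isCompl (f := e) he, fun hr => he1 ?_,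
    fun hk => he0 (LinearMap.ker_eq_top.1 hk)⟩
  ext x
  obtain ⟨y, rfl⟩ := LinearMap.range_eq_top.1 hr x
  exact LinearMap.congr_fun he y

namespace IsIndec

theorem eq_bot_or_eq_bot (h : IsIndec A M) {U V : Submodule A M} (hUV : IsCompl U V) :
    U = ⊥ ∨ V = ⊥ := by
  rcases h.idempotent _ (Submodule.isIdempotentElem_projection hUV) with h0 | h1
  · exact .inl (by rw [← Submodule.range_projection hUV, h0, LinearMap.range_zero])
  · exact .inr (by rw [← Submodule.ker_projection hUV, h1]; exact LinearMap.ker_id)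

theorem isUnit_or_isNilpotent [IsNoetherian A M] [IsArtinian A M] (h : IsIndec A M)
    (f : Module.End A M) : IsUnit f ∨ IsNilpotent f := by
  obtain ⟨n, hn⟩ := Filter.eventually_atTop.1 f.eventually_isCompl_ker_pow_range_pow
  have isCompl := hn (n + 1) n.le_succ
  rcases h.eq_bot_or_eq_bot isCompl with ker_eq | range_eq
  · have range_eq : LinearMap.range (f ^ (n + 1)) = ⊤ := by
      simpa only [ker_eq, bot_sup_eq] using isCompl.sup_eq_top
    refine .inl ((Module.End.isUnit_iff f).2 ⟨?_, ?_⟩)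
    · rw [← LinearMap.ker_eq_bot, eq_bot_iff, ← ker_eq, pow_succ]
      exact LinearMap.ker_le_ker_comp f (f ^ n)
    · rw [← LinearMap.range_eq_top, eq_top_iff, ← range_eq, pow_succ']
      exact LinearMap.range_comp_le_range (f ^ n) f
  · exact .inr ⟨n + 1, LinearMap.range_eq_bot.1 range_eq⟩

theorem isLocalRing [IsNoetherian A M] [IsArtinian A M] (h : IsIndec A M) :
    IsLocalRing (Module.End A M) :=
  have := h.nontrivial
  .of_isUnit_or_isUnit_one_sub_self fun f =>
    (h.isUnit_or_isNilpotent f).imp_right IsNilpotent.isUnit_one_sub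

theorem nonempty_equiv_of_isUnit_comp [Nontrivial M] (h : IsIndec A N) (s : M →ₗ[A] N)
    (r : N →ₗ[A] M) (hu : IsUnit (r ∘ₗ s : Module.End A M)) : Nonempty (M ≃ₗ[A] N) := by
  obtain ⟨w, hw⟩ := hu.exists_left_inv
  have left_inv : ∀ x, w (r (s x)) = x := LinearMap.congr_fun hw
  have s_injective : Function.Injective s := Function.LeftInverse.injective (g := w ∘ₗ r) left_inv
  rcases h.idempotent (s ∘ₗ w ∘ₗ r) (by ext x; simp [left_inv]) with h0 | h1
  · obtain ⟨x, hx⟩ := exists_ne (0 : M)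
    refine absurd (s_injective ?_) hx
    simpa [left_inv] using LinearMap.congr_fun h0 (s x)
  · exact ⟨.ofBijective s ⟨s_injective, fun y => ⟨w (r y), LinearMap.congr_fun h1 y⟩⟩⟩

theorem exists_equiv_of_retract_pi [IsLocalRing (Module.End A M)] {κ : Type*} [Finite κ]
    {X : κ → Type*} [∀ k, AddCommGroup (X k)] [∀ k, Module A (X k)]
    (hX : ∀ k, IsIndec A (X k)) (s : M →ₗ[A] ∀ k, X k) (r : (∀ k, X k) →ₗ[A] M)
    (hrs : r ∘ₗ s = LinearMap.id) : ∃ k, Nonempty (M ≃ₗ[A] X k) := by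
  classical
  have := Fintype.ofFinite κ
  have : Nontrivial M := not_subsingleton_iff_nontrivial.1 fun _ =>
    not_subsingleton (Module.End A M) inferInstance
  have sum_eq_one : ∑ k, (r ∘ₗ LinearMap.single A X k) ∘ₗ (LinearMap.proj k ∘ₗ s) =
      (1 : Module.End A M) := by
    ext x
    simp only [LinearMap.sum_apply, LinearMap.comp_apply, LinearMap.proj_apply,
      LinearMap.single_apply, ← map_sum, Finset.univ_sum_single]
    exact LinearMap.congr_fun hrs x
  obtain ⟨k, -, hk⟩ := IsLocalRing.exists_of_isUnit_sum (sum_eq_one ▸ isUnit_one)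
  exact ⟨k, (hX k).nonempty_equiv_of_isUnit_comp _ _ hk⟩

end IsIndec

section ModuleCat

variable {A : Type u} [Ring A]

theorem isIndec_of_indecomposable {M : ModuleCat.{u} A} (h : Indecomposable M) :
    IsIndec A M := by
  have : Nontrivial M := not_subsingleton_iff_nontrivial.1 fun _ =>
    h.1 (ModuleCat.isZero_of_subsingleton M)
  by_contra hM
  obtain ⟨U, V, hUV, hU, hV⟩ := exists_isCompl_of_not_isIndec hM
  have i : M ≅ ModuleCat.of A U ⊞ ModuleCat.of A V :=
    (U.prodEquivOfIsCompl V hUV).symm.toModuleIso ≪≫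
      (ModuleCat.biprodIsoProd (.of A U) (.of A V)).symm
  rcases h.2 _ _ i with h0 | h0
  · have := ModuleCat.subsingleton_of_isZero h0
    exact hV (by simpa [(Submodule.subsingleton_iff_eq_bot (p := U)).1 this] using hUV.sup_eq_top)
  · have := ModuleCat.subsingleton_of_isZero h0
    exact hU (by simpa [(Submodule.subsingleton_iff_eq_bot (p := V)).1 this] using hUV.sup_eq_top)

theorem indecomposable_of_isIndec {M : ModuleCat.{u} A} (h : IsIndec A M) :
    Indecomposable M := by
  have := h.nontrivial
  refine ⟨fun h0 => not_subsingleton M (ModuleCat.subsingleton_of_isZero h0), fun Y Z i => ?_⟩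
  let e : M ⟶ M := i.hom ≫ Limits.biprod.fst ≫ Limits.biprod.inl ≫ i.inv
  have he : e ≫ e = e := by simp [e]
  simp only [Limits.IsZero.iff_id_eq_zero]
  rcases h.idempotent e.hom (congrArg ModuleCat.Hom.hom he) with h0 | h1
  · have e_eq : e = 0 := ModuleCat.hom_ext h0
    left
    calc 𝟙 Y = Limits.biprod.inl ≫ i.inv ≫ e ≫ i.hom ≫ Limits.biprod.fst := by simp [e]
      _ = 0 := by simp [e_eq]
  · have e_eq : e = 𝟙 M := ModuleCat.hom_ext h1
    right
    calc 𝟙 Z = Limits.biprod.inr ≫ i.inv ≫ 𝟙 M ≫ i.hom ≫ Limits.biprod.snd := by simp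
      _ = 0 := by rw [← e_eq]; simp [e]

theorem indecomposable_iff_isIndec {M : ModuleCat.{u} A} : Indecomposable M ↔ IsIndec A M :=
  ⟨isIndec_of_indecomposable, indecomposable_of_isIndec⟩

theorem exists_equiv_pi_isIndec (M : Type u) [AddCommGroup M] [Module A M] [IsNoetherian A M]
    [IsArtinian A M] : ∃ (κ : Type) (_ : Finite κ) (X : κ → ModuleCat.{u} A),
      (∀ k, IsIndec A (X k)) ∧ Nonempty (M ≃ₗ[A] ∀ k, X k) := by
  induction hl : Module.length A M using WellFoundedLT.induction generalizing M with
  | ind l ih =>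
    subst hl
    by_cases hM : IsIndec A M
    · exact ⟨Unit, inferInstance, fun _ => ModuleCat.of A M, fun _ => hM,
        ⟨(LinearEquiv.funUnique Unit A M).symm⟩⟩
    rcases subsingleton_or_nontrivial M with _ | _
    · exact ⟨Empty, inferInstance, Empty.elim, Empty.rec, ⟨.ofSubsingleton _ _⟩⟩
    obtain ⟨U, V, hUV, hU, hV⟩ := exists_isCompl_of_not_isIndec hM
    obtain ⟨κ, _, X, hX, ⟨eU⟩⟩ := ih _ (Submodule.length_lt hU) U rfl
    obtain ⟨κ', _, Y, hY, ⟨eV⟩⟩ := ih _ (Submodule.length_lt hV) V rfl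
    exact ⟨κ ⊕ κ', inferInstance, Sum.elim X Y, Sum.rec hX hY,
      ⟨(U.prodEquivOfIsCompl V hUV).symm ≪≫ₗ eU.prodCongr eV ≪≫ₗ
        (LinearEquiv.sumPiEquivProdPi A κ κ' fun k => ↑(Sum.elim X Y k)).symm⟩⟩

end ModuleCat

end Indecomposable

section Projective

variable {A : Type*} [Ring A] {M : Type*} [AddCommGroup M] [Module A M] [Module.Projective A M]

theorem eq_top_or_eq_top_of_sup_eq_top [IsLocalRing (Module.End A M)] {U V : Submodule A M}
    (h : U ⊔ V = ⊤) : U = ⊤ ∨ V = ⊤ := by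
  have mkQ_surjective : Function.Surjective (V.mkQ ∘ₗ U.subtype) := by
    intro x
    obtain ⟨x, rfl⟩ := V.mkQ_surjective x
    obtain ⟨a, ha, b, hb, rfl⟩ := Submodule.mem_sup.1 (h ▸ Submodule.mem_top : x ∈ U ⊔ V)
    exact ⟨⟨a, ha⟩, by simp [(Submodule.Quotient.mk_eq_zero V).2 hb]⟩
  obtain ⟨k, hk⟩ := Module.projective_lifting_property _ V.mkQ mkQ_surjective
  simp only [eq_top_iff]
  rcases IsLocalRing.isUnit_or_isUnit_of_add_one
      (add_sub_cancel (U.subtype ∘ₗ k : Module.End A M) 1) with hu | hu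
  · refine .inl fun x _ => ?_
    obtain ⟨y, rfl⟩ := ((Module.End.isUnit_iff _).1 hu).2 x
    exact (k y).2
  · refine .inr fun x _ => ?_
    obtain ⟨y, rfl⟩ := ((Module.End.isUnit_iff _).1 hu).2 x
    rw [← V.ker_mkQ, LinearMap.mem_ker, LinearMap.sub_apply, map_sub, sub_eq_zero]
    exact (LinearMap.congr_fun hk y).symm

theorem IsIndec.le_jacobson [IsNoetherian A M] [IsArtinian A M] (h : IsIndec A M)
    {U : Submodule A M} (hU : U ≠ ⊤) : U ≤ Module.jacobson A M := by
  have := h.isLocalRing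
  refine le_sInf fun m hm => ?_
  by_contra hle
  have sup_eq_top : U ⊔ m = ⊤ :=
    hm.2 _ (lt_of_le_of_ne le_sup_right fun h0 => hle (h0 ▸ le_sup_left))
  exact (eq_top_or_eq_top_of_sup_eq_top sup_eq_top).elim hU hm.1

theorem IsIndec.exists_equiv_of_projective {κ : Type*} [Finite κ] {P : κ → Type*}
    [∀ i, AddCommGroup (P i)] [∀ i, Module A (P i)] (hM : IsIndec A M) [Module.Finite A M]
    [IsNoetherian A M] [IsArtinian A M] (e : A ≃ₗ[A] ∀ i, P i) (hP : ∀ i, IsIndec A (P i)) :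
    ∃ i, Nonempty (M ≃ₗ[A] P i) := by
  have := hM.isLocalRing
  obtain ⟨n, r, s, -, -, hrs⟩ := Module.Finite.exists_comp_eq_id_of_projective A M
  let e' : (Fin n → A) ≃ₗ[A] ∀ x : (_ : Fin n) × κ, P x.2 :=
    .piCongrRight (fun _ => e) ≪≫ₗ (LinearEquiv.piCurry A fun (_ : Fin n) i => P i).symm
  obtain ⟨x, hx⟩ := IsIndec.exists_equiv_of_retract_pi (fun x => hP x.2)
    (e'.toLinearMap ∘ₗ s) (r ∘ₗ e'.symm.toLinearMap)
    (LinearMap.ext fun x => by simpa using LinearMap.congr_fun hrs x)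
  exact ⟨x.2, hx⟩

theorem IsFiltered.of_projective {A : Type u} [Ring A] [IsArtinianRing A] {M : Type u}
    [AddCommGroup M] [Module A M] [Module.Projective A M] [Module.Finite A M] {ι : Type*}
    {C : ι → ModuleCat.{u} A} {s : Set ι} {κ : Type*} [Finite κ] {P : κ → Type u}
    [∀ i, AddCommGroup (P i)] [∀ i, Module A (P i)] (e : A ≃ₗ[A] ∀ i, P i)
    (hP : ∀ i, IsIndec A (P i)) (hC : ∀ i, IsFiltered C s (P i)) : IsFiltered C s M := by
  classical
  obtain ⟨κ', _, X, hX, ⟨e'⟩⟩ := exists_equiv_pi_isIndec (A := A) M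
  refine (IsFiltered.pi fun k => ?_).of_equiv e'
  have : Module.Finite A (∀ k, X k) := .equiv e'
  have : Module.Projective A (∀ k, X k) := .of_equiv e'
  have : Module.Finite A (X k) :=
    .of_surjective (LinearMap.proj (φ := fun k => X k) k) (LinearMap.proj_surjective k)
  have : Module.Projective A (X k) :=
    .of_split (LinearMap.single A (fun k => X k) k) (LinearMap.proj k) (by ext; simp)
  obtain ⟨i, ⟨ek⟩⟩ := (hX k).exists_equiv_of_projective e hP
  exact (hC i).of_equiv ek

end Projective

section Trace

variable {A : Type u} [Ring A] {κ : Type*} {P : κ → ModuleCat.{u} A} {s : Set κ}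
  {M N : Type u} [AddCommGroup M] [Module A M] [AddCommGroup N] [Module A N]

/-- The submodule of `M` generated by the images of the modules `P j`, `j ∈ s`; by `trace_pi`
this is `Tr_{⨁_{j ∈ s} P j}(M)`. -/
def traceOn (P : κ → ModuleCat.{u} A) (s : Set κ) (M : Type u) [AddCommGroup M] [Module A M] :
    Submodule A M :=
  ⨆ j : s, trace A (P j) M

theorem range_le_traceOn {j : κ} (hj : j ∈ s) (f : P j →ₗ[A] M) :
    LinearMap.range f ≤ traceOn P s M :=
  (le_iSup (fun f : P j →ₗ[A] M => LinearMap.range f) f).trans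
    (le_iSup (fun j : s => trace A (P j) M) ⟨j, hj⟩)

theorem apply_mem_traceOn {j : κ} (hj : j ∈ s) (f : P j →ₗ[A] M) (x : P j) :
    f x ∈ traceOn P s M :=
  range_le_traceOn hj f ⟨x, rfl⟩

theorem traceOn_le {U : Submodule A M} (h : ∀ j ∈ s, ∀ f : P j →ₗ[A] M, LinearMap.range f ≤ U) :
    traceOn P s M ≤ U :=
  iSup_le fun j => iSup_le fun f => h j j.2 f

theorem map_traceOn_le (g : M →ₗ[A] N) : (traceOn P s M).map g ≤ traceOn P s N := by
  rw [Submodule.map_le_iff_le_comap]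
  refine traceOn_le fun j hj f => ?_
  rintro _ ⟨x, rfl⟩
  exact apply_mem_traceOn hj (g ∘ₗ f) x

theorem map_mem_traceOn (g : M →ₗ[A] N) {x : M} (hx : x ∈ traceOn P s M) :
    g x ∈ traceOn P s N :=
  map_traceOn_le g ⟨x, hx, rfl⟩

theorem map_traceOn_eq (hP : ∀ j, Module.Projective A (P j)) (g : M →ₗ[A] N)
    (hg : Function.Surjective g) : (traceOn P s M).map g = traceOn P s N := by
  refine le_antisymm (map_traceOn_le g) (traceOn_le fun j hj f => ?_)
  obtain ⟨f', rfl⟩ := Module.projective_lifting_property g f hg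
  rintro _ ⟨x, rfl⟩
  exact ⟨f' x, apply_mem_traceOn hj f' x, rfl⟩

theorem traceOn_mono {t : Set κ} (hst : s ⊆ t) : traceOn P s M ≤ traceOn P t M :=
  traceOn_le fun _ hj f => range_le_traceOn (hst hj) f

theorem traceOn_induction {p : M → Prop} (hf : ∀ j ∈ s, ∀ (f : P j →ₗ[A] M) (x : P j), p (f x))
    (h0 : p 0) (hadd : ∀ x y, p x → p y → p (x + y)) {x : M} (hx : x ∈ traceOn P s M) : p x := by
  refine Submodule.iSup_induction _ (motive := p) hx (fun j y hy => ?_) h0 hadd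
  refine Submodule.iSup_induction _ (motive := p) hy ?_ h0 hadd
  rintro f _ ⟨z, rfl⟩
  exact hf j j.2 f z

theorem trace_pi {κ : Type} {P : κ → ModuleCat.{u} A} (s : Set κ) [Finite s] :
    trace A (∀ j : s, P j) M = traceOn P s M := by
  classical
  have := Fintype.ofFinite s
  apply le_antisymm
  · refine iSup_le fun f => ?_
    rintro _ ⟨x, rfl⟩
    rw [← Finset.univ_sum_single x, map_sum]
    exact Submodule.sum_mem _ fun j _ =>
      apply_mem_traceOn j.2 (f ∘ₗ LinearMap.single A (fun j : s => P j) j) (x j)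
  · refine traceOn_le fun j hj f => ?_
    rintro _ ⟨x, rfl⟩
    exact le_iSup (fun f : (∀ j : s, P j) →ₗ[A] M => LinearMap.range f)
      (f ∘ₗ LinearMap.proj (⟨j, hj⟩ : s)) ⟨Pi.single ⟨j, hj⟩ x, by simp⟩

end Trace

/-- The data of a proper stratification of `A`: the indecomposable projectives `P i` sum up to
the regular module, and `P i` is an extension of `Ψ i` by a module filtered by the `Ψ j` with
`i ≤ j`. Up to reversing the order this is a proper costratifying system whose second member is
a complete family of projectives. -/
structure IsProperStratification {A : Type u} [Ring A] {κ : Type} [LinearOrder κ]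
    (Ψ P : κ → ModuleCat.{u} A) : Prop where
  finite : ∀ i, Module.Finite A (P i)
  projective : ∀ i, Module.Projective A (P i)
  indec : ∀ i, IsIndec A (P i)
  total : Nonempty (A ≃ₗ[A] ∀ i, P i)
  nontrivial : ∀ i, Nontrivial (Ψ i)
  division : ∀ i (f : Ψ i →ₗ[A] Ψ i), f ≠ 0 → Function.Bijective f
  hom_eq_zero : ∀ i j, j < i → ∀ f : Ψ i →ₗ[A] Ψ j, f = 0
  exists_cover : ∀ i, ∃ β : P i →ₗ[A] Ψ i, Function.Surjective β ∧
    IsFiltered Ψ (Set.Ici i) (LinearMap.ker β)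

namespace IsProperStratification

section TraceFiltration

variable {A : Type u} [Ring A] {κ : Type} [LinearOrder κ] {Ψ P : κ → ModuleCat.{u} A}
  {s t : Set κ} {M N : Type u} [AddCommGroup M] [Module A M] [AddCommGroup N] [Module A N]

/-- A choice of the epimorphism `P i → Ψ i`. -/
def cover (h : IsProperStratification Ψ P) (i : κ) : P i →ₗ[A] Ψ i := (h.exists_cover i).choose

theorem cover_surjective (h : IsProperStratification Ψ P) (i : κ) :
    Function.Surjective (h.cover i) :=
  (h.exists_cover i).choose_spec.1

theorem isFiltered_ker_cover (h : IsProperStratification Ψ P) (i : κ) :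
    IsFiltered Ψ (Set.Ici i) (LinearMap.ker (h.cover i)) :=
  (h.exists_cover i).choose_spec.2

theorem isFiltered_P (h : IsProperStratification Ψ P) (i : κ) :
    IsFiltered Ψ (Set.Ici i) (P i) :=
  .step i Set.self_mem_Ici (h.cover i) (h.cover_surjective i) (h.isFiltered_ker_cover i)

theorem cover_ne_zero (h : IsProperStratification Ψ P) (i : κ) : h.cover i ≠ 0 := by
  have := h.nontrivial i
  rintro h0
  obtain ⟨y, hy⟩ := exists_ne (0 : Ψ i)
  obtain ⟨x, rfl⟩ := h.cover_surjective i y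
  exact hy (by rw [h0, LinearMap.zero_apply])

theorem ker_cover_ne_top (h : IsProperStratification Ψ P) (i : κ) :
    LinearMap.ker (h.cover i) ≠ ⊤ :=
  fun h0 => h.cover_ne_zero i (LinearMap.ker_eq_top.1 h0)

theorem finite_Ψ (h : IsProperStratification Ψ P) (i : κ) : Module.Finite A (Ψ i) :=
  have := h.finite i
  .of_surjective (h.cover i) (h.cover_surjective i)

theorem finite_of_isFiltered (h : IsProperStratification Ψ P) (hM : IsFiltered Ψ s M) :
    Module.Finite A M := by
  induction hM with
  | zero => infer_instance
  | step j _ π hπ _ ih =>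
    have := h.finite_Ψ j
    have : Module.Finite A (_ ⧸ LinearMap.ker π) := .equiv (π.quotKerEquivOfSurjective hπ).symm
    exact .of_submodule_quotient (LinearMap.ker π)

theorem hom_eq_zero_of_isFiltered (h : IsProperStratification Ψ P) (hM : IsFiltered Ψ s M)
    (hN : IsFiltered Ψ t N) (hst : ∀ i ∈ s, ∀ j ∈ t, j < i) (f : M →ₗ[A] N) : f = 0 :=
  hM.hom_from_eq_zero (fun i hi g =>
    hN.hom_to_eq_zero (fun j hj k => h.hom_eq_zero i j (hst i hi j hj) k) g) f

theorem hom_P_eq_zero (h : IsProperStratification Ψ P) {i j : κ} (hij : i < j)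
    (f : P j →ₗ[A] Ψ i) : f = 0 :=
  (h.isFiltered_P j).hom_from_eq_zero (fun l hl g => h.hom_eq_zero l i (hij.trans_le hl) g) f

theorem exists_lift (h : IsProperStratification Ψ P) {j : κ} (g : M →ₗ[A] N)
    (hg : Function.Surjective g) (f : P j →ₗ[A] N) : ∃ f' : P j →ₗ[A] M, g ∘ₗ f' = f :=
  have := h.projective j
  Module.projective_lifting_property g f hg

theorem traceOn_eq_top (h : IsProperStratification Ψ P) (hM : IsFiltered Ψ s M) :
    traceOn P s M = ⊤ := by
  induction hM with
  | zero => exact Subsingleton.elim _ _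
  | step j hj π hπ _ ih =>
    obtain ⟨l, hl⟩ := h.exists_lift π hπ (h.cover j)
    refine eq_top_iff.2 fun m _ => ?_
    obtain ⟨p, hp⟩ := h.cover_surjective j (π m)
    have mem_ker : m - l p ∈ LinearMap.ker π := by
      rw [LinearMap.mem_ker, map_sub, ← hp, ← hl, LinearMap.comp_apply, sub_self]
    have mem_trace : m - l p ∈ traceOn P s _ :=
      map_mem_traceOn (LinearMap.ker π).subtype (x := ⟨m - l p, mem_ker⟩) (ih ▸ trivial)
    rw [← sub_add_cancel m (l p)]
    exact add_mem mem_trace (apply_mem_traceOn hj l p)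

theorem exists_comap_eq_and_map_eq_top (h : IsProperStratification Ψ P) {j : κ}
    (hs : IsUpperSet s) (hj : j ∈ s) {π : M →ₗ[A] Ψ j} (hπ : Function.Surjective π)
    {W : Submodule A (LinearMap.ker π)} (hW : IsFiltered Ψ (t \ s) (LinearMap.ker π ⧸ W)) :
    ∃ U : Submodule A M, U.comap (LinearMap.ker π).subtype = W ∧ U.map π = ⊤ := by
  obtain ⟨l, hl⟩ := h.exists_lift π hπ (h.cover j)
  have l_mem_ker (q : LinearMap.ker (h.cover j)) : l q ∈ LinearMap.ker π :=
    (LinearMap.congr_fun hl q).trans q.2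
  have l_mem_W (q : LinearMap.ker (h.cover j)) : (⟨l q, l_mem_ker q⟩ : LinearMap.ker π) ∈ W := by
    rw [← W.ker_mkQ]
    exact LinearMap.congr_fun (h.hom_eq_zero_of_isFiltered (h.isFiltered_ker_cover j) hW
      (fun a ha b hb => lt_of_not_ge fun hab => hb.2 (hs (le_trans ha hab) hj))
      (W.mkQ ∘ₗ (l ∘ₗ (LinearMap.ker (h.cover j)).subtype).codRestrict _ l_mem_ker)) q
  refine ⟨W.map (LinearMap.ker π).subtype ⊔ LinearMap.range l,
    le_antisymm (fun x hx => ?_) fun x hx => Submodule.mem_sup_left ⟨x, hx, rfl⟩, ?_⟩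
  · obtain ⟨_, ⟨y, hy, rfl⟩, _, ⟨p, rfl⟩, hxy⟩ := Submodule.mem_sup.1 hx
    have p_mem_ker : h.cover j p = 0 := by
      have apply_eq : π (y : M) + π (l p) = π (x : M) := (map_add π _ _).symm.trans (congrArg π hxy)
      rwa [y.2, x.2, zero_add, ← LinearMap.comp_apply, hl] at apply_eq
    rw [show x = y + ⟨l p, l_mem_ker ⟨p, p_mem_ker⟩⟩ from Subtype.ext hxy.symm]
    exact add_mem hy (l_mem_W ⟨p, p_mem_ker⟩)
  · rw [Submodule.map_sup, ← LinearMap.range_comp, hl,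
      LinearMap.range_eq_top.2 (h.cover_surjective j), sup_top_eq]

theorem exists_isFiltered_inter_diff (h : IsProperStratification Ψ P) (hs : IsUpperSet s)
    (hM : IsFiltered Ψ t M) :
    ∃ U : Submodule A M, IsFiltered Ψ (t ∩ s) U ∧ IsFiltered Ψ (t \ s) (M ⧸ U) := by
  induction hM with
  | zero => exact ⟨⊥, .zero, .zero⟩
  | step j hj π hπ _ ih =>
    obtain ⟨W, hW, hW'⟩ := ih
    by_cases hjs : j ∈ s
    · obtain ⟨U, rfl, hU⟩ := h.exists_comap_eq_and_map_eq_top hs hjs hπ hW'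
      have sup_eq_top : LinearMap.ker π ⊔ U = ⊤ := by
        rw [sup_comm, ← Submodule.comap_map_eq, hU, Submodule.comap_top]
      have surjective : Function.Surjective (π ∘ₗ U.subtype) := by
        rw [← LinearMap.range_eq_top, LinearMap.range_comp, Submodule.range_subtype, hU]
      exact ⟨U, .step j ⟨hj, hjs⟩ _ surjective (hW.of_equiv (comapSubtypeComm (LinearMap.ker π) U)),
        hW'.of_equiv (quotComapSubtypeEquiv sup_eq_top).symm⟩
    · exact ⟨W.map (LinearMap.ker π).subtype, hW.of_equiv (Submodule.equivMapOfInjective _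
        (LinearMap.ker π).injective_subtype W).symm,
        hW'.quotient_map_subtype (Set.mem_sdiff_of_mem hj hjs) hπ⟩

theorem eq_traceOn (h : IsProperStratification Ψ P) (hs : IsUpperSet s) {U : Submodule A M}
    (hU : IsFiltered Ψ (t ∩ s) U) (hMU : IsFiltered Ψ (t \ s) (M ⧸ U)) : U = traceOn P s M := by
  refine le_antisymm ?_ (traceOn_le fun i hi f => ?_)
  · calc U = (⊤ : Submodule A U).map U.subtype := (U.map_subtype_top).symm
      _ = (traceOn P s U).map U.subtype := by
        rw [h.traceOn_eq_top (hU.mono Set.inter_subset_right)]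
      _ ≤ traceOn P s M := map_traceOn_le U.subtype
  · have comp_eq_zero : U.mkQ ∘ₗ f = 0 := hMU.hom_to_eq_zero
      (fun j hj => h.hom_P_eq_zero (lt_of_not_ge fun hij => hj.2 (hs hij hi))) _
    rintro _ ⟨x, rfl⟩
    rw [← U.ker_mkQ]
    exact LinearMap.congr_fun comp_eq_zero x

theorem isFiltered_traceOn (h : IsProperStratification Ψ P) (hs : IsUpperSet s)
    (hM : IsFiltered Ψ t M) :
    IsFiltered Ψ (t ∩ s) (traceOn P s M) ∧ IsFiltered Ψ (t \ s) (M ⧸ traceOn P s M) := by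
  obtain ⟨U, hU, hMU⟩ := h.exists_isFiltered_inter_diff hs hM
  exact h.eq_traceOn hs hU hMU ▸ ⟨hU, hMU⟩

theorem isFiltered_traceOn_insert (h : IsProperStratification Ψ P) {a : κ}
    (ha : ∀ x ∈ t, x < a) (hM : IsFiltered Ψ (insert a t) M) :
    IsFiltered Ψ {a} (traceOn P (Set.Ici a) M) ∧
      IsFiltered Ψ t (M ⧸ traceOn P (Set.Ici a) M) := by
  have disjoint : Disjoint t (Set.Ici a) :=
    Set.disjoint_left.2 fun x hx => not_le.2 (ha x hx)
  have inter_eq : insert a t ∩ Set.Ici a = {a} := by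
    rw [Set.insert_inter_of_mem Set.self_mem_Ici, disjoint.inter_eq, insert_empty_eq]
  have diff_eq : insert a t \ Set.Ici a = t := by
    rw [Set.insert_sdiff_of_mem _ Set.self_mem_Ici, disjoint.sdiff_eq_left]
  simpa only [inter_eq, diff_eq] using h.isFiltered_traceOn (isUpperSet_Ici a) hM

theorem ker_cover_le (h : IsProperStratification Ψ P) {i : κ} (f : P i →ₗ[A] Ψ i)
    (hf : ∀ g : Module.End A (P i), ¬ IsUnit g → f ∘ₗ g = 0) :
    LinearMap.ker (h.cover i) ≤ LinearMap.ker f := by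
  let K := LinearMap.ker (h.cover i)
  suffices trace_le : traceOn P (Set.Ici i) K ≤ (LinearMap.ker f).comap K.subtype from
    fun x hx => trace_le
      ((h.traceOn_eq_top (h.isFiltered_ker_cover i)).symm ▸ trivial : ⟨x, hx⟩ ∈ _)
  refine traceOn_le fun j hj g => ?_
  rintro _ ⟨x, rfl⟩
  rcases (show i ≤ j from hj).eq_or_lt with rfl | hij
  · exact LinearMap.congr_fun (hf (K.subtype ∘ₗ g)
      (not_isUnit_subtype_comp (h.ker_cover_ne_top i) g)) x
  · exact LinearMap.congr_fun (h.hom_P_eq_zero hij (f ∘ₗ K.subtype ∘ₗ g)) x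

end TraceFiltration

section ProperStandard

variable {A : Type u} [Ring A] [IsArtinianRing A] {κ : Type} [LinearOrder κ]
  {Ψ P : κ → ModuleCat.{u} A}

theorem isLocalRing_end (h : IsProperStratification Ψ P) (i : κ) :
    IsLocalRing (Module.End A (P i)) :=
  have := h.finite i
  (h.indec i).isLocalRing

theorem exists_ne_zero_comp_eq_zero (h : IsProperStratification Ψ P) (i : κ) :
    ∃ f : P i →ₗ[A] Ψ i, f ≠ 0 ∧ ∀ g : Module.End A (P i), ¬ IsUnit g → f ∘ₗ g = 0 := by
  have := h.finite i
  have := h.finite_Ψ i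
  have := h.isLocalRing_end i
  have := isDedekindFiniteMonoid_end (A := A) (M := P i)
  obtain ⟨_, ⟨f, hf, rfl⟩, hmin⟩ := (wellFounded_lt (α := Submodule A (Ψ i))).has_min
    {U | ∃ f : P i →ₗ[A] Ψ i, f ≠ 0 ∧ LinearMap.range f = U}
    ⟨_, h.cover i, h.cover_ne_zero i, rfl⟩
  refine ⟨f, hf, fun g hg => ?_⟩
  by_contra h0
  have range_eq : LinearMap.range (f ∘ₗ g) = LinearMap.range f :=
    eq_of_le_of_not_lt (LinearMap.range_comp_le_range g f) (hmin _ ⟨f ∘ₗ g, h0, rfl⟩)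
  obtain ⟨k, hk⟩ := h.exists_lift (f ∘ₗ g).rangeRestrict (LinearMap.surjective_rangeRestrict _)
    (f.codRestrict _ fun x => range_eq ▸ LinearMap.mem_range_self f x)
  have f_comp : ∀ x, f (g (k x)) = f x := fun x =>
    congrArg Subtype.val (LinearMap.congr_fun hk x)
  have isUnit : IsUnit (1 - g * k) :=
    (IsLocalRing.isUnit_or_isUnit_of_add_one (add_sub_cancel (g * k) 1)).resolve_left
      fun hu => hg (isUnit_of_mul_isUnit_left hu)
  refine hf (LinearMap.ext fun x => ?_)
  obtain ⟨y, rfl⟩ := ((Module.End.isUnit_iff _).1 isUnit).2 x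
  simp [f_comp]

theorem comp_eq_zero (h : IsProperStratification Ψ P) {i : κ} (f : P i →ₗ[A] Ψ i)
    {g : Module.End A (P i)} (hg : ¬ IsUnit g) : f ∘ₗ g = 0 := by
  have := h.finite i
  have := isDedekindFiniteMonoid_end (A := A) (M := P i)
  obtain ⟨f₀, hf₀, f₀_comp⟩ := h.exists_ne_zero_comp_eq_zero i
  obtain ⟨d, rfl⟩ := exists_comp_eq_of_ker_le (h.cover_surjective i) (h.ker_cover_le f₀ f₀_comp)
  have d_injective : Function.Injective d :=
    (h.division i d fun hd => hf₀ (by rw [hd, LinearMap.zero_comp])).1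
  obtain ⟨k, rfl⟩ := h.exists_lift (h.cover i) (h.cover_surjective i) f
  have d_comp : d ∘ₗ (h.cover i ∘ₗ k) ∘ₗ g = 0 :=
    f₀_comp (k * g) fun hu => hg (isUnit_of_mul_isUnit_right hu)
  exact LinearMap.ext fun x => d_injective ((LinearMap.congr_fun d_comp x).trans (map_zero d).symm)

theorem exists_eq_comp_cover (h : IsProperStratification Ψ P) {i : κ} (f : P i →ₗ[A] Ψ i) :
    ∃ d : Ψ i →ₗ[A] Ψ i, d ∘ₗ h.cover i = f :=
  exists_comp_eq_of_ker_le (h.cover_surjective i)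
    (h.ker_cover_le f fun _ hg => h.comp_eq_zero f hg)

theorem surjective_of_ne_zero (h : IsProperStratification Ψ P) {i : κ} {f : P i →ₗ[A] Ψ i}
    (hf : f ≠ 0) : Function.Surjective f := by
  obtain ⟨d, rfl⟩ := h.exists_eq_comp_cover f
  exact (h.division i d fun hd => hf (by rw [hd, LinearMap.zero_comp])).2.comp
    (h.cover_surjective i)

theorem le_jacobson (h : IsProperStratification Ψ P) {i : κ} {U : Submodule A (P i)}
    (hU : U ≠ ⊤) : U ≤ Module.jacobson A (P i) :=
  have := h.finite i
  have := h.projective i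
  (h.indec i).le_jacobson hU

theorem ker_cover_eq_map_traceOn (h : IsProperStratification Ψ P) (i : κ) :
    LinearMap.ker (h.cover i) = (traceOn P (Set.Ici i) (Module.jacobson A (P i))).map
      (Module.jacobson A (P i)).subtype := by
  let J := Module.jacobson A (P i)
  have ker_le : LinearMap.ker (h.cover i) ≤ J := h.le_jacobson (h.ker_cover_ne_top i)
  have := h.finite i
  have := (h.indec i).nontrivial
  refine le_antisymm (fun x hx => ?_) ?_
  · refine ⟨Submodule.inclusion ker_le ⟨x, hx⟩, map_mem_traceOn _ ?_, rfl⟩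
    rw [h.traceOn_eq_top (h.isFiltered_ker_cover i)]
    trivial
  · rw [Submodule.map_le_iff_le_comap]
    refine traceOn_le fun j hj g => ?_
    rintro _ ⟨x, rfl⟩
    rcases (show i ≤ j from hj).eq_or_lt with rfl | hij
    · exact LinearMap.congr_fun (h.comp_eq_zero (h.cover i)
        (not_isUnit_subtype_comp (Module.jacobson_lt_top A (P i)).ne g)) x
    · exact LinearMap.congr_fun (h.hom_P_eq_zero hij (h.cover i ∘ₗ J.subtype ∘ₗ g)) x

variable [Finite κ]

theorem nonempty_equiv_properStandard (h : IsProperStratification Ψ P) (i : κ) :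
    Nonempty (Ψ i ≃ₗ[A] properStandard P i) := by
  have ker_eq := h.ker_cover_eq_map_traceOn i
  rw [← trace_pi (Set.Ici i)] at ker_eq
  exact nonempty_equiv_of_ker_eq (h.cover_surjective i) (Submodule.mkQ_surjective _)
    (ker_eq.trans (Submodule.ker_mkQ _).symm)

theorem filt_properStandard_iff (h : IsProperStratification Ψ P) {M : ModuleCat.{u} A} :
    Filt (properStandard P) M ↔ IsFiltered Ψ Set.univ M := by
  rw [filt_iff_isFiltered]
  exact ⟨fun hM => hM.of_family fun j _ =>
      .of_member trivial (h.nonempty_equiv_properStandard j).some.symm,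
    fun hM => hM.of_family fun j _ =>
      .of_member trivial (h.nonempty_equiv_properStandard j).some⟩

end ProperStandard

end IsProperStratification

namespace IsProperStratification

variable {A : Type u} [Ring A] [IsArtinianRing A] {κ : Type} [LinearOrder κ]
  {Ψ P : κ → ModuleCat.{u} A} {M N : Type u} [AddCommGroup M] [Module A M]
  [AddCommGroup N] [Module A N]

section SingleFactor

variable {i : κ}

theorem surjective_of_traceOn_eq_top (h : IsProperStratification Ψ P)
    (hM : traceOn P {i} M = ⊤) {f : M →ₗ[A] Ψ i} (hf : f ≠ 0) : Function.Surjective f := by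
  by_contra hs
  refine hf ?_
  rw [← LinearMap.ker_eq_top, eq_top_iff, ← hM]
  rintro x hx
  refine traceOn_le (fun j hj g => ?_) hx
  obtain rfl : j = i := hj
  have comp_eq_zero : f ∘ₗ g = 0 := by
    by_contra hne
    exact hs (.of_comp (g := g) (h.surjective_of_ne_zero hne))
  rintro _ ⟨y, rfl⟩
  exact LinearMap.congr_fun comp_eq_zero y

theorem isFiltered_ker_of_surjective (h : IsProperStratification Ψ P)
    (hM : IsFiltered Ψ {i} M) {f : M →ₗ[A] Ψ i} (hf : Function.Surjective f) :
    IsFiltered Ψ {i} (LinearMap.ker f) := by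
  induction hM with
  | zero => exact .zero
  | step j hj π hπ hK ih =>
    obtain rfl : j = i := hj
    by_cases h0 : f ∘ₗ (LinearMap.ker π).subtype = 0
    · obtain ⟨d, rfl⟩ := exists_comp_eq_of_ker_le hπ
        (fun x hx => LinearMap.congr_fun h0 ⟨x, hx⟩ : LinearMap.ker π ≤ LinearMap.ker f)
      have := h.nontrivial j
      have d_injective : Function.Injective d := (h.division j d fun hd => by
        obtain ⟨y, hy⟩ := exists_ne (0 : Ψ j)
        obtain ⟨x, rfl⟩ := hf y
        exact hy (by rw [hd, LinearMap.zero_comp, LinearMap.zero_apply])).1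
      rwa [LinearMap.ker_comp_of_ker_eq_bot _ (LinearMap.ker_eq_bot.2 d_injective)]
    · have restrict_surjective : Function.Surjective (f ∘ₗ (LinearMap.ker π).subtype) :=
        h.surjective_of_traceOn_eq_top (h.traceOn_eq_top hK) h0
      refine .step j rfl (π ∘ₗ (LinearMap.ker f).subtype) (fun y => ?_)
        ((ih restrict_surjective).of_equiv (comapSubtypeComm (LinearMap.ker π) (LinearMap.ker f)))
      obtain ⟨m, rfl⟩ := hπ y
      obtain ⟨k, hk⟩ := restrict_surjective (f m)
      have sub_mem : m - k ∈ LinearMap.ker f := by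
        rw [LinearMap.mem_ker, map_sub, sub_eq_zero]
        exact hk.symm
      exact ⟨⟨m - k, sub_mem⟩, by simp⟩

theorem isFiltered_singleton_ker (h : IsProperStratification Ψ P) (hM : IsFiltered Ψ {i} M)
    (hN : IsFiltered Ψ {i} N) {f : M →ₗ[A] N} (hf : Function.Surjective f) :
    IsFiltered Ψ {i} (LinearMap.ker f) := by
  induction hN generalizing M with
  | zero =>
    exact hM.of_equiv (.ofTop _ (LinearMap.ker_eq_top.2 (Subsingleton.elim _ _)))
  | step j hj π hπ _ ih =>
    obtain rfl : j = i := hj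
    have restrict_surjective : Function.Surjective
        (f.restrict (p := LinearMap.ker (π ∘ₗ f)) (q := LinearMap.ker π) fun _ hx => hx) := by
      rintro ⟨y, hy⟩
      obtain ⟨x, rfl⟩ := hf y
      exact ⟨⟨x, hy⟩, rfl⟩
    exact (ih (h.isFiltered_ker_of_surjective hM (hπ.comp hf)) restrict_surjective).of_equiv
      ((Submodule.submoduleOfEquivOfLe (LinearMap.ker_le_ker_comp f π)).symm ≪≫ₗ
        .ofEq _ _ (LinearMap.ker_restrict _).symm)

theorem exists_surjective_of_retract (h : IsProperStratification Ψ P) (hM : IsFiltered Ψ {i} M)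
    [Nontrivial N] {s : N →ₗ[A] M} {r : M →ₗ[A] N} (hrs : r ∘ₗ s = LinearMap.id) :
    ∃ f : N →ₗ[A] Ψ i, Function.Surjective f := by
  have s_ne_zero : s ≠ 0 := by
    rintro rfl
    obtain ⟨x, hx⟩ := exists_ne (0 : N)
    exact hx (by simpa using (LinearMap.congr_fun hrs x).symm)
  obtain ⟨f, hf⟩ : ∃ f : N →ₗ[A] Ψ i, f ≠ 0 := by
    by_contra! hc
    refine s_ne_zero (hM.hom_to_eq_zero (fun j hj g => ?_) s)
    obtain rfl : j = i := hj
    exact hc g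
  have r_surjective : Function.Surjective r := LinearMap.surjective_of_comp_eq_id s r hrs
  refine ⟨f, h.surjective_of_traceOn_eq_top ?_ hf⟩
  rw [← map_traceOn_eq h.projective r r_surjective, h.traceOn_eq_top hM, Submodule.map_top,
    LinearMap.range_eq_top.2 r_surjective]

theorem isFiltered_singleton_of_retract (h : IsProperStratification Ψ P)
    (hM : IsFiltered Ψ {i} M) (s : N →ₗ[A] M) (r : M →ₗ[A] N) (hrs : r ∘ₗ s = LinearMap.id) :
    IsFiltered Ψ {i} N := by
  induction hl : Module.length A M using WellFoundedLT.induction generalizing M N with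
  | ind l ih =>
    subst hl
    rcases subsingleton_or_nontrivial N with hN | hN
    · exact .zero
    obtain ⟨f, hf⟩ := h.exists_surjective_of_retract hM hrs
    have r_surjective : Function.Surjective r := LinearMap.surjective_of_comp_eq_id s r hrs
    have ker_ne_top : LinearMap.ker (f ∘ₗ r) ≠ ⊤ := by
      have := h.nontrivial i
      intro h0
      obtain ⟨y, hy⟩ := exists_ne (0 : Ψ i)
      obtain ⟨x, rfl⟩ := hf.comp r_surjective y
      exact hy (LinearMap.mem_ker.1 (h0 ▸ Submodule.mem_top : x ∈ LinearMap.ker (f ∘ₗ r)))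
    have := h.finite_of_isFiltered hM
    have s_mem (x : N) (hx : x ∈ LinearMap.ker f) : s x ∈ LinearMap.ker (f ∘ₗ r) := by
      rw [LinearMap.mem_ker, LinearMap.comp_apply]
      exact (congrArg f (LinearMap.congr_fun hrs x)).trans hx
    exact .step i rfl f hf <| ih _ (Submodule.length_lt ker_ne_top)
      (h.isFiltered_ker_of_surjective hM (hf.comp r_surjective))
      (s.restrict s_mem) (r.restrict fun x hx => hx)
      (LinearMap.ext fun x => Subtype.ext (LinearMap.congr_fun hrs x)) rfl

end SingleFactor

theorem isFiltered_ker (h : IsProperStratification Ψ P) {t : Finset κ}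
    (hM : IsFiltered Ψ t M) (hN : IsFiltered Ψ t N) {f : M →ₗ[A] N}
    (hf : Function.Surjective f) : IsFiltered Ψ t (LinearMap.ker f) := by
  induction t using Finset.induction_on_max generalizing M N with
  | empty =>
    cases hM with
    | zero => exact .zero
    | step j hj => simp at hj
  | insert a t ha ih =>
    rw [Finset.coe_insert] at hM hN ⊢
    obtain ⟨trace_M, quot_M⟩ := h.isFiltered_traceOn_insert ha hM
    obtain ⟨trace_N, quot_N⟩ := h.isFiltered_traceOn_insert ha hN
    rw [← map_traceOn_eq h.projective f hf] at trace_N quot_N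
    have ker_trace := h.isFiltered_singleton_ker trace_M trace_N (f.submoduleMap_surjective _)
    have ker_quot := ih quot_M quot_N (f := Submodule.mapQ _ _ f (Submodule.le_comap_map f _)) <| by
      rw [← LinearMap.range_eq_top, Submodule.range_mapQ, LinearMap.range_eq_top.2 hf,
        Submodule.map_top, Submodule.range_mkQ]
    exact .ker_of_submodule f _ (ker_trace.mono (by simp)) (ker_quot.mono (Set.subset_insert a t))

theorem isFiltered_of_retract (h : IsProperStratification Ψ P) {t : Finset κ}
    (hM : IsFiltered Ψ t M) (s : N →ₗ[A] M) (r : M →ₗ[A] N) (hrs : r ∘ₗ s = LinearMap.id) :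
    IsFiltered Ψ t N := by
  induction t using Finset.induction_on_max generalizing M N with
  | empty =>
    cases hM with
    | zero =>
      have := (LinearMap.injective_of_comp_eq_id s r hrs).subsingleton
      exact .zero
    | step j hj => simp at hj
  | insert a t ha ih =>
    rw [Finset.coe_insert] at hM ⊢
    obtain ⟨trace_M, quot_M⟩ := h.isFiltered_traceOn_insert ha hM
    have trace_N := h.isFiltered_singleton_of_retract trace_M
      (s.restrict (p := traceOn P (Set.Ici a) N) fun x hx => map_mem_traceOn s hx)
      (r.restrict fun x hx => map_mem_traceOn r hx)
      (LinearMap.ext fun x => Subtype.ext (LinearMap.congr_fun hrs x))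
    have quot_N := ih quot_M
      ((traceOn P (Set.Ici a) N).mapQ _ s fun x hx => map_mem_traceOn s hx)
      ((traceOn P (Set.Ici a) M).mapQ _ r fun x hx => map_mem_traceOn r hx)
      (by rw [← Submodule.mapQ_comp]; simp only [hrs, Submodule.mapQ_id])
    exact .of_submodule _ (trace_N.mono (by simp)) (quot_N.mono (Set.subset_insert a t))

variable [Finite κ]

theorem isResolving (h : IsProperStratification Ψ P) :
    IsResolving (Filt (properStandard P)) where
  finite _ hM := h.finite_of_isFiltered (h.filt_properStandard_iff.1 hM)
  extensions S hS h₁ h₃ := by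
    rw [h.filt_properStandard_iff] at *
    exact h₃.of_exact S.f.hom S.g.hom hS.moduleCat_injective_f
      ((ShortComplex.ShortExact.moduleCat_exact_iff_function_exact S).1 hS.exact)
      hS.moduleCat_surjective_g h₁
  kernels S hS h₂ h₃ := by
    cases nonempty_fintype κ
    rw [h.filt_properStandard_iff, ← Finset.coe_univ] at *
    have exact := (ShortComplex.ShortExact.moduleCat_exact_iff_function_exact S).1 hS.exact
    exact (h.isFiltered_ker h₂ h₃ hS.moduleCat_surjective_g).of_equiv
      (kerEquivOfExact hS.moduleCat_injective_f exact)
  projectives M _ _ := by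
    rw [h.filt_properStandard_iff]
    exact .of_projective h.total.some h.indec
      fun i => (h.isFiltered_P i).mono (Set.subset_univ _)

theorem isStableUnderRetracts (h : IsProperStratification Ψ P) :
    (Filt (properStandard P)).IsStableUnderRetracts where
  of_retract R hY := by
    cases nonempty_fintype κ
    rw [h.filt_properStandard_iff, ← Finset.coe_univ] at *
    refine h.isFiltered_of_retract hY R.i.hom R.r.hom ?_
    rw [← ModuleCat.hom_comp, R.retract, ModuleCat.hom_id]

end IsProperStratification

section Representatives

variable {A : Type u} [Ring A] {κ : Type} {P : κ → ModuleCat.{u} A}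

theorem IsRepresentativeSet.isBasic [Finite κ] (hP : IsRepresentativeSet P)
    (e : A ≃ₗ[A] ∀ i, P i) : IsBasic A := by
  let ε := Finite.equivFin κ
  refine ⟨Nat.card κ, fun k => P (ε.symm k), fun k => hP.indecomposable _, fun k l hkl =>
    hP.not_iso _ _ fun h => hkl (ε.symm.injective h), ⟨e ≪≫ₗ ?_⟩⟩
  exact (LinearEquiv.piCongrLeft A (fun i => P i) ε.symm).symm

theorem isRepresentativeSet_of_equiv [Finite κ] [IsArtinianRing A] (e : A ≃ₗ[A] ∀ i, P i)
    (hf : ∀ i, Module.Finite A (P i)) (hp : ∀ i, Module.Projective A (P i))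
    (hi : ∀ i, IsIndec A (P i)) (hn : ∀ i j, i ≠ j → IsEmpty (P i ≃ₗ[A] P j)) :
    IsRepresentativeSet P where
  finite := hf
  projective := hp
  indecomposable i := indecomposable_iff_isIndec.2 (hi i)
  not_iso := hn
  exists_iso _ _ _ hM := (indecomposable_iff_isIndec.1 hM).exists_equiv_of_projective e hi

end Representatives

section Tops

variable {A : Type u} [Ring A] [IsArtinianRing A] {M N S : Type*} [AddCommGroup M] [Module A M]
  [AddCommGroup N] [Module A N] [AddCommGroup S] [Module A S]

namespace IsIndec

section Finite

variable [Module.Finite A M] [Module.Projective A M]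

theorem isCoatom_jacobson (h : IsIndec A M) : IsCoatom (Module.jacobson A M) := by
  have := h.nontrivial
  refine ⟨(Module.jacobson_lt_top A M).ne, fun V hV => ?_⟩
  by_contra h0
  exact (h.le_jacobson h0).not_gt hV

theorem isSimpleModule_top (h : IsIndec A M) : IsSimpleModule A (M ⧸ Module.jacobson A M) :=
  isSimpleModule_iff_isCoatom.2 h.isCoatom_jacobson

theorem nonempty_equiv_top (h : IsIndec A M) [IsSimpleModule A S] {f : M →ₗ[A] S}
    (hf : f ≠ 0) : Nonempty (S ≃ₗ[A] M ⧸ Module.jacobson A M) := by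
  have f_surjective : Function.Surjective f := LinearMap.surjective_of_ne_zero hf
  refine nonempty_equiv_of_ker_eq f_surjective (Submodule.mkQ_surjective _) ?_
  have : IsSimpleModule A (M ⧸ LinearMap.ker f) :=
    .congr (f.quotKerEquivOfSurjective f_surjective)
  rw [Submodule.ker_mkQ]
  exact le_antisymm (h.le_jacobson fun h0 => hf (LinearMap.ker_eq_top.1 h0))
    (sInf_le (isSimpleModule_iff_isCoatom.1 this))

theorem surjective_of_mkQ_jacobson_comp_ne_zero (h : IsIndec A M) {g : N →ₗ[A] M}
    (hg : (Module.jacobson A M).mkQ ∘ₗ g ≠ 0) : Function.Surjective g := by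
  by_contra hs
  refine hg (LinearMap.range_le_ker_iff.1 ?_)
  rw [Submodule.ker_mkQ]
  exact h.le_jacobson fun h0 => hs (LinearMap.range_eq_top.1 h0)

end Finite

theorem hom_top_eq_zero [Module.Finite A M] [Module.Projective A M] [Module.Projective A N]
    (hM : IsIndec A M) (hN : IsIndec A N) (hMN : IsEmpty (N ≃ₗ[A] M))
    (f : N →ₗ[A] M ⧸ Module.jacobson A M) : f = 0 := by
  by_contra hf
  obtain ⟨g, rfl⟩ := Module.projective_lifting_property _ f (Submodule.mkQ_surjective _)
  obtain ⟨s, hs⟩ := Module.projective_lifting_property g LinearMap.id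
    (hM.surjective_of_mkQ_jacobson_comp_ne_zero hf)
  have := hM.nontrivial
  obtain ⟨e⟩ := hN.nonempty_equiv_of_isUnit_comp s g (hs ▸ isUnit_one)
  exact hMN.false e.symm

end IsIndec

end Tops

section HomLength

variable {A : Type u} [Ring A] {Q M N L : Type u} [AddCommGroup Q] [Module A Q]
  [AddCommGroup M] [Module A M] [AddCommGroup N] [Module A N] [AddCommGroup L] [Module A L]

/-- Composition with `g`, as a map of right `End(Q)`-modules. -/
def postcomp (Q : Type u) [AddCommGroup Q] [Module A Q] (g : M →ₗ[A] N) :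
    (Q →ₗ[A] M) →ₗ[(Module.End A Q)ᵈᵐᵃ] (Q →ₗ[A] N) where
  toFun f := g ∘ₗ f
  map_add' _ _ := LinearMap.comp_add _ _ _
  map_smul' _ _ := rfl

/-- The length of `Hom(Q, M)` as a right `End(Q)`-module; for `Q` the projective cover of a
simple module it is the multiplicity of that module in `M`. -/
def homLength (A : Type u) [Ring A] (Q M : Type u) [AddCommGroup Q] [Module A Q]
    [AddCommGroup M] [Module A M] : ℕ∞ :=
  Module.length (Module.End A Q)ᵈᵐᵃ (Q →ₗ[A] M)

theorem homLength_eq_zero (h : ∀ f : Q →ₗ[A] M, f = 0) : homLength A Q M = 0 := by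
  rw [homLength, Module.length_eq_zero_iff]
  exact ⟨fun f g => by rw [h f, h g]⟩

variable [Module.Projective A Q]

theorem homLength_eq_add {f : M →ₗ[A] N} {g : N →ₗ[A] L} (hf : Function.Injective f)
    (hfg : Function.Exact f g) (hg : Function.Surjective g) :
    homLength A Q N = homLength A Q M + homLength A Q L := by
  refine Module.length_eq_add_of_exact (postcomp Q f) (postcomp Q g)
    (fun _ _ => (LinearMap.cancel_left hf).1)
    (fun a => Module.projective_lifting_property g a hg) fun b => ⟨fun hb => ?_, ?_⟩
  · have mem_range (x : Q) : b x ∈ LinearMap.range f := (hfg (b x)).1 (LinearMap.congr_fun hb x)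
    let e := LinearEquiv.ofInjective f hf
    refine ⟨e.symm.toLinearMap ∘ₗ b.codRestrict (LinearMap.range f) mem_range,
      LinearMap.ext fun x => ?_⟩
    exact congrArg Subtype.val (e.apply_symm_apply ⟨b x, mem_range x⟩)
  · rintro ⟨a, rfl⟩
    exact LinearMap.ext fun x => hfg.apply_apply_eq_zero (a x)

theorem homLength_eq_one [IsSimpleModule A M] {f : Q →ₗ[A] M} (hf : f ≠ 0) :
    homLength A Q M = 1 := by
  rw [homLength, Module.length_eq_one_iff, isSimpleModule_iff_toSpanSingleton_surjective]
  refine ⟨⟨f, 0, hf⟩, fun g hg k => ?_⟩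
  obtain ⟨c, hc⟩ := Module.projective_lifting_property g k (LinearMap.surjective_of_ne_zero hg)
  exact ⟨DomMulAct.mk c, hc⟩

theorem homLength_ne_top (hM : IsFiniteLength A M) : homLength A Q M ≠ ⊤ := by
  induction hM with
  | of_subsingleton =>
    rw [homLength_eq_zero fun f => Subsingleton.elim _ _]
    exact ENat.zero_ne_top
  | @of_simple_quotient M _ _ N _ _ ih =>
    rw [homLength_eq_add N.injective_subtype (LinearMap.exact_subtype_mkQ N) N.mkQ_surjective]
    refine WithTop.add_ne_top.2 ⟨ih, ?_⟩
    by_cases! h : ∀ f : Q →ₗ[A] M ⧸ N, f = 0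
    · rw [homLength_eq_zero h]
      exact ENat.zero_ne_top
    · obtain ⟨f, hf⟩ := h
      rw [homLength_eq_one hf]
      exact ENat.one_ne_top

end HomLength

section Grothendieck

variable {A : Type u} [Ring A] {κ : Type}

theorem isFiniteLength_of_finite [IsArtinianRing A] (M : Type*) [AddCommGroup M]
    [Module A M] [Module.Finite A M] : IsFiniteLength A M :=
  isFiniteLength_iff_isNoetherian_isArtinian.2 ⟨inferInstance, inferInstance⟩

namespace K0

/-- The class of a module in the Grothendieck group. -/
def of (M : FG A) : K0 A := QuotientAddGroup.mk (FreeAbelianGroup.of M)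

theorem of_eq_add {X Y Z : FG A} {f : X.1 →ₗ[A] Y.1} {g : Y.1 →ₗ[A] Z.1}
    (hf : Function.Injective f) (hfg : Function.Exact f g) (hg : Function.Surjective g) :
    of Y = of X + of Z := by
  rw [← sub_eq_zero, ← sub_sub]
  exact (QuotientAddGroup.eq_zero_iff (N := K0Relations A)
    (FreeAbelianGroup.of Y - FreeAbelianGroup.of X - FreeAbelianGroup.of Z)).2
    (AddSubgroup.subset_closure ⟨X, Y, Z, f, g, hf, hfg, hg, rfl⟩)

theorem of_eq_zero (X : FG A) [Subsingleton X.1] : of X = 0 := by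
  have of_eq_add_self : of X = of X + of X := of_eq_add (f := 0) (g := 0)
    (Function.injective_of_subsingleton _)
    (fun _ => ⟨fun _ => ⟨0, Subsingleton.elim _ _⟩, fun _ => Subsingleton.elim _ _⟩)
    (Function.surjective_to_subsingleton _)
  simpa using of_eq_add_self

variable [IsArtinianRing A]

theorem of_mem_span {S : κ → FG A}
    (hS : ∀ (M : Type u) [AddCommGroup M] [Module A M] [IsSimpleModule A M],
      ∃ i, Nonempty (M ≃ₗ[A] (S i).1))
    {M : Type u} [AddCommGroup M] [Module A M] (hM : IsFiniteLength A M)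
    (hM' : Module.Finite A M) :
    of ⟨ModuleCat.of A M, hM'⟩ ∈ Submodule.span ℤ (Set.range fun i => of (S i)) := by
  induction hM with
  | @of_subsingleton M =>
    have : Subsingleton (ModuleCat.of A M) := ‹Subsingleton M›
    exact of_eq_zero ⟨ModuleCat.of A M, hM'⟩ ▸ zero_mem _
  | @of_simple_quotient M _ _ N _ _ ih =>
    obtain ⟨i, ⟨e⟩⟩ := hS (M ⧸ N)
    have hN : Module.Finite A N := inferInstance
    have exact : Function.Exact N.subtype (e.toLinearMap ∘ₗ N.mkQ) := by
      rw [LinearMap.exact_iff, LinearEquiv.ker_comp, Submodule.ker_mkQ, Submodule.range_subtype]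
    rw [of_eq_add (X := ⟨ModuleCat.of A N, hN⟩) (Y := ⟨ModuleCat.of A M, hM'⟩) (Z := S i)
      N.injective_subtype exact (e.surjective.comp N.mkQ_surjective)]
    exact add_mem (ih hN) (Submodule.subset_span ⟨i, rfl⟩)

theorem span_eq_top {S : κ → FG A}
    (hS : ∀ (M : Type u) [AddCommGroup M] [Module A M] [IsSimpleModule A M],
      ∃ i, Nonempty (M ≃ₗ[A] (S i).1)) :
    Submodule.span ℤ (Set.range fun i => of (S i)) = ⊤ := by
  refine eq_top_iff.2 fun x _ => ?_
  obtain ⟨x, rfl⟩ := QuotientAddGroup.mk_surjective x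
  induction x using FreeAbelianGroup.induction_on with
  | zero => exact zero_mem _
  | of X =>
    have := X.2
    exact of_mem_span hS (isFiniteLength_of_finite X.1) X.2
  | neg X hX => exact neg_mem (hX trivial)
  | add x y hx hy => exact add_mem (hx trivial) (hy trivial)

/-- The additive function `M ↦ length Hom(Q, M)` on the Grothendieck group. -/
def liftHomLength (Q : Type u) [AddCommGroup Q] [Module A Q] [Module.Projective A Q] :
    K0 A →+ ℤ :=
  QuotientAddGroup.lift (K0Relations A)
    (FreeAbelianGroup.lift fun X : FG A => ((homLength A Q X.1).toNat : ℤ)) <| by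
      refine (AddSubgroup.closure_le _).2 ?_
      rintro _ ⟨X, Y, Z, f, g, hf, hfg, hg, rfl⟩
      have := X.2
      have := Z.2
      simp only [SetLike.mem_coe, AddMonoidHom.mem_ker, map_sub, FreeAbelianGroup.lift_apply_of]
      rw [homLength_eq_add hf hfg hg, ENat.toNat_add
        (homLength_ne_top (isFiniteLength_of_finite X.1))
        (homLength_ne_top (isFiniteLength_of_finite Z.1))]
      push_cast
      ring

theorem liftHomLength_of (Q : Type u) [AddCommGroup Q] [Module A Q] [Module.Projective A Q]
    (X : FG A) : liftHomLength Q (of X) = ((homLength A Q X.1).toNat : ℤ) :=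
  FreeAbelianGroup.lift_apply_of _ _

end K0

theorem exists_hom_ne_zero [Finite κ] {P : κ → Type*} [∀ i, AddCommGroup (P i)]
    [∀ i, Module A (P i)] (e : A ≃ₗ[A] ∀ i, P i) (M : Type*) [AddCommGroup M] [Module A M]
    [Nontrivial M] : ∃ (i : κ) (f : P i →ₗ[A] M), f ≠ 0 := by
  classical
  by_contra! hom_eq_zero
  obtain ⟨x, hx⟩ := exists_ne (0 : M)
  have comp_eq_zero : LinearMap.toSpanSingleton A M x ∘ₗ e.symm.toLinearMap = 0 :=
    LinearMap.pi_ext' fun i => (hom_eq_zero i _).trans (hom_eq_zero i _).symm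
  exact hx (by simpa using LinearMap.congr_fun comp_eq_zero (e 1))

namespace IsRepresentativeSet

variable {P : κ → ModuleCat.{u} A}

theorem isIndec (hP : IsRepresentativeSet P) (i : κ) : IsIndec A (P i) :=
  indecomposable_iff_isIndec.1 (hP.indecomposable i)

variable [IsArtinianRing A]

/-- The simple top `P i / rad (P i)`. -/
def top (hP : IsRepresentativeSet P) (i : κ) : FG A :=
  ⟨ModuleCat.of A (P i ⧸ Module.jacobson A (P i)),
    have := hP.finite i
    inferInstanceAs (Module.Finite A (P i ⧸ Module.jacobson A (P i)))⟩

theorem exists_equiv_top [Finite κ] (hP : IsRepresentativeSet P) (e : A ≃ₗ[A] ∀ i, P i)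
    (M : Type u) [AddCommGroup M] [Module A M] [IsSimpleModule A M] :
    ∃ i, Nonempty (M ≃ₗ[A] (hP.top i).1) := by
  have := IsSimpleModule.nontrivial A M
  obtain ⟨i, f, hf⟩ := exists_hom_ne_zero e M
  have := hP.finite i
  have := hP.projective i
  exact ⟨i, (hP.isIndec i).nonempty_equiv_top hf⟩

theorem homLength_top_self (hP : IsRepresentativeSet P) (i : κ) :
    homLength A (P i) (hP.top i).1 = 1 := by
  have := hP.finite i
  have := hP.projective i
  have : IsSimpleModule A (hP.top i).1 := (hP.isIndec i).isSimpleModule_top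
  have := IsSimpleModule.nontrivial A (hP.top i).1
  refine homLength_eq_one (f := (Module.jacobson A (P i)).mkQ) fun h0 => ?_
  obtain ⟨y, hy⟩ := exists_ne (0 : (hP.top i).1)
  obtain ⟨x, rfl⟩ := Submodule.mkQ_surjective _ y
  exact hy (LinearMap.congr_fun h0 x)

theorem homLength_top_of_ne (hP : IsRepresentativeSet P) {i j : κ} (hij : i ≠ j) :
    homLength A (P i) (hP.top j).1 = 0 := by
  have := hP.finite j
  have := hP.projective i
  have := hP.projective j
  exact homLength_eq_zero
    ((hP.isIndec j).hom_top_eq_zero (hP.isIndec i) (hP.not_iso i j hij))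

theorem linearIndependent_of_top (hP : IsRepresentativeSet P) :
    LinearIndependent ℤ fun i => K0.of (hP.top i) := by
  classical
  have := hP.projective
  refine .of_comp (LinearMap.pi fun i => (K0.liftHomLength (P i)).toIntLinearMap) ?_
  suffices h : (LinearMap.pi fun i => (K0.liftHomLength (P i)).toIntLinearMap) ∘
      (fun i => K0.of (hP.top i)) = fun i => Pi.single i 1 by
    rw [h]
    exact Pi.linearIndependent_single_one κ ℤ
  ext j i
  change K0.liftHomLength (P i) (K0.of (hP.top j)) = _
  rw [K0.liftHomLength_of]
  rcases eq_or_ne i j with rfl | hij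
  · rw [hP.homLength_top_self, Pi.single_eq_same]
    rfl
  · rw [hP.homLength_top_of_ne hij, Pi.single_eq_of_ne hij]
    rfl

theorem rank_K0 [Fintype κ] (hP : IsRepresentativeSet P) (e : A ≃ₗ[A] ∀ i, P i) :
    Module.rank ℤ (K0 A) = (Fintype.card κ : Cardinal) :=
  rank_eq_card_basis
    (Module.Basis.mk hP.linearIndependent_of_top (K0.span_eq_top (hP.exists_equiv_top e)).ge)

end IsRepresentativeSet

end Grothendieck

namespace IsProperStratification

variable {A : Type u} [Ring A] {κ : Type} [LinearOrder κ] {Ψ P : κ → ModuleCat.{u} A}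

theorem not_iso_of_lt (h : IsProperStratification Ψ P) {i j : κ} (hij : i < j) :
    IsEmpty (P i ≃ₗ[A] P j) := by
  refine ⟨fun e => h.cover_ne_zero i ?_⟩
  have comp_eq_zero := h.hom_P_eq_zero hij (h.cover i ∘ₗ e.symm.toLinearMap)
  ext x
  simpa using LinearMap.congr_fun comp_eq_zero (e x)

theorem not_iso (h : IsProperStratification Ψ P) {i j : κ} (hij : i ≠ j) :
    IsEmpty (P i ≃ₗ[A] P j) := by
  rcases hij.lt_or_gt with hlt | hlt
  · exact h.not_iso_of_lt hlt
  · exact ⟨fun e => (h.not_iso_of_lt hlt).false e.symm⟩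

theorem isRepresentativeSet [Finite κ] [IsArtinianRing A] (h : IsProperStratification Ψ P) :
    IsRepresentativeSet P :=
  isRepresentativeSet_of_equiv h.total.some h.finite h.projective h.indec fun _ _ => h.not_iso

end IsProperStratification

section Finiteness

theorem finite_hom_of_isNoetherianRing {R : Type*} [CommRing R] [IsNoetherianRing R] {A : Type*}
    [Ring A] {M N : Type*} [AddCommGroup M] [Module A M] [Module.Finite A M] [AddCommGroup N]
    [Module A N] [Module R N] [Module.Finite R N] [SMulCommClass A R N] :
    Module.Finite R (M →ₗ[A] N) := by
  obtain ⟨n, p, hp⟩ := Module.Finite.exists_fin (R := A) (M := M)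
  let evaluate : (M →ₗ[A] N) →ₗ[R] (Fin n → N) :=
    { toFun := fun f k => f (p k)
      map_add' := fun _ _ => rfl
      map_smul' := fun _ _ => rfl }
  exact .of_injective evaluate fun f g hfg => LinearMap.ext_on_range hp fun k => congrFun hfg k

theorem exists_module_isScalarTower (R A M : Type*) [CommRing R] [Ring A] [Algebra R A]
    [AddCommGroup M] [Module A M] : ∃ _ : Module R M, IsScalarTower R A M := by
  let _ : Module R M := Module.compHom M (algebraMap R A)
  exact ⟨inferInstance, ⟨fun r a x => by
    rw [Algebra.smul_def, mul_smul]
    rfl⟩⟩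

theorem finite_end_hom (R : Type*) [CommRing R] [IsNoetherianRing R] {A : Type*} [Ring A]
    [Algebra R A] [Module.Finite R A] (M N : Type*) [AddCommGroup M] [Module A M]
    [Module.Finite A M] [AddCommGroup N] [Module A N] [Module.Finite A N] :
    Module.Finite (Module.End A N) (M →ₗ[A] N) := by
  obtain ⟨_, _⟩ := exists_module_isScalarTower R A N
  have : SMulCommClass A R N := IsScalarTower.to_smulCommClass'
  have : Module.Finite R N := .trans A N
  have : Module.Finite R (M →ₗ[A] N) := finite_hom_of_isNoetherianRing
  have : IsScalarTower R (Module.End A N) (M →ₗ[A] N) := ⟨fun _ _ _ => rfl⟩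
  exact .of_restrictScalars_finite R _ _

end Finiteness

section Dual

variable {A : Type*} [Ring A] {P P' : Type*} [AddCommGroup P] [Module A P] [AddCommGroup P']
  [Module A P']

theorem exists_dual_basis (A P : Type*) [Ring A] [AddCommGroup P] [Module A P]
    [Module.Finite A P] [Module.Projective A P] :
    ∃ (n : ℕ) (p : Fin n → P) (x : Fin n → (P →ₗ[A] A)), ∀ q, ∑ k, x k q • p k = q := by
  obtain ⟨n, r, s, -, -, hrs⟩ := Module.Finite.exists_comp_eq_id_of_projective A P
  refine ⟨n, fun k => r (Pi.single k 1), fun k => LinearMap.proj k ∘ₗ s, fun q => ?_⟩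
  simp_rw [← map_smul, ← map_sum, LinearMap.comp_apply, LinearMap.proj_apply]
  rw [← pi_eq_sum_univ' (s q)]
  exact LinearMap.congr_fun hrs q

theorem eq_sum_op_smul {n : ℕ} {p : Fin n → P} {x : Fin n → (P →ₗ[A] A)}
    (hx : ∀ q, ∑ k, x k q • p k = q) (g : P →ₗ[A] A) :
    g = ∑ k, MulOpposite.op (g (p k)) • x k := by
  ext q
  conv_lhs => rw [← hx q]
  simp

theorem exists_lcomp_eq [Module.Finite A P'] [Module.Projective A P']
    (φ : (P' →ₗ[A] A) →ₗ[Aᵐᵒᵖ] (P →ₗ[A] A)) :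
    ∃ f : P →ₗ[A] P', LinearMap.lcomp Aᵐᵒᵖ A f = φ := by
  obtain ⟨n, p, x, hx⟩ := exists_dual_basis A P'
  refine ⟨∑ k, (φ (x k)).smulRight (p k), ?_⟩
  ext g q
  conv_rhs => rw [eq_sum_op_smul hx g, map_sum]
  simp

theorem lcomp_injective [Module.Finite A P'] [Module.Projective A P'] :
    Function.Injective fun f : P →ₗ[A] P' => LinearMap.lcomp Aᵐᵒᵖ A f := by
  intro f f' hff
  obtain ⟨n, p, x, hx⟩ := exists_dual_basis A P'
  ext q
  have forms_eq (k) : x k (f q) = x k (f' q) :=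
    LinearMap.congr_fun (LinearMap.congr_fun hff (x k)) q
  rw [← hx (f q), ← hx (f' q)]
  simp only [forms_eq]

/-- The dual of the regular left module is the regular right module. -/
def dualSelfEquiv (A : Type*) [Ring A] : (A →ₗ[A] A) ≃ₗ[Aᵐᵒᵖ] Aᵐᵒᵖ :=
  LinearMap.ringLmapEquivSelf A Aᵐᵒᵖ A ≪≫ₗ MulOpposite.opLinearEquiv Aᵐᵒᵖ

/-- The dual of a finite direct sum is the direct sum of the duals. -/
def dualPiEquiv {κ : Type*} [Fintype κ] [DecidableEq κ] (P : κ → Type*)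
    [∀ i, AddCommGroup (P i)] [∀ i, Module A (P i)] :
    ((∀ i, P i) →ₗ[A] A) ≃ₗ[Aᵐᵒᵖ] ∀ i, (P i →ₗ[A] A) :=
  (LinearMap.lsum A P Aᵐᵒᵖ).symm

theorem exists_dual_retract (A P : Type*) [Ring A] [AddCommGroup P] [Module A P]
    [Module.Finite A P] [Module.Projective A P] :
    ∃ (n : ℕ) (s : (P →ₗ[A] A) →ₗ[Aᵐᵒᵖ] (Fin n → Aᵐᵒᵖ))
      (r : (Fin n → Aᵐᵒᵖ) →ₗ[Aᵐᵒᵖ] (P →ₗ[A] A)), r ∘ₗ s = LinearMap.id := by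
  obtain ⟨n, r, s, -, -, hrs⟩ := Module.Finite.exists_comp_eq_id_of_projective A P
  let e : ((Fin n → A) →ₗ[A] A) ≃ₗ[Aᵐᵒᵖ] (Fin n → Aᵐᵒᵖ) :=
    dualPiEquiv (fun _ => A) ≪≫ₗ LinearEquiv.piCongrRight fun _ => dualSelfEquiv A
  refine ⟨n, e.toLinearMap ∘ₗ LinearMap.lcomp Aᵐᵒᵖ A r,
    LinearMap.lcomp Aᵐᵒᵖ A s ∘ₗ e.symm.toLinearMap, ?_⟩
  ext g q
  simpa using congrArg g (LinearMap.congr_fun hrs q)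

theorem finite_dual (A P : Type*) [Ring A] [AddCommGroup P] [Module A P] [Module.Finite A P]
    [Module.Projective A P] : Module.Finite Aᵐᵒᵖ (P →ₗ[A] A) := by
  obtain ⟨n, s, r, hrs⟩ := exists_dual_retract A P
  exact .of_surjective r (LinearMap.surjective_of_comp_eq_id _ _ hrs)

theorem projective_dual (A P : Type*) [Ring A] [AddCommGroup P] [Module A P] [Module.Finite A P]
    [Module.Projective A P] : Module.Projective Aᵐᵒᵖ (P →ₗ[A] A) := by
  obtain ⟨n, s, r, hrs⟩ := exists_dual_retract A P
  exact .of_split s r hrs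

theorem IsIndec.dual [Module.Finite A P] [Module.Projective A P] (h : IsIndec A P) :
    IsIndec Aᵐᵒᵖ (P →ₗ[A] A) := by
  constructor
  · by_contra! subsingleton
    have id_eq_zero : (LinearMap.id : P →ₗ[A] P) = 0 :=
      lcomp_injective (LinearMap.ext fun _ => Subsingleton.elim _ _)
    have := h.nontrivial
    obtain ⟨x, hx⟩ := exists_ne (0 : P)
    exact hx (LinearMap.congr_fun id_eq_zero x)
  · intro φ hφ
    obtain ⟨f, rfl⟩ := exists_lcomp_eq φ
    rcases h.idempotent f (lcomp_injective hφ) with rfl | rfl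
    · exact .inl (LinearMap.ext fun g => LinearMap.comp_zero g)
    · exact .inr rfl

theorem nonempty_equiv_of_dual [Module.Finite A P] [Module.Projective A P] [Module.Finite A P']
    [Module.Projective A P'] (e : (P →ₗ[A] A) ≃ₗ[Aᵐᵒᵖ] (P' →ₗ[A] A)) :
    Nonempty (P ≃ₗ[A] P') := by
  obtain ⟨f, hf⟩ := exists_lcomp_eq e.toLinearMap
  obtain ⟨g, hg⟩ := exists_lcomp_eq e.symm.toLinearMap
  refine ⟨LinearEquiv.ofLinearMap g f (lcomp_injective ?_) (lcomp_injective ?_)⟩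
  · change LinearMap.lcomp Aᵐᵒᵖ A f ∘ₗ LinearMap.lcomp Aᵐᵒᵖ A g = LinearMap.id
    rw [hf, hg, LinearEquiv.comp_symm]
  · change LinearMap.lcomp Aᵐᵒᵖ A g ∘ₗ LinearMap.lcomp Aᵐᵒᵖ A f = LinearMap.id
    rw [hf, hg, LinearEquiv.symm_comp]

theorem nonempty_equiv_pi_dual {A : Type u} [Ring A] {κ : Type} [Finite κ]
    {P : κ → ModuleCat.{u} A} (e : A ≃ₗ[A] ∀ i, P i) :
    Nonempty (Aᵐᵒᵖ ≃ₗ[Aᵐᵒᵖ] ∀ i, dual (P i)) := by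
  classical
  have := Fintype.ofFinite κ
  exact ⟨(dualSelfEquiv A).symm ≪≫ₗ LinearEquiv.congrLeft A Aᵐᵒᵖ e ≪≫ₗ
    dualPiEquiv fun i => (P i : Type u)⟩

end Dual

section DualTrace

variable {A : Type u} [Ring A] {κ : Type} {P : κ → ModuleCat.{u} A} {s t : Set κ}

theorem traceOn_traceOn {M : Type u} [AddCommGroup M] [Module A M] (hst : s ⊆ t) :
    traceOn P s (traceOn P t M) = (traceOn P s M).submoduleOf (traceOn P t M) := by
  apply le_antisymm
  · exact Submodule.map_le_iff_le_comap.1 (map_traceOn_le _)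
  · have le_map : traceOn P s M ≤ (traceOn P s (traceOn P t M)).map (traceOn P t M).subtype := by
      refine traceOn_le fun j hj f => ?_
      rintro _ ⟨y, rfl⟩
      exact ⟨_, apply_mem_traceOn hj
        (f.codRestrict _ fun y => apply_mem_traceOn (hst hj) f y) y, rfl⟩
    intro x hx
    obtain ⟨y, hy, hyx⟩ := le_map hx
    rwa [← Subtype.ext hyx]

variable {X : Type u} [AddCommGroup X] [Module A X]

/-- The forms on `X` with values in the trace ideal of the modules `P j`, `j ∈ s`. For a
projective `X` they are the trace of the duals of these modules in the dual of `X`. -/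
def formsIn (P : κ → ModuleCat.{u} A) (s : Set κ) (X : Type u) [AddCommGroup X] [Module A X] :
    Submodule Aᵐᵒᵖ (X →ₗ[A] A) where
  carrier := {g | ∀ x, g x ∈ traceOn P s A}
  add_mem' hf hg x := add_mem (hf x) (hg x)
  zero_mem' _ := zero_mem _
  smul_mem' c _ hg x := map_mem_traceOn (LinearMap.toSpanSingleton A A c.unop) (hg x)

theorem op_smul_mem_traceOn_dual {a : A} (ha : a ∈ traceOn P s A) (g : X →ₗ[A] A) :
    MulOpposite.op a • g ∈ traceOn (fun i => dual (P i)) s (X →ₗ[A] A) := by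
  refine traceOn_induction (p := fun a => MulOpposite.op a • g ∈ _) (fun j hj f y => ?_) ?_ ?_ ha
  · have eq_lcomp : MulOpposite.op (f y) • g = LinearMap.lcomp Aᵐᵒᵖ A (g.smulRight y) f := by
      ext q
      simp
    rw [eq_lcomp]
    exact apply_mem_traceOn (P := fun i => dual (P i)) hj
      (LinearMap.lcomp Aᵐᵒᵖ A (g.smulRight y)) f
  · rw [MulOpposite.op_zero, zero_smul]
    exact zero_mem _
  · intro a b ha hb
    rw [MulOpposite.op_add, add_smul]
    exact add_mem ha hb

theorem traceOn_dual (hf : ∀ i, Module.Finite A (P i)) (hp : ∀ i, Module.Projective A (P i))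
    (s : Set κ) (X : Type u) [AddCommGroup X] [Module A X] [Module.Finite A X]
    [Module.Projective A X] :
    traceOn (fun i => dual (P i)) s (X →ₗ[A] A) = formsIn P s X := by
  apply le_antisymm
  · refine traceOn_le fun j hj φ => ?_
    have := hf j
    have := hp j
    obtain ⟨f, rfl⟩ := exists_lcomp_eq (P := X) (P' := P j) φ
    rintro _ ⟨g, rfl⟩ x
    exact apply_mem_traceOn (P := P) hj g (f x)
  · intro g hg
    obtain ⟨n, p, x, hx⟩ := exists_dual_basis A X
    rw [eq_sum_op_smul hx g]
    exact sum_mem fun l _ => op_smul_mem_traceOn_dual (hg (p l)) (x l)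

theorem formsIn_empty : formsIn P ∅ X = ⊥ := by
  have trace_eq_bot : traceOn P ∅ A = ⊥ := eq_bot_iff.2 (traceOn_le fun j hj => hj.elim)
  refine eq_bot_iff.2 fun g hg => LinearMap.ext fun x => ?_
  simpa [trace_eq_bot] using hg x

section Layer

variable {Y : Type u} [AddCommGroup Y] [Module A Y] {v : X →ₗ[A] Y}

theorem comap_lcomp_formsIn
    (hv : Function.Injective
      (LinearMap.lcomp ℤ (traceOn P t A ⧸ (traceOn P s A).submoduleOf (traceOn P t A)) v))
    (hY : formsIn P t Y = ⊤) :
    (formsIn P s X).comap (LinearMap.lcomp Aᵐᵒᵖ A v) = formsIn P s Y := by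
  refine le_antisymm (fun g hgv y => ?_) fun g hg x => hg (v x)
  let T := (traceOn P s A).submoduleOf (traceOn P t A)
  have hg : g ∈ formsIn P t Y := hY ▸ Submodule.mem_top
  have mkQ_comp_eq_zero : T.mkQ ∘ₗ g.codRestrict (traceOn P t A) hg = 0 :=
    (injective_iff_map_eq_zero _).1 hv _ <|
      LinearMap.ext fun x => (Submodule.Quotient.mk_eq_zero T).2 (hgv x)
  exact (Submodule.Quotient.mk_eq_zero T).1 (LinearMap.congr_fun mkQ_comp_eq_zero y)

theorem formsIn_sup_range_lcomp [Module.Projective A Y] (hst : s ⊆ t)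
    (hv : Function.Surjective
      (LinearMap.lcomp ℤ (traceOn P t A ⧸ (traceOn P s A).submoduleOf (traceOn P t A)) v))
    (hY : formsIn P t Y = ⊤) :
    formsIn P s X ⊔ LinearMap.range (LinearMap.lcomp Aᵐᵒᵖ A v) = formsIn P t X := by
  refine le_antisymm (sup_le (fun f hf x => traceOn_mono hst (hf x)) ?_) fun f hf => ?_
  · rintro _ ⟨g, rfl⟩ x
    exact (hY ▸ Submodule.mem_top : g ∈ formsIn P t Y) (v x)
  · let T := (traceOn P s A).submoduleOf (traceOn P t A)
    obtain ⟨g, hg⟩ := hv (T.mkQ ∘ₗ f.codRestrict (traceOn P t A) hf)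
    obtain ⟨g', rfl⟩ := Module.projective_lifting_property T.mkQ g T.mkQ_surjective
    let k : Y →ₗ[A] A := (traceOn P t A).subtype ∘ₗ g'
    have sub_mem : f - LinearMap.lcomp Aᵐᵒᵖ A v k ∈ formsIn P s X := fun x =>
      (Submodule.Quotient.eq T).1 (LinearMap.congr_fun hg x).symm
    rw [← sub_add_cancel f (LinearMap.lcomp Aᵐᵒᵖ A v k)]
    exact add_mem (Submodule.mem_sup_left sub_mem) (Submodule.mem_sup_right ⟨k, rfl⟩)

end Layer

/-- Restriction to the summands, followed by the projections onto the standard modules of the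
opposite algebra. -/
def dualPiToStandard [LinearOrder κ] (P : κ → ModuleCat.{u} A) (a : κ) (n : ℕ) :
    ((Fin n → P a) →ₗ[A] A) →ₗ[Aᵐᵒᵖ] (Fin n → standard (fun i => dual (P i)) a) :=
  LinearMap.pi fun l => Submodule.mkQ
      (trace Aᵐᵒᵖ (∀ j : {j // a < j}, dual (P j)) (dual (P a))) ∘ₗ
    LinearMap.lcomp Aᵐᵒᵖ A (LinearMap.single A (fun _ => P a) l)

variable [LinearOrder κ]

theorem dualPiToStandard_surjective (a : κ) (n : ℕ) :
    Function.Surjective (dualPiToStandard P a n) := by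
  intro y
  choose g hg using fun l => Submodule.mkQ_surjective
    (trace Aᵐᵒᵖ (∀ j : {j // a < j}, dual (P j)) (dual (P a))) (y l)
  refine ⟨(dualPiEquiv fun _ => P a).symm g, funext fun l => ?_⟩
  rw [← hg l]
  exact congrArg _ (congrFun ((dualPiEquiv fun _ => P a).apply_symm_apply g) l)

theorem ker_dualPiToStandard [Finite κ] (hf : ∀ i, Module.Finite A (P i))
    (hp : ∀ i, Module.Projective A (P i)) (a : κ) (n : ℕ) :
    LinearMap.ker (dualPiToStandard P a n) = formsIn P (Set.Ioi a) (Fin n → P a) := by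
  have := hf a
  have := hp a
  have trace_eq : trace Aᵐᵒᵖ (∀ j : {j // a < j}, dual (P j)) (dual (P a)) =
      formsIn P (Set.Ioi a) (P a) :=
    (trace_pi (P := fun i => dual (P i)) (Set.Ioi a)).trans
      (traceOn_dual hf hp (Set.Ioi a) (P a))
  rw [dualPiToStandard, LinearMap.ker_pi]
  ext g
  simp only [Submodule.mem_iInf, LinearMap.mem_ker]
  refine (forall_congr' fun l => (Submodule.Quotient.mk_eq_zero _).trans
    (by rw [trace_eq])).trans ?_
  refine ⟨fun hg x => ?_, fun hg l x => hg _⟩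
  rw [← LinearMap.sum_single_apply (fun _ => (P a : Type u)) x, map_sum]
  exact sum_mem fun l _ => hg l (x l)

end DualTrace

theorem IsFiltered.sup_range {A : Type u} [Ring A] {ι : Type w} {C : ι → ModuleCat.{u} A}
    {s : Set ι} {M N : Type u} [AddCommGroup M] [Module A M] [AddCommGroup N] [Module A N]
    {U : Submodule A M} (hU : IsFiltered C s U) (f : N →ₗ[A] M)
    (hN : IsFiltered C s (N ⧸ U.comap f)) : IsFiltered C s ↥(U ⊔ LinearMap.range f) := by
  let V := U ⊔ LinearMap.range f
  let f' : N →ₗ[A] V := f.codRestrict V fun x => Submodule.mem_sup_right ⟨x, rfl⟩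
  have surjective : Function.Surjective ((U.submoduleOf V).mkQ ∘ₗ f') := by
    intro y
    obtain ⟨⟨_, hx⟩, rfl⟩ := Submodule.mkQ_surjective _ y
    obtain ⟨m, hm, _, ⟨x, rfl⟩, rfl⟩ := Submodule.mem_sup.1 hx
    refine ⟨x, ((Submodule.Quotient.eq _).2 ?_).symm⟩
    simpa [f', Submodule.submoduleOf] using hm
  have ker_eq : LinearMap.ker ((U.submoduleOf V).mkQ ∘ₗ f') = LinearMap.ker (U.comap f).mkQ := by
    rw [LinearMap.ker_comp, Submodule.ker_mkQ, Submodule.ker_mkQ]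
    rfl
  exact hU.of_factor le_sup_left (hN.of_equiv
    (nonempty_equiv_of_ker_eq surjective (Submodule.mkQ_surjective _) ker_eq).some)

theorem IsFiltered.bijective_lcomp {A : Type u} [Ring A] {ι : Type w} {C : ι → ModuleCat.{u} A}
    {s : Set ι} {X Y N : Type u} [AddCommGroup X] [Module A X] [AddCommGroup Y] [Module A Y]
    [Module.Projective A Y] [AddCommGroup N] [Module A N] {v : X →ₗ[A] Y}
    (hv : ∀ j ∈ s, Function.Bijective (LinearMap.lcomp ℤ (C j) v)) (hN : IsFiltered C s N) :
    Function.Bijective (LinearMap.lcomp ℤ N v) := by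
  induction hN with
  | zero => exact ⟨fun f g _ => LinearMap.ext fun _ => Subsingleton.elim _ _,
      fun f => ⟨0, LinearMap.ext fun _ => Subsingleton.elim _ _⟩⟩
  | step j hj π hπ _ ih =>
    constructor
    · refine (injective_iff_map_eq_zero _).2 fun g hg => ?_
      have comp_eq_zero : π ∘ₗ g = 0 := (injective_iff_map_eq_zero _).1 (hv j hj).1 _ <| by
        ext x
        simpa using congrArg π (LinearMap.congr_fun hg x)
      have restrict_eq_zero : g.codRestrict (LinearMap.ker π) (LinearMap.congr_fun comp_eq_zero) =
          0 := (injective_iff_map_eq_zero _).1 ih.1 _ <| by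
        ext x
        exact LinearMap.congr_fun hg x
      ext y
      exact congrArg Subtype.val (LinearMap.congr_fun restrict_eq_zero y)
    · intro f
      obtain ⟨g, hg⟩ := (hv j hj).2 (π ∘ₗ f)
      obtain ⟨g', rfl⟩ := Module.projective_lifting_property π g hπ
      obtain ⟨k, hk⟩ := ih.2 ((f - g' ∘ₗ v).codRestrict (LinearMap.ker π) fun x => by
        simpa [sub_eq_zero] using (LinearMap.congr_fun hg x).symm)
      refine ⟨g' + (LinearMap.ker π).subtype ∘ₗ k, LinearMap.ext fun x => ?_⟩
      have k_apply : (k (v x) : _) = f x - g' (v x) :=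
        congrArg Subtype.val (LinearMap.congr_fun hk x)
      simp [k_apply]

namespace IsProperStratification

section Regular

variable {A : Type u} [Ring A] {κ : Type} [LinearOrder κ] [Finite κ] {Ψ P : κ → ModuleCat.{u} A}

theorem isFiltered_regular (h : IsProperStratification Ψ P) :
    IsFiltered Ψ Set.univ A :=
  (IsFiltered.pi fun i => (h.isFiltered_P i).mono (Set.subset_univ _)).of_equiv h.total.some

theorem isFiltered_layer (h : IsProperStratification Ψ P) (a : κ) :
    IsFiltered Ψ {a} (traceOn P (Set.Ici a) A ⧸
      (traceOn P (Set.Ioi a) A).submoduleOf (traceOn P (Set.Ici a) A)) := by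
  have isFiltered_Ici := (h.isFiltered_traceOn (isUpperSet_Ici a) h.isFiltered_regular).1
  have isFiltered_quotient := (h.isFiltered_traceOn (isUpperSet_Ioi a) isFiltered_Ici).2
  rw [traceOn_traceOn Set.Ioi_subset_Ici_self] at isFiltered_quotient
  refine isFiltered_quotient.mono ?_
  rintro x ⟨⟨-, hax⟩, hxa⟩
  exact le_antisymm (not_lt.1 hxa) hax

end Regular

variable {A : Type u} [Ring A] [IsArtinianRing A] {κ : Type} [LinearOrder κ]
  {Ψ P : κ → ModuleCat.{u} A}

theorem exists_bijective_lcomp (h : IsProperStratification Ψ P) (X : Type u) [AddCommGroup X]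
    [Module A X] [Module.Projective A X] (a : κ)
    [Module.Finite (Module.End A (Ψ a)) (X →ₗ[A] Ψ a)] :
    ∃ (n : ℕ) (v : X →ₗ[A] (Fin n → P a)), ∀ {N : Type u} [AddCommGroup N] [Module A N],
      IsFiltered Ψ {a} N → Function.Bijective (LinearMap.lcomp ℤ N v) := by
  have := h.nontrivial a
  have := h.projective a
  have (n : ℕ) : Module.Projective A (Fin n → P a) :=
    .of_equiv (DirectSum.linearEquivFunOnFintype A (Fin n) fun _ => P a)
  let _ : DivisionRing (Module.End A (Ψ a)) := DivisionRing.ofIsUnitOrEqZero fun f =>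
    or_iff_not_imp_right.2 fun hf => (Module.End.isUnit_iff f).2 (h.division a f hf)
  obtain ⟨n, ⟨b⟩⟩ : ∃ n, Nonempty (Module.Basis (Fin n) (Module.End A (Ψ a)) (X →ₗ[A] Ψ a)) :=
    ⟨_, ⟨Module.finBasis _ _⟩⟩
  choose v hv using fun l =>
    Module.projective_lifting_property (h.cover a) (b l) (h.cover_surjective a)
  let combine (d : Fin n → Module.End A (Ψ a)) : (Fin n → P a) →ₗ[A] Ψ a :=
    LinearMap.lsum A (fun _ => P a) ℤ fun l => d l ∘ₗ h.cover a
  have combine_surjective : Function.Surjective combine := by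
    intro f
    choose d hd using fun l =>
      h.exists_eq_comp_cover ((LinearMap.lsum A (fun _ => P a) ℤ).symm f l)
    exact ⟨d, by simp only [combine, hd, LinearEquiv.apply_symm_apply]⟩
  have lcomp_combine : LinearMap.lcomp ℤ (Ψ a) (LinearMap.pi v) ∘ combine = b.equivFun.symm := by
    ext d x
    simp [combine, ← hv]
  have bijective : Function.Bijective (LinearMap.lcomp ℤ (Ψ a) (LinearMap.pi v) ∘ combine) :=
    lcomp_combine ▸ b.equivFun.symm.bijective
  refine ⟨_, LinearMap.pi v, fun hN => hN.bijective_lcomp ?_⟩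
  rintro _ rfl
  exact ⟨bijective.1.of_comp_right combine_surjective, bijective.2.of_comp⟩

section StandardlyStratified

variable [Finite κ]

theorem isFiltered_formsIn_Ici (h : IsProperStratification Ψ P) {X : Type u} [AddCommGroup X]
    [Module A X] [Module.Projective A X] (a : κ)
    [Module.Finite (Module.End A (Ψ a)) (X →ₗ[A] Ψ a)]
    (hX : IsFiltered (standard fun i => dual (P i)) Set.univ (formsIn P (Set.Ioi a) X)) :
    IsFiltered (standard fun i => dual (P i)) Set.univ (formsIn P (Set.Ici a) X) := by
  obtain ⟨n, v, hv⟩ := h.exists_bijective_lcomp X a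
  have := h.projective a
  have : Module.Projective A (Fin n → P a) :=
    .of_equiv (DirectSum.linearEquivFunOnFintype A (Fin n) fun _ => P a)
  have formsIn_eq_top : formsIn P (Set.Ici a) (Fin n → P a) = ⊤ := by
    refine eq_top_iff.2 fun g _ x => ?_
    rw [← LinearMap.sum_single_apply (fun _ => (P a : Type u)) x, map_sum]
    exact sum_mem fun l _ =>
      apply_mem_traceOn Set.self_mem_Ici (g ∘ₗ LinearMap.single A (fun _ => P a) l) (x l)
  have bijective := hv (h.isFiltered_layer a)
  rw [← formsIn_sup_range_lcomp Set.Ioi_subset_Ici_self bijective.2 formsIn_eq_top]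
  refine hX.sup_range _ ?_
  rw [comap_lcomp_formsIn bijective.1 formsIn_eq_top,
    ← ker_dualPiToStandard h.finite h.projective a n]
  exact .of_equiv (.pi fun _ => .of_member (Set.mem_univ a) (LinearEquiv.refl _ _))
    (LinearMap.quotKerEquivOfSurjective _ (dualPiToStandard_surjective a n))

theorem isFiltered_formsIn (h : IsProperStratification Ψ P) (X : Type u) [AddCommGroup X]
    [Module A X] [Module.Projective A X]
    [∀ a, Module.Finite (Module.End A (Ψ a)) (X →ₗ[A] Ψ a)] {t : Finset κ} :
    IsUpperSet (t : Set κ) →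
    IsFiltered (standard fun i => dual (P i)) Set.univ (formsIn P (t : Set κ) X) := by
  induction t using Finset.induction_on_min with
  | empty =>
    intro _
    rw [Finset.coe_empty, formsIn_empty]
    exact .zero
  | insert a t ha ih =>
    intro upper
    have coe_eq_Ioi : (t : Set κ) = Set.Ioi a := by
      refine Set.Subset.antisymm ha fun x (hx : a < x) => ?_
      have x_mem := upper hx.le (Finset.mem_coe.2 (Finset.mem_insert_self a t))
      exact (Finset.mem_insert.1 x_mem).resolve_left hx.ne'
    rw [Finset.coe_insert, coe_eq_Ioi, Set.Ioi_insert]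
    rw [coe_eq_Ioi] at ih
    exact h.isFiltered_formsIn_Ici a (ih (isUpperSet_Ioi a))

theorem isFiltered_dual (h : IsProperStratification Ψ P) (X : Type u) [AddCommGroup X]
    [Module A X] [Module.Projective A X]
    [∀ a, Module.Finite (Module.End A (Ψ a)) (X →ₗ[A] Ψ a)] :
    IsFiltered (standard fun i => dual (P i)) Set.univ (X →ₗ[A] A) := by
  have := Fintype.ofFinite κ
  refine (h.isFiltered_formsIn X (t := Finset.univ) ?_).of_eq_top (eq_top_iff.2 fun g _ x => ?_)
  · rw [Finset.coe_univ]
    exact isUpperSet_univ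
  · rw [Finset.coe_univ, h.traceOn_eq_top h.isFiltered_regular]
    exact Submodule.mem_top

theorem isStandardlyStratified_dual [IsArtinianRing Aᵐᵒᵖ] (h : IsProperStratification Ψ P)
    [∀ i j, Module.Finite (Module.End A (Ψ j)) (P i →ₗ[A] Ψ j)] :
    IsStandardlyStratified fun i => dual (P i) := by
  have e := (nonempty_equiv_pi_dual h.total.some).some
  have := h.finite
  have := h.projective
  have isIndec_dual (i) : IsIndec Aᵐᵒᵖ (dual (P i)) := (h.indec i).dual
  refine ⟨isRepresentativeSet_of_equiv e (fun i => finite_dual A (P i))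
    (fun i => projective_dual A (P i)) isIndec_dual fun i j hij => ⟨fun ε => ?_⟩, fun M _ _ => ?_⟩
  · exact (h.not_iso hij).false (nonempty_equiv_of_dual ε).some
  · exact filt_iff_isFiltered.2 (.of_projective e isIndec_dual fun i => h.isFiltered_dual (P i))

end StandardlyStratified

end IsProperStratification

section ExtVanishing

variable {A : Type u} [Ring A]

theorem subsingleton_ext_of_sum_comp_eq_id {X Y : ModuleCat.{u} A} {κ : Type*} [Fintype κ]
    {Z : κ → ModuleCat.{u} A} (s : ∀ k, X ⟶ Z k) (r : ∀ k, Z k ⟶ X) (hsr : ∑ k, s k ≫ r k = 𝟙 X)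
    (hZ : ∀ k, Subsingleton (Abelian.Ext (Z k) Y 1)) : Subsingleton (Abelian.Ext X Y 1) := by
  refine subsingleton_of_forall_eq 0 fun x => ?_
  rw [← Abelian.Ext.mk₀_id_comp x, ← hsr, Abelian.Ext.mk₀_sum, Abelian.Ext.sum_comp]
  refine Finset.sum_eq_zero fun k _ => ?_
  rw [← Abelian.Ext.mk₀_comp_mk₀, Abelian.Ext.comp_assoc_of_second_deg_zero,
    Subsingleton.elim ((Abelian.Ext.mk₀ (r k)).comp x _) 0, Abelian.Ext.comp_zero]

theorem subsingleton_ext_sum {ι : Type} [Fintype ι] {Q : ι → ModuleCat.{u} A}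
    {Y : ModuleCat.{u} A} (hQ : ∀ i, Subsingleton (Abelian.Ext (Q i) Y 1)) :
    Subsingleton (Abelian.Ext (sum Q) Y 1) := by
  classical
  refine subsingleton_ext_of_sum_comp_eq_id
    (fun i => ModuleCat.ofHom (LinearMap.proj (φ := fun i => (Q i : Type u)) i))
    (fun i => ModuleCat.ofHom (LinearMap.single A (fun i => (Q i : Type u)) i)) ?_ hQ
  refine ModuleCat.hom_ext (LinearMap.ext fun x => ?_)
  rw [ModuleCat.hom_sum, LinearMap.sum_apply]
  exact Finset.univ_sum_single (M := fun i => (Q i : Type u)) x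

theorem IsFiltered.subsingleton_ext {ι : Type w} {C : ι → ModuleCat.{u} A} {s : Set ι}
    {X : ModuleCat.{u} A} {M : Type u} [AddCommGroup M] [Module A M] (hM : IsFiltered C s M)
    (hX : ∀ j ∈ s, Subsingleton (Abelian.Ext X (C j) 1)) :
    Subsingleton (Abelian.Ext X (ModuleCat.of A M) 1) := by
  induction hM with
  | @zero M =>
    refine subsingleton_of_forall_eq 0 fun x => ?_
    have id_eq_zero : 𝟙 (ModuleCat.of A M) = 0 :=
      ModuleCat.hom_ext (LinearMap.ext fun _ => Subsingleton.elim _ _)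
    rw [← Abelian.Ext.comp_mk₀_id x, id_eq_zero, Abelian.Ext.mk₀_zero, Abelian.Ext.comp_zero]
  | step j hj π hπ _ ih =>
    have := hX j hj
    refine subsingleton_of_forall_eq 0 fun x => ?_
    obtain ⟨y, rfl⟩ := Abelian.Ext.covariant_sequence_exact₂ X
      (LinearMap.shortExact_shortComplexKer hπ) x (Subsingleton.elim _ _)
    rw [Subsingleton.elim y 0, Abelian.Ext.zero_comp]

theorem exists_lift_of_subsingleton_ext {X : ModuleCat.{u} A} {M L : Type u} [AddCommGroup M]
    [Module A M] [AddCommGroup L] [Module A L] {π : M →ₗ[A] L} (hπ : Function.Surjective π)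
    (hX : Subsingleton (Abelian.Ext X (ModuleCat.of A (LinearMap.ker π)) 1)) (φ : X →ₗ[A] L) :
    ∃ ψ : X →ₗ[A] M, π ∘ₗ ψ = φ := by
  obtain ⟨y, hy⟩ := Abelian.Ext.covariant_sequence_exact₃ X
    (LinearMap.shortExact_shortComplexKer hπ) (Abelian.Ext.mk₀ (ModuleCat.ofHom φ)) (zero_add 1)
    (Subsingleton.elim _ _)
  obtain ⟨ψ, rfl⟩ := (Abelian.Ext.mk₀_bijective _ _).2 y
  rw [Abelian.Ext.mk₀_comp_mk₀] at hy
  exact ⟨ψ.hom, congrArg ModuleCat.Hom.hom ((Abelian.Ext.mk₀_bijective _ _).1 hy)⟩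

end ExtVanishing

section AddClosure

variable {A : Type u} [Ring A] {S X Y : ModuleCat.{u} A}

theorem addClosure_iff_exists_sum_comp_eq_id : addClosure S X ↔
    ∃ (n : ℕ) (s : Fin n → (X →ₗ[A] S)) (r : Fin n → (S →ₗ[A] X)),
      ∑ k, r k ∘ₗ s k = LinearMap.id := by
  classical
  constructor
  · rintro ⟨n, s, r, hrs⟩
    refine ⟨n, fun k => LinearMap.proj k ∘ₗ s,
      fun k => r ∘ₗ LinearMap.single A (fun _ => (S : Type u)) k, LinearMap.ext fun x => ?_⟩
    rw [LinearMap.sum_apply, ← hrs, LinearMap.comp_apply,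
      ← Finset.univ_sum_single (s x), map_sum]
    rfl
  · rintro ⟨n, s, r, hsr⟩
    refine ⟨n, LinearMap.pi s, ∑ k, r k ∘ₗ LinearMap.proj k, ?_⟩
    rw [← hsr]
    ext x
    simp

namespace addClosure

protected theorem self (S : ModuleCat.{u} A) : addClosure S S :=
  ⟨1, LinearMap.pi fun _ => LinearMap.id, LinearMap.proj 0, rfl⟩

theorem of_subsingleton [Subsingleton X] : addClosure S X :=
  ⟨0, 0, 0, LinearMap.ext fun _ => Subsingleton.elim _ _⟩

theorem of_retract (hY : addClosure S Y) (s : X →ₗ[A] Y) (r : Y →ₗ[A] X)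
    (hrs : r ∘ₗ s = LinearMap.id) : addClosure S X := by
  obtain ⟨n, s', r', hY⟩ := hY
  refine ⟨n, s' ∘ₗ s, r ∘ₗ r', ?_⟩
  rw [LinearMap.comp_assoc, ← LinearMap.comp_assoc s s' r', hY, LinearMap.id_comp, hrs]

theorem component {ι : Type} [Fintype ι] (Q : ι → ModuleCat.{u} A) (i : ι) :
    addClosure (sum Q) (Q i) := by
  classical
  refine (addClosure.self (sum Q)).of_retract (LinearMap.single A (fun i => (Q i : Type u)) i)
    (LinearMap.proj (φ := fun i => (Q i : Type u)) i) (LinearMap.ext fun x => ?_)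
  exact Pi.single_eq_same (M := fun i => (Q i : Type u)) i x

theorem prod (hX : addClosure S X) (hY : addClosure S Y) :
    addClosure S (ModuleCat.of A (X × Y)) := by
  obtain ⟨n, s, r, h⟩ := addClosure_iff_exists_sum_comp_eq_id.1 hX
  obtain ⟨m, s', r', h'⟩ := addClosure_iff_exists_sum_comp_eq_id.1 hY
  refine addClosure_iff_exists_sum_comp_eq_id.2
    ⟨n + m, Fin.append (fun k => s k ∘ₗ LinearMap.fst A X Y) (fun k => s' k ∘ₗ LinearMap.snd A X Y),
      Fin.append (fun k => LinearMap.inl A X Y ∘ₗ r k) (fun k => LinearMap.inr A X Y ∘ₗ r' k), ?_⟩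
  have hX (x : X) : ∑ k, r k (s k x) = x := by simpa using LinearMap.congr_fun h x
  have hY (y : Y) : ∑ k, r' k (s' k y) = y := by simpa using LinearMap.congr_fun h' y
  rw [Fin.sum_univ_add]
  simp only [Fin.append_left, Fin.append_right]
  refine LinearMap.ext fun ⟨x, y⟩ => ?_
  simp only [LinearMap.add_apply, LinearMap.sum_apply, LinearMap.comp_apply, LinearMap.fst_apply,
    LinearMap.snd_apply, ← map_sum, hX, hY]
  simp

theorem finite (hX : addClosure S X) [Module.Finite A S] : Module.Finite A X := by
  obtain ⟨n, s, r, hrs⟩ := hX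
  exact .of_surjective r (LinearMap.surjective_of_comp_eq_id s r hrs)

theorem subsingleton_ext (hX : addClosure S X) (hS : Subsingleton (Abelian.Ext S Y 1)) :
    Subsingleton (Abelian.Ext X Y 1) := by
  obtain ⟨n, s, r, hsr⟩ := addClosure_iff_exists_sum_comp_eq_id.1 hX
  refine subsingleton_ext_of_sum_comp_eq_id (fun k => ModuleCat.ofHom (s k))
    (fun k => ModuleCat.ofHom (r k)) ?_ fun _ => hS
  ext x
  simpa using LinearMap.congr_fun hsr x

end addClosure

end AddClosure

section CoprodKernel

variable {A : Type*} [Ring A] {M L X Q : Type*} [AddCommGroup M] [Module A M] [AddCommGroup L]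
  [Module A L] [AddCommGroup X] [Module A X] [AddCommGroup Q] [Module A Q] {π : M →ₗ[A] L}
  {p : X →ₗ[A] LinearMap.ker π} {β : Q →ₗ[A] L} {l : Q →ₗ[A] M}

theorem exact_subtype_ker_comp (hp : Function.Surjective p) :
    Function.Exact ((LinearMap.ker π).subtype ∘ₗ p) π := by
  rw [LinearMap.exact_iff, LinearMap.range_comp, LinearMap.range_eq_top.2 hp, Submodule.map_top,
    Submodule.range_subtype]

theorem surjective_coprod_of_exact {f : X →ₗ[A] M} (hf : Function.Exact f π) (hl : π ∘ₗ l = β)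
    (hβ : Function.Surjective β) : Function.Surjective (f.coprod l) := by
  intro m
  obtain ⟨q, hq⟩ := hβ (π m)
  obtain ⟨x, hx⟩ := (hf (m - l q)).1 (by
    rw [map_sub, ← LinearMap.comp_apply, hl, hq, sub_self])
  exact ⟨(x, q), by rw [LinearMap.coprod_apply, hx, sub_add_cancel]⟩

theorem exists_exact_ker_coprod (hl : π ∘ₗ l = β) (hp : Function.Surjective p) :
    ∃ (f : LinearMap.ker p →ₗ[A] LinearMap.ker (((LinearMap.ker π).subtype ∘ₗ p).coprod l))
      (g : LinearMap.ker (((LinearMap.ker π).subtype ∘ₗ p).coprod l) →ₗ[A] LinearMap.ker β),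
      Function.Injective f ∧ Function.Exact f g ∧ Function.Surjective g := by
  refine ⟨(LinearMap.inl A X Q).restrict fun x (hx : p x = 0) => by simp [hx],
    (LinearMap.snd A X Q).restrict fun ⟨x, q⟩ hx => ?_, ?_, ?_, ?_⟩
  · rw [LinearMap.mem_ker] at hx
    simpa [← hl] using congrArg π hx
  · intro x y hxy
    exact Subtype.ext (congrArg Prod.fst (congrArg Subtype.val hxy))
  · rintro ⟨⟨x, q⟩, hx⟩
    constructor
    · intro hq
      obtain rfl : q = 0 := congrArg Subtype.val hq
      have hpx : (p x : M) = 0 := by simpa using hx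
      exact ⟨⟨x, Subtype.ext hpx⟩, rfl⟩
    · rintro ⟨y, hy⟩
      exact Subtype.ext (congrArg Prod.snd (congrArg Subtype.val hy)).symm
  · rintro ⟨q, hq⟩
    obtain ⟨x, hx⟩ := hp ⟨-l q, by
      rw [LinearMap.mem_ker, map_neg, ← LinearMap.comp_apply, hl, LinearMap.mem_ker.1 hq, neg_zero]⟩
    exact ⟨⟨(x, q), by simp [hx]⟩, rfl⟩

end CoprodKernel

namespace IsProperCostratifyingSystem

variable {A : Type u} [Ring A] {ι : Type} [Fintype ι] [LinearOrder ι] {Ψ Q : ι → ModuleCat.{u} A}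
  {M L : Type u} [AddCommGroup M] [Module A M] [AddCommGroup L] [Module A L] {X : ModuleCat.{u} A}
  {s : Set ι}

theorem subsingleton_ext (h : IsProperCostratifyingSystem Ψ Q) (hX : addClosure (sum Q) X)
    (hM : IsFiltered Ψ s M) : Subsingleton (Abelian.Ext X (ModuleCat.of A M) 1) :=
  hX.subsingleton_ext
    (subsingleton_ext_sum fun i => hM.subsingleton_ext fun j _ => h.ext_eq_zero i j)

theorem exists_lift (h : IsProperCostratifyingSystem Ψ Q) (hX : addClosure (sum Q) X)
    {π : M →ₗ[A] L} (hπ : Function.Surjective π) (hk : IsFiltered Ψ s (LinearMap.ker π))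
    (φ : X →ₗ[A] L) : ∃ ψ : X →ₗ[A] M, π ∘ₗ ψ = φ :=
  exists_lift_of_subsingleton_ext hπ (h.subsingleton_ext hX hk) φ

theorem exists_cover (h : IsProperCostratifyingSystem Ψ Q) (i : ι) : ∃ β : Q i →ₗ[A] Ψ i,
    Function.Surjective β ∧ IsFiltered Ψ (Set.Iic i) (LinearMap.ker β) := by
  obtain ⟨Z, α, β, hα, hαβ, hβ, hZ⟩ := h.exact_sequence i
  refine ⟨β, hβ, (filt_subtype_iff_isFiltered (s := Set.Iic i)).1 hZ |>.of_equiv ?_⟩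
  exact (kerEquivOfExact hα hαβ).symm

theorem exists_presentation (h : IsProperCostratifyingSystem Ψ Q)
    (hM : IsFiltered Ψ Set.univ M) : ∃ (X : ModuleCat.{u} A) (p : X →ₗ[A] M),
      addClosure (sum Q) X ∧ Function.Surjective p ∧
        IsFiltered Ψ Set.univ (LinearMap.ker p) := by
  induction hM with
  | zero =>
    exact ⟨ModuleCat.of A PUnit, 0, .of_subsingleton, fun x => ⟨0, Subsingleton.elim _ _⟩, .zero⟩
  | step j _ π hπ hk ih =>
    obtain ⟨X, p, hX, hp, hpk⟩ := ih
    obtain ⟨β, hβ, hβk⟩ := h.exists_cover j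
    obtain ⟨l, hl⟩ := h.exists_lift (.component Q j) hπ hk β
    obtain ⟨f, g, hf, hfg, hg⟩ := exists_exact_ker_coprod hl hp
    exact ⟨ModuleCat.of A (X × Q j), _, hX.prod (.component Q j),
      surjective_coprod_of_exact (exact_subtype_ker_comp hp) hl hβ,
      (hβk.mono (Set.subset_univ _)).of_exact f g hf hfg hg hpk⟩

end IsProperCostratifyingSystem

section HomFunctor

variable {A : Type u} [Ring A] (S : ModuleCat.{u} A) {M N L X Y : ModuleCat.{u} A}

/-- The action of `homFunctor S` on linear maps between modules, as an additive map. -/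
def homMap : (M →ₗ[A] N) →+ ((S ⟶ M) →ₗ[EndOp S] (S ⟶ N)) where
  toFun f :=
    { toFun := fun g => g ≫ ModuleCat.ofHom f
      map_add' := fun _ _ => Preadditive.add_comp _ _ _ _ _ _
      map_smul' := fun _ _ => Category.assoc _ _ _ }
  map_zero' := rfl
  map_add' _ _ := rfl

theorem homMap_comp (f : M →ₗ[A] N) (g : N →ₗ[A] L) :
    homMap S (g ∘ₗ f) = homMap S g ∘ₗ homMap S f := rfl

variable {S}

theorem homMap_injective {f : M →ₗ[A] N} (hf : Function.Injective f) :
    Function.Injective (homMap S f) := fun _ _ hab =>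
  ModuleCat.hom_ext (LinearMap.ext fun x =>
    hf (LinearMap.congr_fun (congrArg ModuleCat.Hom.hom hab) x))

theorem homMap_exact {f : M →ₗ[A] N} {g : N →ₗ[A] L} (hf : Function.Injective f)
    (hfg : Function.Exact f g) : Function.Exact (homMap S f) (homMap S g) := by
  intro b
  constructor
  · intro hb
    have mem_range : ∀ x, ∃ y, f y = b.hom x := fun x =>
      (hfg (b.hom x)).1 (LinearMap.congr_fun (congrArg ModuleCat.Hom.hom hb) x)
    let e := LinearEquiv.ofInjective f hf
    exact ⟨ModuleCat.ofHom (e.symm.toLinearMap ∘ₗ b.hom.codRestrict (LinearMap.range f) mem_range),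
      ModuleCat.hom_ext (LinearMap.ext fun x =>
        congrArg Subtype.val (e.apply_symm_apply ⟨b.hom x, mem_range x⟩))⟩
  · rintro ⟨a, rfl⟩
    exact ModuleCat.hom_ext (LinearMap.ext fun x => hfg.apply_apply_eq_zero (a.hom x))

theorem homMap_surjective {f : M →ₗ[A] N}
    (hf : ∀ φ : S →ₗ[A] N, ∃ ψ : S →ₗ[A] M, f ∘ₗ ψ = φ) : Function.Surjective (homMap S f) := by
  intro φ
  obtain ⟨ψ, hψ⟩ := hf φ.hom
  exact ⟨ModuleCat.ofHom ψ, ModuleCat.hom_ext hψ⟩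

theorem homMap_bijective {f : M →ₗ[A] N} (hf : Function.Bijective f) :
    Function.Bijective (homMap S f) :=
  ⟨homMap_injective hf.1, homMap_surjective fun φ =>
    ⟨(LinearEquiv.ofBijective f hf).symm.toLinearMap ∘ₗ φ,
      LinearMap.ext fun x => (LinearEquiv.ofBijective f hf).apply_symm_apply (φ x)⟩⟩

variable (S) in
/-- `Hom(S, -)` commutes with finite direct sums. -/
def homSumEquiv {κ : Type} [Fintype κ] (Q : κ → ModuleCat.{u} A) :
    (S ⟶ sum Q) ≃ₗ[EndOp S] ∀ i, S ⟶ Q i where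
  toFun f i := f ≫ ModuleCat.ofHom (LinearMap.proj (φ := fun i => (Q i : Type u)) i)
  map_add' _ _ := rfl
  map_smul' _ _ := rfl
  invFun g := ModuleCat.ofHom (LinearMap.pi fun i => (g i).hom)
  left_inv _ := rfl
  right_inv _ := rfl

variable (S) in
/-- The regular module over `EndOp S` is `Hom(S, S)`. -/
def endOpEquiv : EndOp S ≃ₗ[EndOp S] (S ⟶ S) where
  toFun γ := γ.unop
  map_add' _ _ := rfl
  map_smul' _ _ := rfl
  invFun f := MulOpposite.op f
  left_inv _ := rfl
  right_inv _ := rfl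

theorem eq_sum_op_comp_smul {n : ℕ} {s : Fin n → (M →ₗ[A] S)} {r : Fin n → (S →ₗ[A] M)}
    (hsr : ∑ k, r k ∘ₗ s k = LinearMap.id) (f : S ⟶ M) :
    f = ∑ k, (MulOpposite.op (f ≫ ModuleCat.ofHom (s k)) : EndOp S) • ModuleCat.ofHom (r k) := by
  refine ModuleCat.hom_ext (LinearMap.ext fun x => ?_)
  rw [ModuleCat.hom_sum, LinearMap.sum_apply]
  have apply_eq := LinearMap.congr_fun hsr (f.hom x)
  rw [LinearMap.sum_apply] at apply_eq
  exact apply_eq.symm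

namespace addClosure

theorem homMap_bijective (hM : addClosure S M) :
    Function.Bijective (homMap S : (M →ₗ[A] N) →+ _) := by
  obtain ⟨n, s, r, hsr⟩ := addClosure_iff_exists_sum_comp_eq_id.1 hM
  refine ⟨(injective_iff_map_eq_zero _).2 fun f hf => LinearMap.ext fun x => ?_, fun φ =>
    ⟨∑ k, (φ (ModuleCat.ofHom (r k))).hom ∘ₗ s k, LinearMap.ext fun g => ?_⟩⟩
  · have comp_eq_zero (k : Fin n) : f ∘ₗ r k = 0 :=
      congrArg ModuleCat.Hom.hom (LinearMap.congr_fun hf (ModuleCat.ofHom (r k)))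
    rw [← LinearMap.comp_id f, ← hsr, LinearMap.comp_apply, LinearMap.sum_apply, map_sum]
    exact Finset.sum_eq_zero fun k _ => LinearMap.congr_fun (comp_eq_zero k) (s k x)
  · conv_rhs => rw [eq_sum_op_comp_smul hsr g, map_sum]
    simp only [map_smul, map_sum, LinearMap.sum_apply]
    rfl

theorem exists_hom_retract (hM : addClosure S M) :
    ∃ (n : ℕ) (s : (S ⟶ M) →ₗ[EndOp S] (Fin n → EndOp S))
      (r : (Fin n → EndOp S) →ₗ[EndOp S] (S ⟶ M)), r ∘ₗ s = LinearMap.id := by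
  obtain ⟨n, s, r, hrs⟩ := hM
  let e := homSumEquiv S (fun _ : Fin n => S) ≪≫ₗ
    LinearEquiv.piCongrRight fun _ => (endOpEquiv S).symm
  refine ⟨n, e.toLinearMap ∘ₗ homMap S (N := sum fun _ : Fin n => S) s,
    homMap S (M := sum fun _ : Fin n => S) r ∘ₗ e.symm.toLinearMap, ?_⟩
  rw [LinearMap.comp_assoc, ← LinearMap.comp_assoc _ e.toLinearMap, LinearEquiv.symm_comp,
    LinearMap.id_comp]
  exact congrArg (homMap S) hrs

theorem finite_hom (hM : addClosure S M) : Module.Finite (EndOp S) (S ⟶ M) := by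
  obtain ⟨n, s, r, hrs⟩ := hM.exists_hom_retract
  exact .of_surjective r (LinearMap.surjective_of_comp_eq_id s r hrs)

theorem projective_hom (hM : addClosure S M) : Module.Projective (EndOp S) (S ⟶ M) := by
  obtain ⟨n, s, r, hrs⟩ := hM.exists_hom_retract
  exact .of_split s r hrs

theorem isIndec_hom (hM : addClosure S M) (h : IsIndec A M) : IsIndec (EndOp S) (S ⟶ M) where
  nontrivial := by
    have := h.nontrivial
    refine not_subsingleton_iff_nontrivial.1 fun _ => ?_
    exact one_ne_zero (hM.homMap_bijective.1 (LinearMap.ext fun _ => Subsingleton.elim _ _) :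
      (1 : Module.End A M) = 0)
  idempotent φ hφ := by
    obtain ⟨f, rfl⟩ := hM.homMap_bijective.2 φ
    rcases h.idempotent f (hM.homMap_bijective.1 hφ) with rfl | rfl
    · exact .inl (map_zero _)
    · exact .inr rfl

end addClosure

theorem homMap_bijective_of_presentation {d : Y →ₗ[A] X} {p : X →ₗ[A] M} (hX : addClosure S X)
    (hY : addClosure S Y) (hdp : Function.Exact d p) (hp : Function.Surjective p)
    (hSp : Function.Surjective (homMap S p)) :
    Function.Bijective (homMap S : (M →ₗ[A] N) →+ _) := by
  refine ⟨(injective_iff_map_eq_zero _).2 fun f hf => ?_, fun φ => ?_⟩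
  · have comp_eq_zero : f ∘ₗ p = 0 := hX.homMap_bijective.1 <| by
      rw [homMap_comp, hf, LinearMap.zero_comp, map_zero]
    rwa [← LinearMap.zero_comp p, LinearMap.cancel_right hp] at comp_eq_zero
  · obtain ⟨f₀, hf₀⟩ := hX.homMap_bijective.2 (φ ∘ₗ homMap S p)
    have comp_eq_zero : f₀ ∘ₗ d = 0 := hY.homMap_bijective.1 <| by
      rw [homMap_comp, hf₀, LinearMap.comp_assoc, ← homMap_comp, hdp.linearMap_comp_eq_zero,
        map_zero, map_zero, LinearMap.comp_zero]
    obtain ⟨f, rfl⟩ := exists_comp_eq_of_ker_le hp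
      (hdp.linearMap_ker_eq.trans_le (LinearMap.range_le_ker_iff.2 comp_eq_zero))
    exact ⟨f, (LinearMap.cancel_right hSp).1 hf₀⟩

end HomFunctor

section Counit

variable {A : Type u} [Ring A] (S : ModuleCat.{u} A) {M N X Y : ModuleCat.{u} A}
  {V W : ModuleCat.{u} (EndOp S)}

/-- The evaluation map `S ⊗_ℤ Hom(S, M) → M`. -/
def evalTensor (M : ModuleCat.{u} A) : (S ⊗[ℤ] (homFunctor S).obj M) →ₗ[A] M :=
  TensorProduct.AlgebraTensorModule.lift
    { toFun := fun x =>
        AddMonoidHom.toIntLinearMap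
          { toFun := fun f : S ⟶ M => f.hom x
            map_zero' := rfl
            map_add' := fun _ _ => rfl }
      map_add' := fun x y => by
        ext f
        exact map_add (ModuleCat.Hom.hom (show S ⟶ M from f)) x y
      map_smul' := fun a x => by
        ext f
        exact map_smul (ModuleCat.Hom.hom (show S ⟶ M from f)) a x }

theorem balancing_le_ker_evalTensor (M : ModuleCat.{u} A) :
    balancing S ((homFunctor S).obj M) ≤ LinearMap.ker (evalTensor S M) := by
  refine Submodule.span_le.2 ?_
  rintro _ ⟨γ, x, f, rfl⟩
  rw [SetLike.mem_coe, LinearMap.mem_ker, map_sub, sub_eq_zero]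
  rfl

/-- The counit `S ⊗_Γ Hom(S, M) → M` of the tensor-hom adjunction, `Γ = EndOp S`. -/
def counit (M : ModuleCat.{u} A) : (tensorFunctor S).obj ((homFunctor S).obj M) →ₗ[A] M :=
  (balancing S ((homFunctor S).obj M)).liftQ (evalTensor S M) (balancing_le_ker_evalTensor S M)

/-- The map `x ↦ x ⊗ y` from `S` to `S ⊗_Γ V`. -/
def tmulRight (y : V) : S →ₗ[A] (tensorFunctor S).obj V where
  toFun x := (balancing S V).mkQ (x ⊗ₜ[ℤ] y)
  map_add' x x' := by rw [TensorProduct.add_tmul, map_add]; rfl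
  map_smul' a x := by rw [← TensorProduct.smul_tmul', map_smul]; rfl

theorem tmulRight_smul (γ : EndOp S) (x : S) (y : V) :
    tmulRight S (γ • y) x = tmulRight S y (γ.unop.hom x) := by
  symm
  exact (Submodule.Quotient.eq _).2 (Submodule.subset_span ⟨γ, x, y, rfl⟩)

theorem tmulRight_sum {n : ℕ} (y : Fin n → V) (x : S) :
    tmulRight S (∑ k, y k) x = ∑ k, tmulRight S (y k) x := by
  change (balancing S V).mkQ (x ⊗ₜ[ℤ] ∑ k, y k) = _
  rw [TensorProduct.tmul_sum, map_sum]
  rfl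

variable {S}

theorem tensorFunctor_hom_ext {f g : (tensorFunctor S).obj V →ₗ[A] M}
    (h : ∀ (x : S) (y : V), f (tmulRight S y x) = g (tmulRight S y x)) : f = g :=
  Submodule.linearMap_qext _ (TensorProduct.AlgebraTensorModule.ext h)

theorem tensorFunctor_map_zero : (tensorFunctor S).map (0 : V ⟶ W) = 0 :=
  ModuleCat.hom_ext <| tensorFunctor_hom_ext fun x y => by
    change (balancing S W).mkQ (x ⊗ₜ[ℤ] (0 : W)) = 0
    rw [TensorProduct.tmul_zero, map_zero]

theorem tensorFunctor_map_surjective (f : V ⟶ W) (hf : Function.Surjective f.hom) :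
    Function.Surjective ((tensorFunctor S).map f).hom := by
  intro z
  obtain ⟨z, rfl⟩ := (balancing S W).mkQ_surjective z
  obtain ⟨w, rfl⟩ := LinearMap.lTensor_surjective S (g := f.hom.toAddMonoidHom.toIntLinearMap) hf z
  exact ⟨(balancing S V).mkQ w, rfl⟩

theorem counit_naturality (f : M ⟶ N) : counit S N ∘ₗ
    ((tensorFunctor S).map ((homFunctor S).map f)).hom = f.hom ∘ₗ counit S M :=
  tensorFunctor_hom_ext fun _ _ => rfl

theorem addClosure.counit_bijective (hM : addClosure S M) : Function.Bijective (counit S M) := by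
  obtain ⟨n, s, r, hsr⟩ := addClosure_iff_exists_sum_comp_eq_id.1 hM
  let inv : M →ₗ[A] (tensorFunctor S).obj ((homFunctor S).obj M) :=
    ∑ k, tmulRight S (V := (homFunctor S).obj M) (ModuleCat.ofHom (r k)) ∘ₗ s k
  have inv_comp : inv ∘ₗ counit S M = LinearMap.id := tensorFunctor_hom_ext fun x f => by
    let γ (k : Fin n) : EndOp S := MulOpposite.op ((show S ⟶ M from f) ≫ ModuleCat.ofHom (s k))
    let ρ (k : Fin n) : (homFunctor S).obj M := ModuleCat.ofHom (r k)
    have eq_sum : f = ∑ k, γ k • ρ k := eq_sum_op_comp_smul hsr (show S ⟶ M from f)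
    calc inv (f.hom x) = ∑ k, tmulRight S (ρ k) (s k (f.hom x)) := LinearMap.sum_apply _ _ _
      _ = ∑ k, tmulRight S (γ k • ρ k) x :=
        Finset.sum_congr rfl fun k _ => (tmulRight_smul S (γ k) x (ρ k)).symm
      _ = tmulRight S f x := by rw [← tmulRight_sum, ← eq_sum]
  have comp_inv : counit S M ∘ₗ inv = LinearMap.id := by
    refine Eq.trans (LinearMap.ext fun m => ?_) hsr
    rw [LinearMap.comp_apply, LinearMap.sum_apply, map_sum, LinearMap.sum_apply]
    rfl
  exact ⟨LinearMap.injective_of_comp_eq_id _ _ inv_comp,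
    LinearMap.surjective_of_comp_eq_id _ _ comp_inv⟩

theorem counit_bijective_of_presentation {d : Y →ₗ[A] X} {p : X →ₗ[A] M} (hX : addClosure S X)
    (hY : addClosure S Y) (hdp : Function.Exact d p) (hp : Function.Surjective p)
    (hSp : Function.Surjective (homMap S p)) : Function.Bijective (counit S M) := by
  constructor
  · refine (injective_iff_map_eq_zero _).2 fun z hz => ?_
    obtain ⟨w, rfl⟩ := tensorFunctor_map_surjective
      ((homFunctor S).map (ModuleCat.ofHom p)) hSp z
    obtain ⟨y, hy⟩ := (hdp _).1
      ((LinearMap.congr_fun (counit_naturality (ModuleCat.ofHom p)) w).symm.trans hz)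
    obtain ⟨v, rfl⟩ := hY.counit_bijective.2 y
    obtain rfl : ((tensorFunctor S).map ((homFunctor S).map (ModuleCat.ofHom d))).hom v = w :=
      hX.counit_bijective.1
        ((LinearMap.congr_fun (counit_naturality (ModuleCat.ofHom d)) v).trans hy)
    have map_comp_eq_zero : (tensorFunctor S).map ((homFunctor S).map (ModuleCat.ofHom d)) ≫
        (tensorFunctor S).map ((homFunctor S).map (ModuleCat.ofHom p)) = 0 := by
      rw [← Functor.map_comp, ← Functor.map_comp, ← ModuleCat.ofHom_comp,
        hdp.linearMap_comp_eq_zero, ModuleCat.ofHom_zero, Functor.map_zero, tensorFunctor_map_zero]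
    exact LinearMap.congr_fun (congrArg ModuleCat.Hom.hom map_comp_eq_zero) v
  · intro m
    obtain ⟨x, rfl⟩ := hp m
    obtain ⟨w, rfl⟩ := hX.counit_bijective.2 x
    exact ⟨_, LinearMap.congr_fun (counit_naturality (ModuleCat.ofHom p)) w⟩

theorem nonempty_tensorFunctor_equiv (hM : Function.Bijective (counit S M))
    (e : V ≃ₗ[EndOp S] (S ⟶ M)) : Nonempty ((tensorFunctor S).obj V ≃ₗ[A] M) :=
  ⟨((tensorFunctor S).mapIso (LinearEquiv.toModuleIso
    (X₂ := ((homFunctor S).obj M : Type u)) e)).toLinearEquiv ≪≫ₗ .ofBijective (counit S M) hM⟩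

end Counit

section Pushout

variable {A : Type*} [Ring A] {X Z P W : Type*} [AddCommGroup X] [Module A X] [AddCommGroup Z]
  [Module A Z] [AddCommGroup P] [Module A P] [AddCommGroup W] [Module A W] {α : Z →ₗ[A] P}
  {β : P →ₗ[A] W} {κ : Z →ₗ[A] X}

theorem ker_coprod_eq_range {Y : Type*} [AddCommGroup Y] [Module A Y] {f : X →ₗ[A] Y}
    {g : Y →ₗ[A] W} {l : P →ₗ[A] Y} (hαβ : Function.Exact α β) (hf : Function.Injective f)
    (hfg : Function.Exact f g) (hl : g ∘ₗ l = β) (hlα : l ∘ₗ α = f ∘ₗ κ) :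
    LinearMap.ker (f.coprod l) = LinearMap.range ((-κ).prod α) := by
  have l_apply (z : Z) : l (α z) = f (κ z) := LinearMap.congr_fun hlα z
  ext ⟨x, p⟩
  rw [LinearMap.mem_ker, LinearMap.coprod_apply]
  constructor
  · intro h0
    have hp : β p = 0 := by
      simpa [← hl, hfg.apply_apply_eq_zero] using congrArg g h0
    obtain ⟨z, rfl⟩ := (hαβ p).1 hp
    refine ⟨z, Prod.ext (hf ?_) rfl⟩
    rw [l_apply] at h0
    simpa using (eq_neg_of_add_eq_zero_left h0).symm
  · rintro ⟨z, hz⟩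
    obtain ⟨rfl, rfl⟩ := Prod.ext_iff.1 hz
    simp [l_apply]

theorem nonempty_equiv_of_pushout {Y Y' : Type*} [AddCommGroup Y] [Module A Y] [AddCommGroup Y']
    [Module A Y'] {f : X →ₗ[A] Y} {g : Y →ₗ[A] W} {l : P →ₗ[A] Y} {f' : X →ₗ[A] Y'}
    {g' : Y' →ₗ[A] W} {l' : P →ₗ[A] Y'} (hαβ : Function.Exact α β) (hβ : Function.Surjective β)
    (hf : Function.Injective f) (hfg : Function.Exact f g) (hl : g ∘ₗ l = β)
    (hlα : l ∘ₗ α = f ∘ₗ κ) (hf' : Function.Injective f') (hfg' : Function.Exact f' g')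
    (hl' : g' ∘ₗ l' = β) (hlα' : l' ∘ₗ α = f' ∘ₗ κ) : Nonempty (Y ≃ₗ[A] Y') :=
  nonempty_equiv_of_ker_eq (surjective_coprod_of_exact hfg hl hβ)
    (surjective_coprod_of_exact hfg' hl' hβ)
    ((ker_coprod_eq_range hαβ hf hfg hl hlα).trans
      (ker_coprod_eq_range hαβ hf' hfg' hl' hlα').symm)

theorem exists_pushout {A : Type*} [Ring A] {X Z P W : Type u} [AddCommGroup X] [Module A X]
    [AddCommGroup Z] [Module A Z] [AddCommGroup P] [Module A P] [AddCommGroup W] [Module A W]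
    {α : Z →ₗ[A] P} {β : P →ₗ[A] W} (hα : Function.Injective α) (hαβ : Function.Exact α β)
    (hβ : Function.Surjective β) (κ : Z →ₗ[A] X) :
    ∃ (Y : ModuleCat.{u} A) (f : X →ₗ[A] Y) (g : Y →ₗ[A] W) (l : P →ₗ[A] Y),
      Function.Injective f ∧ Function.Exact f g ∧ Function.Surjective g ∧ g ∘ₗ l = β ∧
        l ∘ₗ α = f ∘ₗ κ := by
  let J := LinearMap.range ((-κ).prod α)
  have le_ker : J ≤ LinearMap.ker (β ∘ₗ LinearMap.snd A X P) := by
    rintro _ ⟨z, rfl⟩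
    exact hαβ.apply_apply_eq_zero z
  refine ⟨ModuleCat.of A ((X × P) ⧸ J), J.mkQ ∘ₗ LinearMap.inl A X P, J.liftQ _ le_ker,
    J.mkQ ∘ₗ LinearMap.inr A X P, (injective_iff_map_eq_zero _).2 fun x hx => ?_, fun y => ?_,
    fun w => ?_, rfl, LinearMap.ext fun z => ?_⟩
  · obtain ⟨z, hz⟩ := (Submodule.Quotient.mk_eq_zero J).1 hx
    obtain rfl : z = 0 := hα (by simpa using congrArg Prod.snd hz)
    simpa using (congrArg Prod.fst hz).symm
  · obtain ⟨⟨x, p⟩, rfl⟩ := J.mkQ_surjective y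
    constructor
    · intro hp
      obtain ⟨z, rfl⟩ := (hαβ p).1 hp
      exact ⟨x + κ z, (Submodule.Quotient.eq J).2 ⟨-z, by simp⟩⟩
    · rintro ⟨x', hx'⟩
      rw [← hx']
      exact map_zero β
  · obtain ⟨p, rfl⟩ := hβ w
    exact ⟨J.mkQ (0, p), rfl⟩
  · exact (Submodule.Quotient.eq J).2 ⟨z, by simp⟩

end Pushout

section HomExtension

variable {A : Type u} [Ring A] {S K P L M N : ModuleCat.{u} A}

theorem nonempty_equiv_ker_homMap (f : M →ₗ[A] N) :
    Nonempty (LinearMap.ker (homMap S f) ≃ₗ[EndOp S] (S ⟶ ModuleCat.of A (LinearMap.ker f))) :=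
  have subtype_injective := Submodule.injective_subtype (LinearMap.ker f)
  ⟨(kerEquivOfExact (f := homMap S (M := ModuleCat.of A (LinearMap.ker f))
      (LinearMap.ker f).subtype)
    (homMap_injective subtype_injective)
    (homMap_exact subtype_injective (LinearMap.exact_subtype_ker_map f))).symm⟩

theorem exists_extension_equiv_hom {α : K →ₗ[A] P} {β : P →ₗ[A] L} (hα : Function.Injective α)
    (hαβ : Function.Exact α β) (hβ : Function.Surjective β)
    (hSβ : Function.Surjective (homMap S β)) (hP : Module.Projective (EndOp S) (S ⟶ P))
    (hKM : Function.Surjective (homMap S : (K →ₗ[A] M) →+ _)) {Y : Type u} [AddCommGroup Y]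
    [Module (EndOp S) Y] {f : (S ⟶ M) →ₗ[EndOp S] Y} {g : Y →ₗ[EndOp S] (S ⟶ L)}
    (hf : Function.Injective f) (hfg : Function.Exact f g) (hg : Function.Surjective g) :
    ∃ (N : ModuleCat.{u} A) (a : M →ₗ[A] N) (b : N →ₗ[A] L), Function.Injective a ∧
      Function.Exact a b ∧ Function.Surjective b ∧ Nonempty (Y ≃ₗ[EndOp S] (S ⟶ N)) := by
  have exact_homMap := homMap_exact (S := S) hα hαβ
  obtain ⟨l, hl⟩ := Module.projective_lifting_property g (homMap S β) hg
  have mem_ker (z : S ⟶ K) : (l ∘ₗ homMap S α) z ∈ LinearMap.ker g :=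
    (LinearMap.congr_fun hl _).trans (exact_homMap.apply_apply_eq_zero z)
  let e := kerEquivOfExact hf hfg
  obtain ⟨κ, hκ⟩ := hKM (e.symm.toLinearMap ∘ₗ (l ∘ₗ homMap S α).codRestrict _ mem_ker)
  have l_comp : l ∘ₗ homMap S α = f ∘ₗ homMap S κ := by
    rw [hκ]
    exact LinearMap.ext fun z => (congrArg Subtype.val (e.apply_symm_apply ⟨_, mem_ker z⟩)).symm
  obtain ⟨N, a, b, l', ha, hab, hb, hl', hl'α⟩ := exists_pushout hα hαβ hβ κ
  exact ⟨N, a, b, ha, hab, hb, nonempty_equiv_of_pushout exact_homMap hSβ hf hfg hl l_comp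
    (homMap_injective ha) (homMap_exact ha hab) (by rw [← homMap_comp, hl'])
    (by rw [← homMap_comp, ← homMap_comp, hl'α])⟩

end HomExtension

section Transfer

variable {A : Type u} [Ring A] {ι : Type} [Fintype ι]

/-- The family `F(Ψ i)` of modules over `Γ = End_A(Q)ᵒᵖ`, `Q = ⨁ i, Q i`, indexed by `ι` with the
opposite order. -/
def ΓΨ (Ψ Q : ι → ModuleCat.{u} A) : ιᵒᵈ → ModuleCat.{u} (EndOp (sum Q)) :=
  fun i => (homFunctor (sum Q)).obj (Ψ (OrderDual.ofDual i))

theorem nonempty_equiv_pi_ΓP (Q : ι → ModuleCat.{u} A) :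
    Nonempty (EndOp (sum Q) ≃ₗ[EndOp (sum Q)] ∀ i, ΓP Q i) :=
  ⟨endOpEquiv (sum Q) ≪≫ₗ homSumEquiv (sum Q) Q⟩

variable [LinearOrder ι] {Ψ Q : ι → ModuleCat.{u} A}

namespace IsProperCostratifyingSystem

variable {M N : ModuleCat.{u} A} {s : Set ι}

theorem homMap_surjective (h : IsProperCostratifyingSystem Ψ Q) {f : M →ₗ[A] N}
    (hf : Function.Surjective f) (hk : IsFiltered Ψ s (LinearMap.ker f)) :
    Function.Surjective (homMap (sum Q) f) :=
  Costrat.homMap_surjective (h.exists_lift (.self _) hf hk)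

theorem exists_exact_presentation (h : IsProperCostratifyingSystem Ψ Q)
    (hM : IsFiltered Ψ Set.univ M) :
    ∃ (X Y : ModuleCat.{u} A) (d : Y →ₗ[A] X) (p : X →ₗ[A] M), addClosure (sum Q) X ∧
      addClosure (sum Q) Y ∧ Function.Exact d p ∧ Function.Surjective p ∧
        Function.Surjective (homMap (sum Q) p) := by
  obtain ⟨X, p, hX, hp, hpk⟩ := h.exists_presentation hM
  obtain ⟨Y, q, hY, hq, -⟩ := h.exists_presentation hpk
  exact ⟨X, Y, _, p, hX, hY, exact_subtype_ker_comp hq, hp, h.homMap_surjective hp hpk⟩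

theorem homMap_bijective (h : IsProperCostratifyingSystem Ψ Q) (hM : IsFiltered Ψ Set.univ M) :
    Function.Bijective (homMap (sum Q) : (M →ₗ[A] N) →+ _) := by
  obtain ⟨X, Y, d, p, hX, hY, hdp, hp, hQp⟩ := h.exists_exact_presentation hM
  exact homMap_bijective_of_presentation hX hY hdp hp hQp

theorem counit_bijective (h : IsProperCostratifyingSystem Ψ Q) (hM : IsFiltered Ψ Set.univ M) :
    Function.Bijective (counit (sum Q) M) := by
  obtain ⟨X, Y, d, p, hX, hY, hdp, hp, hQp⟩ := h.exists_exact_presentation hM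
  exact counit_bijective_of_presentation hX hY hdp hp hQp

theorem isFiltered_hom (h : IsProperCostratifyingSystem Ψ Q) {M : Type u} [AddCommGroup M]
    [Module A M] (hM : IsFiltered Ψ s M) :
    IsFiltered (ΓΨ Ψ Q) (OrderDual.ofDual ⁻¹' s) (sum Q ⟶ ModuleCat.of A M) := by
  induction hM with
  | @zero M =>
    have : Subsingleton (sum Q ⟶ ModuleCat.of A M) :=
      ⟨fun f g => by ext x; exact Subsingleton.elim _ _⟩
    exact .zero
  | @step M _ _ j hj π hπ hk ih =>
    refine .step (M := sum Q ⟶ ModuleCat.of A M) (OrderDual.toDual j) hj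
      (homMap (M := ModuleCat.of A M) (sum Q) π)
      (h.homMap_surjective (M := ModuleCat.of A M) hπ hk) (ih.of_equiv ?_)
    exact (nonempty_equiv_ker_homMap (M := ModuleCat.of A M) π).some

theorem exists_equiv_hom (h : IsProperCostratifyingSystem Ψ Q) {Y : Type u} [AddCommGroup Y]
    [Module (EndOp (sum Q)) Y] (hY : IsFiltered (ΓΨ Ψ Q) Set.univ Y) :
    ∃ M : ModuleCat.{u} A, IsFiltered Ψ Set.univ M ∧
      Nonempty (Y ≃ₗ[EndOp (sum Q)] (sum Q ⟶ M)) := by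
  induction hY with
  | zero =>
    have : Subsingleton (sum Q ⟶ ModuleCat.of A PUnit.{u + 1}) := ⟨fun f g => by ext⟩
    exact ⟨ModuleCat.of A PUnit, .zero, ⟨.ofSubsingleton _ _⟩⟩
  | @step Y _ _ i _ π hπ _ ih =>
    obtain ⟨M, hM, ⟨e⟩⟩ := ih
    obtain ⟨β, hβ, hβk⟩ := h.exists_cover (OrderDual.ofDual i)
    have exact_ker : Function.Exact ((LinearMap.ker π).subtype ∘ₗ e.symm.toLinearMap) π :=
      exact_subtype_ker_comp e.symm.surjective
    obtain ⟨N, a, b, ha, hab, hb, ⟨e'⟩⟩ := exists_extension_equiv_hom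
      (K := ModuleCat.of A (LinearMap.ker β)) (Submodule.injective_subtype _)
      (LinearMap.exact_subtype_ker_map β) hβ (h.homMap_surjective hβ hβk)
      (addClosure.component Q (OrderDual.ofDual i)).projective_hom
      (h.homMap_bijective (hβk.mono (Set.subset_univ _))).2
      ((Submodule.injective_subtype _).comp e.symm.injective) exact_ker hπ
    have isFiltered_Ψ : IsFiltered Ψ Set.univ (Ψ (OrderDual.ofDual i)) :=
      .of_member (Set.mem_univ _) (.refl ..)
    exact ⟨N, isFiltered_Ψ.of_exact a b ha hab hb hM, ⟨e'⟩⟩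

end IsProperCostratifyingSystem

end Transfer

theorem exists_algebra_finite_of_ringEquiv {R : Type*} [CommRing R] {E E' : Type*} [Ring E]
    [Ring E'] [Algebra R E] [Module.Finite R E] (ε : E ≃+* E') :
    ∃ _ : Algebra R E', Module.Finite R E' := by
  let _ : Algebra R E' := (ε.toRingHom.comp (algebraMap R E)).toAlgebra' fun r x => by
    obtain ⟨y, rfl⟩ := ε.surjective x
    change ε _ * ε y = ε y * ε _
    rw [← map_mul, ← map_mul, Algebra.commutes]
  exact ⟨inferInstance, .equiv (AlgEquiv.ofRingEquiv (f := ε) fun _ => rfl).toLinearEquiv⟩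

theorem exists_algebra_finite_endOp (R : Type*) [CommRing R] [IsNoetherianRing R] {A : Type u}
    [Ring A] [Algebra R A] [Module.Finite R A] (S : ModuleCat.{u} A) [Module.Finite A S] :
    ∃ _ : Algebra R (EndOp S), Module.Finite R (EndOp S) := by
  obtain ⟨_, _⟩ := exists_module_isScalarTower R A S
  have : SMulCommClass A R S := IsScalarTower.to_smulCommClass'
  have : Module.Finite R S := .trans A S
  have : Module.Finite R (Module.End A S) := finite_hom_of_isNoetherianRing
  obtain ⟨_, _⟩ := exists_algebra_finite_of_ringEquiv (R := R) S.endRingEquiv.symm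
  exact ⟨inferInstance, .equiv (MulOpposite.opLinearEquiv R)⟩

namespace IsProperCostratifyingSystem

variable {A : Type u} [Ring A] {ι : Type} [Fintype ι] [LinearOrder ι] {Ψ Q : ι → ModuleCat.{u} A}
  {M : ModuleCat.{u} A}

theorem homMap_bijective_Ψ (h : IsProperCostratifyingSystem Ψ Q) (i : ι) {N : ModuleCat.{u} A} :
    Function.Bijective (homMap (sum Q) : (Ψ i →ₗ[A] N) →+ _) :=
  h.homMap_bijective (.of_member (Set.mem_univ i) (.refl ..))

theorem isProperStratification (h : IsProperCostratifyingSystem Ψ Q) :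
    IsProperStratification (ΓΨ Ψ Q) (ΓP Q) where
  finite i := (addClosure.component Q (OrderDual.ofDual i)).finite_hom
  projective i := (addClosure.component Q (OrderDual.ofDual i)).projective_hom
  indec i := (addClosure.component Q (OrderDual.ofDual i)).isIndec_hom
    (indecomposable_iff_isIndec.1 (h.indecomposable (OrderDual.ofDual i)))
  total := nonempty_equiv_pi_ΓP Q
  nontrivial i := by
    have := (h.division (OrderDual.ofDual i)).1
    refine not_subsingleton_iff_nontrivial.1 fun (_ : Subsingleton (sum Q ⟶ _)) => ?_
    exact one_ne_zero ((h.homMap_bijective_Ψ _).1 (LinearMap.ext fun _ => Subsingleton.elim _ _) :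
      (1 : Module.End A (Ψ (OrderDual.ofDual i))) = 0)
  division i φ hφ := by
    obtain ⟨f, rfl⟩ := (h.homMap_bijective_Ψ (OrderDual.ofDual i)).2 φ
    have isUnit : IsUnit f := (h.division (OrderDual.ofDual i)).2 f fun hf =>
      hφ ((congrArg _ hf).trans (map_zero _))
    exact Costrat.homMap_bijective ((Module.End.isUnit_iff f).1 isUnit)
  hom_eq_zero i j hij φ := by
    obtain ⟨f, rfl⟩ := (h.homMap_bijective_Ψ (OrderDual.ofDual i)).2 φ
    have f_eq_zero := h.hom_eq_zero _ _ (OrderDual.ofDual_lt_ofDual.2 hij) f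
    exact (congrArg _ f_eq_zero).trans (map_zero _)
  exists_cover i := by
    obtain ⟨β, hβ, hβk⟩ := h.exists_cover (OrderDual.ofDual i)
    exact ⟨homMap (sum Q) β, h.homMap_surjective hβ hβk,
      (h.isFiltered_hom hβk).of_equiv (nonempty_equiv_ker_homMap β).some⟩

theorem isFiltered_of_addClosure [IsArtinianRing (EndOp (sum Q))]
    (h : IsProperCostratifyingSystem Ψ Q) (hM : addClosure (sum Q) M) :
    IsFiltered Ψ Set.univ M := by
  have hP := h.isProperStratification
  have := hM.finite_hom
  have := hM.projective_hom
  obtain ⟨N, hN, ⟨e⟩⟩ := h.exists_equiv_hom (Y := sum Q ⟶ M)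
    (.of_projective hP.total.some hP.indec fun i => (hP.isFiltered_P i).mono (Set.subset_univ _))
  obtain ⟨e'⟩ := nonempty_tensorFunctor_equiv (V := (homFunctor (sum Q)).obj M)
    (h.counit_bijective hN) e
  exact hN.of_equiv ((LinearEquiv.ofBijective _ hM.counit_bijective).symm ≪≫ₗ e')

theorem finite_sum (h : IsProperCostratifyingSystem Ψ Q) : Module.Finite A (sum Q) := by
  have := h.finite_Q
  exact inferInstanceAs (Module.Finite A (∀ i, Q i))

theorem addClosure_eq [IsArtinianRing (EndOp (sum Q))] (h : IsProperCostratifyingSystem Ψ Q) :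
    addClosure (sum Q) = Filt Ψ ⊓ leftPerpOne (Filt Ψ) := by
  have := h.finite_sum
  ext X
  constructor
  · intro hX
    exact ⟨filt_iff_isFiltered.2 (h.isFiltered_of_addClosure hX), hX.finite, fun Y hY =>
      h.subsingleton_ext hX (filt_iff_isFiltered.1 hY)⟩
  · rintro ⟨hX, -, ext_eq_zero⟩
    obtain ⟨Y, p, hY, hp, hpk⟩ := h.exists_presentation (filt_iff_isFiltered.1 hX)
    obtain ⟨s, hs⟩ := exists_lift_of_subsingleton_ext hp
      (ext_eq_zero (ModuleCat.of A (LinearMap.ker p)) (filt_iff_isFiltered.2 hpk)) LinearMap.id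
    exact hY.of_retract s p hs

theorem full_homFunctor (h : IsProperCostratifyingSystem Ψ Q) :
    ((Filt Ψ).ι ⋙ homFunctor (sum Q)).Full where
  map_surjective {M N} φ := by
    obtain ⟨f, hf⟩ := (h.homMap_bijective (filt_iff_isFiltered.1 M.property)).2 φ.hom
    exact ⟨ObjectProperty.homMk (ModuleCat.ofHom f), ModuleCat.hom_ext hf⟩

theorem faithful_homFunctor (h : IsProperCostratifyingSystem Ψ Q) :
    ((Filt Ψ).ι ⋙ homFunctor (sum Q)).Faithful where
  map_injective {M _} _ _ hfg := ObjectProperty.hom_ext _ <| ModuleCat.hom_ext <|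
    (h.homMap_bijective (filt_iff_isFiltered.1 M.property)).1 (congrArg ModuleCat.Hom.hom hfg)

theorem shortExact_map_homFunctor (h : IsProperCostratifyingSystem Ψ Q)
    {S : ShortComplex (ModuleCat.{u} A)} (hS : S.ShortExact) (h₁ : Filt Ψ S.X₁) :
    (S.map (homFunctor (sum Q))).ShortExact := by
  have exact := (ShortComplex.ShortExact.moduleCat_exact_iff_function_exact S).1 hS.exact
  exact ModuleCat.shortComplex_shortExact _ (homMap_exact hS.moduleCat_injective_f exact)
    (homMap_injective hS.moduleCat_injective_f)
    (h.homMap_surjective hS.moduleCat_surjective_g ((filt_iff_isFiltered.1 h₁).of_equiv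
      (kerEquivOfExact hS.moduleCat_injective_f exact).symm))

section Equivalence

variable [IsArtinianRing (EndOp (sum Q))]

theorem filt_homFunctor_obj (h : IsProperCostratifyingSystem Ψ Q) (hM : Filt Ψ M) :
    Filt (properStandard (ΓP Q)) ((homFunctor (sum Q)).obj M) :=
  h.isProperStratification.filt_properStandard_iff.2 (h.isFiltered_hom (filt_iff_isFiltered.1 hM))

theorem filt_tensorFunctor_obj (h : IsProperCostratifyingSystem Ψ Q)
    {N : ModuleCat.{u} (EndOp (sum Q))} (hN : Filt (properStandard (ΓP Q)) N) :
    Filt Ψ ((tensorFunctor (sum Q)).obj N) := by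
  obtain ⟨M, hM, ⟨e⟩⟩ :=
    h.exists_equiv_hom (h.isProperStratification.filt_properStandard_iff.1 hN)
  obtain ⟨e'⟩ := nonempty_tensorFunctor_equiv (h.counit_bijective hM) e
  exact filt_iff_isFiltered.2 (hM.of_equiv e')

/-- The functor from `Ψ`-filtered modules to modules filtered by the proper standard modules over
`EndOp (sum Q)` that is induced by `Hom(Q, -)`. -/
abbrev filtHomFunctor (h : IsProperCostratifyingSystem Ψ Q) :
    (Filt Ψ).FullSubcategory ⥤ (Filt (properStandard (ΓP Q))).FullSubcategory :=
  (Filt (properStandard (ΓP Q))).lift ((Filt Ψ).ι ⋙ homFunctor (sum Q))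
    fun M => h.filt_homFunctor_obj M.property

/-- The functor from modules over `EndOp (sum Q)` filtered by the proper standard modules to
`Ψ`-filtered modules that is induced by `Q ⊗ -`. -/
abbrev filtTensorFunctor (h : IsProperCostratifyingSystem Ψ Q) :
    (Filt (properStandard (ΓP Q))).FullSubcategory ⥤ (Filt Ψ).FullSubcategory :=
  (Filt Ψ).lift ((Filt (properStandard (ΓP Q))).ι ⋙ tensorFunctor (sum Q))
    fun N => h.filt_tensorFunctor_obj N.property

theorem isEquivalence_filtHomFunctor (h : IsProperCostratifyingSystem Ψ Q) :
    h.filtHomFunctor.IsEquivalence where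
  full := by
    have := h.full_homFunctor
    infer_instance
  faithful := by
    have := h.faithful_homFunctor
    infer_instance
  essSurj := ⟨fun N => by
    obtain ⟨M, hM, ⟨e⟩⟩ :=
      h.exists_equiv_hom (h.isProperStratification.filt_properStandard_iff.1 N.property)
    refine ⟨⟨M, filt_iff_isFiltered.2 hM⟩, ⟨ObjectProperty.isoMk _ ?_⟩⟩
    exact (LinearEquiv.toModuleIso (X₂ := ((homFunctor (sum Q)).obj M : Type u)) e).symm⟩

theorem nonempty_filtHomFunctor_comp_iso (h : IsProperCostratifyingSystem Ψ Q) :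
    Nonempty (h.filtHomFunctor ⋙ h.filtTensorFunctor ≅ 𝟭 _) :=
  ⟨NatIso.ofComponents
    (fun M => ObjectProperty.isoMk _ (LinearEquiv.ofBijective _
      (h.counit_bijective (filt_iff_isFiltered.1 M.property))).toModuleIso)
    fun f => ObjectProperty.hom_ext _ (ModuleCat.hom_ext (counit_naturality f.hom))⟩

theorem isExactEquivalence (h : IsProperCostratifyingSystem Ψ Q) :
    IsExactEquivalenceWithQuasiInverse (Filt Ψ) (Filt (properStandard (ΓP Q)))
      (homFunctor (sum Q)) (tensorFunctor (sum Q)) := by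
  have isEquivalence := h.isEquivalence_filtHomFunctor
  obtain ⟨iso⟩ := h.nonempty_filtHomFunctor_comp_iso
  let E := h.filtHomFunctor.asEquivalence
  have tensor_iso_inverse : h.filtTensorFunctor ≅ E.inverse :=
    Iso.isoInverseComp (G := E) iso ≪≫ E.inverse.rightUnitor
  exact ⟨fun M => h.filt_homFunctor_obj M.property, fun N => h.filt_tensorFunctor_obj N.property,
    isEquivalence, fun S h₁ _ _ hS => h.shortExact_map_homFunctor hS h₁, ⟨iso⟩,
    ⟨Functor.isoWhiskerRight tensor_iso_inverse h.filtHomFunctor ≪≫ E.counitIso⟩⟩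

end Equivalence

end IsProperCostratifyingSystem

end

end Costrat

open Costrat in
theorem mainTheorem1_general {R : Type w} [CommRing R] [IsArtinianRing R]
    {A : Type u} [Ring A] {ι : Type} [Fintype ι] [LinearOrder ι] (Ψ Q : ι → ModuleCat.{u} A)
    [Algebra R (EndOp (sum Q))] [Module.Finite R (EndOp (sum Q))]
    (h : IsProperCostratifyingSystem Ψ Q) :
    (IsRepresentativeSet (ΓP Q) ∧ IsBasic (EndOp (sum Q)) ∧
      Module.rank ℤ (K0 (EndOp (sum Q))) = (Fintype.card ι : Cardinal)) ∧
    IsExactEquivalenceWithQuasiInverse (Filt Ψ) (Filt (properStandard (ΓP Q)))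
      (homFunctor (sum Q)) (tensorFunctor (sum Q)) ∧
    (∀ i : ι, Nonempty ((homFunctor (sum Q)).obj (Ψ i) ≅
      properStandard (ΓP Q) (OrderDual.toDual i))) ∧
    IsStandardlyStratified (fun i : ιᵒᵈ => dual (ΓP Q i)) ∧
    addClosure (sum Q) = Filt Ψ ⊓ leftPerpOne (Filt Ψ) ∧
    IsResolving (Filt (properStandard (ΓP Q))) ∧
    (Filt (properStandard (ΓP Q))).IsStableUnderRetracts := by
  have : IsArtinianRing (EndOp (sum Q)) := .of_finite R _
  have : IsArtinianRing (EndOp (sum Q))ᵐᵒᵖ := .of_finite R _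
  have hP := h.isProperStratification
  have representatives := hP.isRepresentativeSet
  have finite_hom (i j) :
      Module.Finite (Module.End (EndOp (sum Q)) (ΓΨ Ψ Q j))
        (ΓP Q i →ₗ[EndOp (sum Q)] ΓΨ Ψ Q j) := by
    have := hP.finite i
    have := hP.finite_Ψ j
    exact finite_end_hom R _ _
  exact ⟨⟨representatives, representatives.isBasic hP.total.some,
      representatives.rank_K0 hP.total.some⟩, h.isExactEquivalence,
    fun i => ⟨(hP.nonempty_equiv_properStandard (OrderDual.toDual i)).some.toModuleIso⟩,
    hP.isStandardlyStratified_dual, h.addClosure_eq, hP.isResolving, hP.isStableUnderRetracts⟩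

theorem mainTheorem1 {R : Type w} [CommRing R] [IsArtinianRing R]
    {Λ : Type u} [Ring Λ] [Algebra R Λ] [Module.Finite R Λ]
    {ι : Type} [Fintype ι] [LinearOrder ι] (Ψ Q : ι → ModuleCat.{u} Λ)
    (h : Costrat.IsProperCostratifyingSystem Ψ Q) :
    -- (a)
    (Costrat.IsRepresentativeSet (Costrat.ΓP Q) ∧
      Costrat.IsBasic (Costrat.EndOp (Costrat.sum Q)) ∧
      Module.rank ℤ (Costrat.K0 (Costrat.EndOp (Costrat.sum Q))) = (Fintype.card ι : Cardinal)) ∧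
    -- (b)
    Costrat.IsExactEquivalenceWithQuasiInverse (Costrat.Filt Ψ)
      (Costrat.Filt (Costrat.properStandard (Costrat.ΓP Q)))
      (Costrat.homFunctor (Costrat.sum Q)) (Costrat.tensorFunctor (Costrat.sum Q)) ∧
    -- (c)
    (∀ i : ι, Nonempty ((Costrat.homFunctor (Costrat.sum Q)).obj (Ψ i) ≅
      Costrat.properStandard (Costrat.ΓP Q) (OrderDual.toDual i))) ∧
    -- (d)
    Costrat.IsStandardlyStratified (fun i : ιᵒᵈ => Costrat.dual (Costrat.ΓP Q i)) ∧
    -- (e)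
    Costrat.addClosure (Costrat.sum Q) =
      Costrat.Filt Ψ ⊓ Costrat.leftPerpOne (Costrat.Filt Ψ) ∧
    -- (f)
    Costrat.IsResolving (Costrat.Filt (Costrat.properStandard (Costrat.ΓP Q))) ∧
    (Costrat.Filt (Costrat.properStandard (Costrat.ΓP Q))).IsStableUnderRetracts := by
  have := h.finite_sum
  obtain ⟨_, _⟩ := Costrat.exists_algebra_finite_endOp R (Costrat.sum Q)
  exact mainTheorem1_general (R := R) Ψ Q h
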